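/- **Model.** A cloud stores an input $X\in\{0,1\}^n$; $k$ machines with IDs $1,\dots,k$ ($1\le k\le n$, $n\ge 2$) form a complete network. Time proceeds in synchronous rounds. In each round a machine first poses at most $n$ queries to the cloud, each asking either for an input bit $x_i$ or for the value $\mathrm{RG}(s)$, $s\in\mathbb N$, of a global random bit (the same fair bit for all machines that ask for the same $s$; different bits are independent), receives the answers, and then sends at most one message of $O(\log n)$ bits to each other machine. Machines also have private random bits. The adversary is static: before any random bit is drawn it chooses $X$ and a set of at most $\beta k$ Byzantine machines ($0\le\beta<1$, $\beta$ known to the algorithm); the Byzantine machines then behave arbitrarily, possibly depending on all random bits. Put $\gamma=1-\beta$. The Download problem requires every honest machine to output $X$. For an execution, $\mathcal Q$ is the maximum number of queries (of both kinds) posed by an honest machine, $\mathcal T$ the number of rounds until all honest machines have terminated, and $\mathcal M$ the total number of messages sent by honest machines. **Algorithm Parallel_Download** ($\log=\log_2$). *Forest.* Take $\min(\lceil n/k\rceil,k)$ copies of the complete $(\lceil n/k\rceil+1)$-ary tree (all levels but the deepest are full, the deepest one is filled from the left) with exactly $\lceil k^2/n\rceil$ leaves in which every nonleaf node has at least two children.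 Let $\nu$ be the total number of nodes. Partition $[1,n]$ into consecutive blocks of almost equal length, one for each leaf $v$, called $I_v$; for a nonleaf node $v$ let $I_v$ be the union of $I_c$ over its children $c$. The level of a node is the height of its subtree, leaves having level $1$; let $H$ be the level of the roots. *Election.* Let $\sigma=\lceil 9\log n/\gamma\rceil$. Using global random bits (fetched $n$ per round), all machines draw $\sigma$ independent hash functions $h_1,\dots,h_\sigma$ on the set of nodes, each a uniformly random polynomial of degree less than $\sigma$ over the field with $2^m$ elements, $m=\lceil\log(n\max(\nu,k))\rceil+1$, evaluated at the field element that stands for the node and then reduced modulo $k$ to a machine ID. The committee of node $v$ is $\mathcal C_v=\{h_1(v),\dots,h_\sigma(v)\}$. *Convergecast.* In one round, every member of a leaf committee $\mathcal C_v$ queries all bits of $I_v$. Then, for $i=2,\dots,H$ in turn, and in parallel for all nodes $v$ of level $i$ and all children $c$ of $v$, every machine in $\mathcal C_v$ executes Weak_Resolve$(\mathcal C_c,I_c)$. *Distribution.* In parallel for all roots $v$, every machine executes Weak_Resolve$(\mathcal C_v,I_v)$, and then terminates with the array of bits it has learned. *Weak_Resolve$(\mathcal C,I)$, executed by machine $M$.*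 Every member of $\mathcal C$ other than $M$ sends to $M$ its bit for each $j\in I$, one bit per round; a machine that belongs to several reporting committees serves these one after the other, in a schedule known to all. Then $M$, starting with an empty blacklist, goes through the indices $j\in I$ in increasing order, one per round: if two members of $\mathcal C$ that are not blacklisted reported different bits for $j$ (members that sent no valid bit are disregarded, and $M$ uses its own bit if $M\in\mathcal C$), then $M$ queries $x_j$ and blacklists all members that reported the wrong bit; otherwise it adopts the bit reported by the members that are not blacklisted. **Theorem.** There is an absolute constant $C>0$ such that for all $n\ge2$, $1\le k\le n$ and $0\le\beta<1$, and against every static adversary as above, with probability at least $1-C/n$ Algorithm Parallel_Download solves the Download problem with $$\mathcal Q\le C\,\frac{n\log^3 n}{\gamma^3k},\qquad \mathcal T\le C\Bigl(\frac nk+k\Bigr)\frac{\log^2n}{\gamma^2},\qquad \mathcal M\le C\Bigl(\frac{nk\log n}{\gamma}+\frac{n\log k\,\log^2n}{\gamma^2}\Bigr).$$ -/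

import Mathlib

namespace CCA

/-! ## The model: a congested clique of `k` machines assisted by a cloud holding `n` bits -/

/-- A cloud query: either an input bit, or the `s`-th global random bit. -/
inductive Query (n : ℕ) where
  | input (i : Fin n) : Query n
  | random (s : ℕ) : Query n
  deriving DecidableEq

/-- Machine-machine messages: bit strings of length `O(log n)`. -/
abbrev Message (n : ℕ) : Type := {l : List Bool // l.length ≤ Nat.clog 2 n + 1}

/-- An outcome of all coin tosses: the coordinate `Sum.inl s` is the answer of the cloud's random
bit generator to the parameter `s`, and `Sum.inr (M, s)` is the `s`-th private coin of machine `M`. -/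
abbrev Coins (k : ℕ) : Type := ℕ ⊕ (Fin k × ℕ) → Bool

/-- All coins are fair and independent. -/
noncomputable def coinMeasure (k : ℕ) : MeasureTheory.Measure (Coins k) :=
  MeasureTheory.Measure.infinitePi fun _ => (PMF.uniformOfFintype Bool).toMeasure

/-- A synchronous algorithm for the problem of learning the whole input. In each round a machine
that has not yet produced its output poses a set of at most `n` queries, updates its state by the
answers, sends at most one message to each other machine, and updates its state by the messages
received. A machine whose state has an output has terminated. -/
structure Algorithm (n k : ℕ) where
  State : Type
  /-- The initial state of the machine with the given ID and the given private coins. -/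
  start : Fin k → (ℕ → Bool) → State
  queries : State → Finset (Query n)
  queries_card_le : ∀ s, (queries s).card ≤ n
  /-- Update by the answers; queries that were not posed have the answer `none`. -/
  answer : State → (Query n → Option Bool) → State
  send : State → Fin k → Option (Message n)
  receive : State → (Fin k → Option (Message n)) → State
  output : State → Option (Fin n → Bool)

/-- A static adversary. The input and the set of at most `β k` Byzantine machines are chosen before
any coin is tossed. The messages sent by the Byzantine machines are arbitrary: they may depend on
all coins, hence on everything that happens in the execution. (`behaviour ω t M M'` is what `M`
sends to `M'` in round `t`.) -/
structure StaticAdversary (n k : ℕ) (β : ℝ) where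
  input : Fin n → Bool
  byzantine : Finset (Fin k)
  card_byzantine_le : (byzantine.card : ℝ) ≤ β * k
  behaviour : Coins k → ℕ → Fin k → Fin k → Option (Message n)

section Execution

variable {n k : ℕ} {β : ℝ} (A : Algorithm n k) (adv : StaticAdversary n k β) (ω : Coins k)

/-- The cloud's reply to a query. -/
def cloud : Query n → Bool
  | .input i => adv.input i
  | .random s => ω (Sum.inl s)

/-- The state of a running machine at the end of the query sub-round. -/
def afterQueries (s : A.State) : A.State :=
  A.answer s fun q => if q ∈ A.queries s then some (cloud adv ω q) else none

/-- The message from `M` to `M'` in round `t`, if `c` holds the states of the machines at the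
beginning of the round. -/
def message (c : Fin k → A.State) (t : ℕ) (M M' : Fin k) : Option (Message n) :=
  if M = M' then none
  else if M ∈ adv.byzantine then adv.behaviour ω t M M'
  else if (A.output (c M)).isSome then none
  else A.send (afterQueries A adv ω (c M)) M'

/-- The states at the beginning of round `t`. Those of Byzantine machines are never used. -/
def states : ℕ → Fin k → A.State
  | 0 => fun M => A.start M fun s => ω (Sum.inr (M, s))
  | t + 1 => fun M =>
      if (A.output (states t M)).isSome then states t M
      else A.receive (afterQueries A adv ω (states t M))
        fun M' => message A adv ω (states t) t M' M

/-- The number of queries posed by machine `M` in the first `t` rounds. -/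
def queryCount (t : ℕ) (M : Fin k) : ℕ :=
  ∑ r ∈ Finset.range t,
    if (A.output (states A adv ω r M)).isSome then 0
    else (A.queries (states A adv ω r M)).card

/-- The number of messages sent by honest machines in the first `t` rounds. -/
def messageCount (t : ℕ) : ℕ :=
  ∑ r ∈ Finset.range t, ∑ M ∈ adv.byzantineᶜ,
    (Finset.univ.filter fun M' => (message A adv ω (states A adv ω r) r M M').isSome).card

/-- In this execution every honest machine terminates after at most `T` rounds and outputs the
input array, no honest machine ever poses more than `Q` queries, and the honest machines send at
most `M` messages altogether. -/
def DownloadsWithin (Q T M : ℝ) : Prop :=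
  (∃ t : ℕ, (t : ℝ) ≤ T ∧ ∀ m ∉ adv.byzantine, A.output (states A adv ω t m) = some adv.input) ∧
  (∀ t : ℕ, ∀ m ∉ adv.byzantine, (queryCount A adv ω t m : ℝ) ≤ Q) ∧
  (∀ t : ℕ, (messageCount A adv ω t : ℝ) ≤ M)

end Execution

/-! ## The public convergecast forest

Each tree is a complete `arity`-ary tree: its nodes are numbered `0, …, treeSize - 1` level by
level, the root being `0`, and the children of `p` are `arity * p + c + 1` for `c < arity`, as far
as these are below `treeSize`. The nodes below `treeInner` are the nonleaf nodes. The sizes are such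
that there are `treeLeaves` leaves and that every nonleaf node has at least two children. -/

section Forest

variable (n k : ℕ)

def arity : ℕ := n ⌈/⌉ k + 1

def treeLeaves : ℕ := k ^ 2 ⌈/⌉ n

def treeInner : ℕ := (treeLeaves n k - 1) ⌈/⌉ (arity n k - 1)

def treeSize : ℕ := treeLeaves n k + treeInner n k

def numTrees : ℕ := min (n ⌈/⌉ k) k

/-- A node of the forest: the number of its tree and its number within the tree. -/
abbrev Node : Type := Fin (numTrees n k) × Fin (treeSize n k)

/-- The number `ν` of nodes of the forest. -/
def numNodes : ℕ := numTrees n k * treeSize n k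

/-- The predefined numbering of the nodes of the forest by `0, …, ν - 1`. -/
def nodeNumber (v : Node n k) : ℕ := v.1 * treeSize n k + v.2

/-- All nodes, in a fixed order. -/
def nodes : List (Node n k) :=
  (List.finRange (numTrees n k)).flatMap fun a => (List.finRange (treeSize n k)).map fun p => (a, p)

/-- The level of node `p` of a tree, i.e. the height of its subtree; leaves have level `1`. -/
def level (p : ℕ) : ℕ :=
  1 + (Finset.range (arity n k)).sup fun c =>
    if h : p < arity n k * p + c + 1 ∧ arity n k * p + c + 1 < treeSize n k then
      level (arity n k * p + c + 1) else 0
termination_by treeSize n k - p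
decreasing_by omega

/-- The height of the forest (all its trees are equal). -/
def forestHeight : ℕ := level n k 0

/-- The parent of a node; `none` for a root. -/
def parent (v : Node n k) : Option (Node n k) :=
  if (v.2 : ℕ) = 0 then none
  else some (v.1, ⟨((v.2 : ℕ) - 1) / arity n k,
    lt_of_le_of_lt ((Nat.div_le_self _ _).trans (Nat.sub_le _ _)) v.2.isLt⟩)

def IsLeaf (v : Node n k) : Prop := treeInner n k ≤ (v.2 : ℕ)

instance (v : Node n k) : Decidable (IsLeaf n k v) := inferInstanceAs (Decidable (_ ≤ _))

/-- The indices are partitioned into consecutive blocks of almost equal length, one for each leaf of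
the forest; this is the block of the leaf with number `l` among all the leaves. -/
def block (l : ℕ) : Finset (Fin n) :=
  Finset.univ.filter fun j => (j : ℕ) * (numTrees n k * treeLeaves n k) / n = l

/-- The indices assigned to node `p` of tree `a`: a leaf gets its block, and a nonleaf node gets the
union of what its children get. -/
def assigned (a p : ℕ) : Finset (Fin n) :=
  if treeInner n k ≤ p then block n k (a * treeLeaves n k + (p - treeInner n k))
  else (Finset.range (arity n k)).biUnion fun c =>
    if h : p < arity n k * p + c + 1 ∧ arity n k * p + c + 1 < treeSize n k then
      assigned a (arity n k * p + c + 1) else ∅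
termination_by treeSize n k - p
decreasing_by omega

/-- The increasing list of the indices assigned to a node. -/
def indexList (v : Node n k) : List (Fin n) :=
  (List.finRange n).filter fun j => j ∈ assigned n k v.1 v.2

/-- The phase in which the committee of `v` reports what it knows. The nonleaf nodes of level `i`
learn from their children in phase `i`, for `i = 2, …, forestHeight`, and then all machines learn
from the roots in phase `forestHeight + 1`. -/
def reportPhase (v : Node n k) : ℕ :=
  match parent n k v with
  | some u => level n k u.2
  | none => forestHeight n k + 1

/-- The largest number of indices that a node has to report in phase `i`. -/
def width (i : ℕ) : ℕ :=
  (Finset.univ.filter fun v : Node n k => reportPhase n k v = i).sup fun v =>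
    (indexList n k v).length

end Forest

/-! ## Election of public committees by hashing -/

section Election

variable (n k : ℕ) (β : ℝ)

/-- The number `σ = ⌈9 log n / γ⌉` of hash functions, with `γ = 1 - β`. -/
noncomputable def committeeSize : ℕ := ⌈9 * Real.logb 2 n / (1 - β)⌉₊

/-- The hash functions are computed in the field with `2 ^ wordLength` elements. -/
def wordLength : ℕ := Nat.clog 2 (n * max (numNodes n k) k) + 1

/-- A fixed bijection between the field and the words of length `wordLength`, read as numbers. -/
noncomputable def fieldEquiv : GaloisField 2 (wordLength n k) ≃ Fin (2 ^ wordLength n k) :=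
  Finite.equivFinOfCardEq (GaloisField.card 2 (wordLength n k) (Nat.succ_ne_zero _))

noncomputable def toField (x : ℕ) : GaloisField 2 (wordLength n k) :=
  (fieldEquiv n k).symm ⟨x % 2 ^ wordLength n k, Nat.mod_lt _ (by positivity)⟩

/-- The number whose binary digits are the `l`-th block of `wordLength` random bits. -/
def randomWord (bits : ℕ → Bool) (l : ℕ) : ℕ :=
  ∑ i ∈ Finset.range (wordLength n k), if bits (l * wordLength n k + i) then 2 ^ i else 0

/-- The `u`-th hash function at the node `v`: a random polynomial of degree less than `σ` is
evaluated at (the field element that stands for) `v`, and the result is reduced modulo `k`. -/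
noncomputable def hash (bits : ℕ → Bool) (u : ℕ) (v : Node n k) : ℕ :=
  (fieldEquiv n k (∑ e ∈ Finset.range (committeeSize n β),
    toField n k (randomWord n k bits (u * committeeSize n β + e)) *
      toField n k (nodeNumber n k v) ^ e) : ℕ) % k

/-- The committee of the node `v`. -/
noncomputable def committee (bits : ℕ → Bool) (v : Node n k) : Finset (Fin k) :=
  Finset.univ.filter fun M => ∃ u < committeeSize n β, hash n k β bits u v = M

/-- The number of global random bits used by the election. -/
noncomputable def numRandomBits : ℕ := committeeSize n β * committeeSize n β * wordLength n k

/-- The random bits are fetched `n` at a time. -/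
noncomputable def electionRounds : ℕ := numRandomBits n k β ⌈/⌉ n

end Election

/-! ## The rounds after the election, for given committees -/

/-- What is done in a round. -/
inductive Instruction where
  /-- Fetch the `r`-th batch of random bits. -/
  | elect (r : ℕ)
  /-- The members of the leaf committees query the indices of their leaves. -/
  | queryLeaves
  /-- Slot `s` of the transmission of the reports of phase `i`. -/
  | report (i s : ℕ)
  /-- Phase `i`: the `t`-th index of each reporting committee is resolved. -/
  | resolve (i t : ℕ)

section Protocol

variable {n k : ℕ} (com : Node n k → Finset (Fin k))

/-- The machines that learn from the committee of `v`: those of the parent committee or, for a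
root, all. -/
def recipients (v : Node n k) : Finset (Fin k) :=
  match parent n k v with
  | some u => com u
  | none => Finset.univ

/-- The nodes to whose committees `M` belongs and that report in phase `i`. -/
def duties (i : ℕ) (M : Fin k) : List (Node n k) :=
  (nodes n k).filter fun v => reportPhase n k v = i ∧ M ∈ com v

/-- The largest number of duties that a machine has in phase `i`. -/
def maxDuties (i : ℕ) : ℕ := Finset.univ.sup fun M => (duties com i M).length

/-- The node and the index reported by machine `M` in slot `s` of phase `i`: it serves its duties
one after the other, spending `width i` slots on each. -/
def slot (i s : ℕ) (M : Fin k) : Option (Node n k × Fin n) :=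
  ((duties com i M)[s / width n k i]?).bind fun v =>
    ((indexList n k v)[s % width n k i]?).map fun j => (v, j)

/-- The instructions after the election, one for each round. -/
def program : List Instruction :=
  Instruction.queryLeaves ::
    (List.range' 2 (forestHeight n k)).flatMap fun i =>
      (List.range (maxDuties com i * width n k i)).map (Instruction.report i) ++
        (List.range (width n k i)).map (Instruction.resolve i)

/-- The local state of a machine. -/
structure LocalState (n k : ℕ) where
  self : Fin k
  /-- The number of rounds completed. -/
  clock : ℕ
  /-- The global random bits fetched so far. -/
  bits : ℕ → Bool
  /-- The array of bits learned (with the default value `false`). -/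
  res : Fin n → Bool
  /-- `reports v M j` is the value for index `j` received from `M` as a member of committee `v`. -/
  reports : Node n k → Fin k → Fin n → Option Bool
  /-- The members of committee `v` that have been blacklisted. -/
  blacklist : Node n k → Finset (Fin k)

variable (st : LocalState n k)

/-- What machine `M`, as a member of committee `v`, says about index `j`. A machine that is itself
in the committee uses its own value. -/
def claim (v : Node n k) (M : Fin k) (j : Fin n) : Option Bool :=
  if M = st.self then some (st.res j) else st.reports v M j

/-- Some member of committee `v` that is not blacklisted says that the bit at `j` is `b`. -/
def Claimed (v : Node n k) (j : Fin n) (b : Bool) : Prop :=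
  ∃ M ∈ com v \ st.blacklist v, claim st v M j = some b

instance (v : Node n k) (j : Fin n) (b : Bool) : Decidable (Claimed com st v j b) :=
  inferInstanceAs (Decidable (∃ M ∈ com v \ st.blacklist v, claim st v M j = some b))

/-- The members of committee `v` that are not blacklisted disagree about index `j`. -/
def Conflict (v : Node n k) (j : Fin n) : Prop :=
  Claimed com st v j true ∧ Claimed com st v j false

instance (v : Node n k) (j : Fin n) : Decidable (Conflict com st v j) :=
  inferInstanceAs (Decidable (_ ∧ _))

/-- At step `t` of phase `i`, the machine resolves index `j` by the claims of committee `v`. -/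
def Resolves (i t : ℕ) (v : Node n k) (j : Fin n) : Prop :=
  reportPhase n k v = i ∧ st.self ∈ recipients com v ∧ (indexList n k v)[t]? = some j

instance (i t : ℕ) (v : Node n k) (j : Fin n) : Decidable (Resolves com st i t v j) :=
  inferInstanceAs (Decidable (_ ∧ _ ∧ _))

/-- The indices queried by a machine that resolves: those on which there is a conflict. -/
def conflicts (i t : ℕ) : Finset (Fin n) :=
  Finset.univ.filter fun j => ∃ v : Node n k, Resolves com st i t v j ∧ Conflict com st v j

/-- The indices of the leaves to whose committees the machine belongs. -/
def leafIndices : Finset (Fin n) :=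
  Finset.univ.filter fun j => ∃ v : Node n k,
    IsLeaf n k v ∧ st.self ∈ com v ∧ j ∈ indexList n k v

/-- One step of all the invocations of the weak resolution procedure that run in parallel. A queried
index gets the value returned by the cloud, and those who claimed the opposite are blacklisted; any
other index gets the value on which the claims agree. -/
def resolveStep (i t : ℕ) (ans : Query n → Option Bool) : LocalState n k :=
  { st with
    res := fun j =>
      match ans (Query.input j) with
      | some b => b
      | none =>
        match (nodes n k).find? fun v => Resolves com st i t v j with
        | some v => decide (Claimed com st v j true)
        | none => st.res j
    blacklist := fun v => st.blacklist v ∪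
      (com v).filter fun M => ∃ j, Resolves com st i t v j ∧
        ∃ b, ans (Query.input j) = some b ∧ claim st v M j = some (!b) }

/-- A single bit as a message. -/
def bitMessage (n : ℕ) (b : Bool) : Message n := ⟨[b], by simp⟩

/-- Only messages that consist of a single bit are accepted. -/
def readBit (m : Message n) : Option Bool :=
  match m.1 with
  | [b] => some b
  | _ => none

/-- Store the reports received in slot `s` of phase `i`. -/
def storeReports (i s : ℕ) (inbox : Fin k → Option (Message n)) : LocalState n k :=
  { st with
    reports := fun v M j =>
      if slot com i s M = some (v, j) ∧ st.self ∈ recipients com v then (inbox M).bind readBit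
      else st.reports v M j }

end Protocol

/-! ## The algorithm -/

section ParallelDownload

variable (n k : ℕ) (β : ℝ)

/-- What the machine does in the current round; `none` if it has finished. -/
noncomputable def currentInstruction (st : LocalState n k) : Option Instruction :=
  if st.clock < electionRounds n k β then some (Instruction.elect st.clock)
  else (program (committee n k β st.bits))[st.clock - electionRounds n k β]?

noncomputable def pdQueries (st : LocalState n k) : Finset (Query n) :=
  match currentInstruction n k β st with
  | some (Instruction.elect r) =>
      ((Finset.range n).filter fun s => r * n + s < numRandomBits n k β).image
        fun s => Query.random (r * n + s)
  | some Instruction.queryLeaves => (leafIndices (committee n k β st.bits) st).image Query.input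
  | some (Instruction.resolve i t) =>
      (conflicts (committee n k β st.bits) st i t).image Query.input
  | _ => ∅

theorem pdQueries_card_le (st : LocalState n k) : (pdQueries n k β st).card ≤ n := by
  unfold pdQueries
  split
  · exact Finset.card_image_le.trans ((Finset.card_filter_le _ _).trans (by simp))
  · exact Finset.card_image_le.trans ((Finset.card_le_univ _).trans (by simp))
  · exact Finset.card_image_le.trans ((Finset.card_le_univ _).trans (by simp))
  · simp

noncomputable def pdAnswer (st : LocalState n k) (ans : Query n → Option Bool) : LocalState n k :=
  match currentInstruction n k β st with
  | some (Instruction.elect _) =>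
      { st with bits := fun s => (ans (Query.random s)).getD (st.bits s) }
  | some Instruction.queryLeaves =>
      { st with res := fun j => (ans (Query.input j)).getD (st.res j) }
  | some (Instruction.resolve i t) => resolveStep (committee n k β st.bits) st i t ans
  | _ => st

noncomputable def pdSend (st : LocalState n k) (M : Fin k) : Option (Message n) :=
  match currentInstruction n k β st with
  | some (Instruction.report i s) =>
      (slot (committee n k β st.bits) i s st.self).bind fun x =>
        if M ∈ recipients (committee n k β st.bits) x.1 then some (bitMessage n (st.res x.2))
        else none
  | _ => none

noncomputable def pdReceive (st : LocalState n k) (inbox : Fin k → Option (Message n)) :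
    LocalState n k :=
  match currentInstruction n k β st with
  | some (Instruction.report i s) =>
      { storeReports (committee n k β st.bits) st i s inbox with clock := st.clock + 1 }
  | _ => { st with clock := st.clock + 1 }

/-- The algorithm `Parallel_Download` for `n` bits, `k` machines and the bound `β` on the fraction
of Byzantine machines. -/
noncomputable def parallelDownload : Algorithm n k where
  State := LocalState n k
  start M _ :=
    { self := M
      clock := 0
      bits := fun _ => false
      res := fun _ => false
      reports := fun _ _ _ => none
      blacklist := fun _ => ∅ }
  queries := pdQueries n k β
  queries_card_le := pdQueries_card_le n k β
  answer := pdAnswer n k β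
  send := pdSend n k β
  receive := pdReceive n k β
  output st := if (currentInstruction n k β st).isNone then some st.res else none

end ParallelDownload

end CCA

namespace CCA

/-! ## Sizes of the forest -/

/-! Call the election good (`GoodElection`) if every committee has an honest member and no machine
sits in more than σ² committees. For each single outcome of the coins with a good election,
correctness and all cost bounds hold whatever the Byzantine machines send, so their knowledge of the
coins does not help them. It remains to see that a bad election has probability O(1/n).

Correctness. Honest members of a reporting committee report the truth, and a member is blacklisted
only for contradicting the cloud, so honest members never are. At each index either the surviving
claims conflict and the cloud decides, or they all agree with an honest one (`resolve_res_eq`).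
Induction over the phases carries this from the leaves to the roots and then to all machines
(`phaseInvariant_phaseStart`, `output_eq`).

Queries. Each index queried because of a conflict adds a machine to some blacklist
(`card_conflicts_le`). So their number is at most the total size of the committees from which a
machine learns: those of the roots and of the children of its at most σ² nodes. With committees of
size at most σ and O(n/k) roots and children per node, this is O(σ³ n/k).

Rounds. A phase lasts at most σ² + 1 times its width, and the widths are dominated by a geometric
sequence with sum O(n/k + k) (`sum_width_le`).

Messages. Nodes that report in the same phase have disjoint index sets (`node_unique`), so a phase
costs at most nσ times the number of recipients of a node: σ in each of the O(log k) convergecast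
phases, k in the last phase.

Probability. A random polynomial of degree less than σ has independent uniform values at up to σ
points (`density_evalCoeffs`). The field has at least 4k elements, so after reduction modulo k a
value names a Byzantine machine with probability at most 1 - 3γ/4 and a given machine with
probability at most 2/k. A given committee is wholly Byzantine with probability at most (1 - 3γ/4)^σ
≤ n⁻², and there are at most 8k nodes. A machine in more than σ² committees is the value of one hash
function at σ nodes; the union bound σ k C(8k, σ) (2/k)^σ ≤ σ n 16^σ / σ! is O(1/n). -/

theorem le_mul_ceilDiv (a : ℕ) {b : ℕ} (hb : 0 < b) : a ≤ b * (a ⌈/⌉ b) :=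
  (ceilDiv_le_iff_le_mul hb).1 le_rfl

theorem mul_ceilDiv_lt (a : ℕ) {b : ℕ} (hb : 0 < b) : b * (a ⌈/⌉ b) < a + b := by
  rw [Nat.ceilDiv_eq_add_pred_div]
  have := Nat.mul_div_le (a + b - 1) b
  omega

section Forest

variable {n k : ℕ}

theorem ceilDiv_pos_of_pos {a b : ℕ} (ha : 0 < a) (hb : 0 < b) : 0 < a ⌈/⌉ b := by
  have := le_mul_ceilDiv a hb
  exact Nat.pos_of_mul_pos_left (lt_of_lt_of_le ha this)

theorem treeLeaves_pos (hk : 1 ≤ k) (hkn : k ≤ n) : 0 < treeLeaves n k :=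
  ceilDiv_pos_of_pos (by positivity) (by omega)

theorem numTrees_pos (hk : 1 ≤ k) (hkn : k ≤ n) : 0 < numTrees n k :=
  lt_min (ceilDiv_pos_of_pos (by omega) (by omega)) (by omega)

theorem two_le_arity (hk : 1 ≤ k) (hkn : k ≤ n) : 2 ≤ arity n k := by
  have : 0 < n ⌈/⌉ k := ceilDiv_pos_of_pos (by omega) (by omega)
  unfold arity; omega

theorem treeLeaves_le (hk : 1 ≤ k) (hkn : k ≤ n) : treeLeaves n k ≤ k := by
  refine (ceilDiv_le_iff_le_mul (by omega)).2 ?_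
  nlinarith

/-- Without the cap on the number of trees, the two rounded factors are at least n/k and k²/n; with
it, k trees have a leaf each. -/
theorem le_numLeaves (hk : 1 ≤ k) (hkn : k ≤ n) : k ≤ numTrees n k * treeLeaves n k := by
  have h1 := treeLeaves_pos hk hkn
  unfold numTrees
  rcases min_choice (n ⌈/⌉ k) k with h | h <;> rw [h]
  · have h2 := le_mul_ceilDiv n (show 0 < k by omega)
    have h3 : k ^ 2 ≤ n * treeLeaves n k := le_mul_ceilDiv (k ^ 2) (show 0 < n by omega)
    have h4 := Nat.mul_le_mul h2 h3
    have h5 : (n * k) * k ≤ (n * k) * (n ⌈/⌉ k * treeLeaves n k) := by nlinarith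
    exact Nat.le_of_mul_le_mul_left h5 (Nat.mul_pos (by omega) (by omega))
  · nlinarith

/-- If k² ≤ n, each of the at most k trees is a single leaf; this is where the cap on the number of
trees counts. Otherwise rounding up at most doubles each of n/k and k²/n. -/
theorem numLeaves_le (hk : 1 ≤ k) (hkn : k ≤ n) : numTrees n k * treeLeaves n k ≤ 4 * k := by
  have h3 : n * treeLeaves n k < k ^ 2 + n := mul_ceilDiv_lt (k ^ 2) (show 0 < n by omega)
  have h2 := mul_ceilDiv_lt n (show 0 < k by omega)
  rcases le_or_gt (k ^ 2) n with h | h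
  · have h4 : treeLeaves n k < 2 := by
      by_contra hc
      nlinarith
    have h5 : numTrees n k ≤ k := min_le_right _ _
    nlinarith
  · have h5 : numTrees n k ≤ n ⌈/⌉ k := min_le_left _ _
    have h6 : k * numTrees n k ≤ 2 * n := by nlinarith
    have h7 : n * treeLeaves n k ≤ 2 * k ^ 2 := by omega
    have h8 := Nat.mul_le_mul h6 h7
    have h9 : (n * k) * (numTrees n k * treeLeaves n k) ≤ (n * k) * (4 * k) := by nlinarith
    exact Nat.le_of_mul_le_mul_left h9 (Nat.mul_pos (by omega) (by omega))

theorem arity_sub_one : arity n k - 1 = n ⌈/⌉ k := by simp [arity]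

theorem treeLeaves_sub_one_le (hk : 1 ≤ k) (hkn : k ≤ n) :
    treeLeaves n k - 1 ≤ (n ⌈/⌉ k) * treeInner n k := by
  unfold treeInner
  rw [arity_sub_one]
  exact le_mul_ceilDiv _ (ceilDiv_pos_of_pos (by omega) (by omega))

theorem mul_treeInner_lt (hk : 1 ≤ k) (hkn : k ≤ n) :
    (n ⌈/⌉ k) * treeInner n k < treeLeaves n k - 1 + n ⌈/⌉ k := by
  unfold treeInner
  rw [arity_sub_one]
  exact mul_ceilDiv_lt _ (ceilDiv_pos_of_pos (by omega) (by omega))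

theorem treeInner_lt_treeLeaves (hk : 1 ≤ k) (hkn : k ≤ n) : treeInner n k < treeLeaves n k := by
  have h1 := treeLeaves_pos hk hkn
  have h2 : treeInner n k ≤ treeLeaves n k - 1 := by
    have hD : 0 < arity n k - 1 := by have := two_le_arity hk hkn; omega
    refine (ceilDiv_le_iff_le_mul hD).2 ?_
    exact Nat.le_mul_of_pos_left _ hD
  omega

theorem treeSize_pos (hk : 1 ≤ k) (hkn : k ≤ n) : 0 < treeSize n k := by
  have := treeLeaves_pos hk hkn
  unfold treeSize; omega

theorem numNodes_le (hk : 1 ≤ k) (hkn : k ≤ n) : numNodes n k ≤ 8 * k := by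
  have h1 := numLeaves_le hk hkn
  have h2 := treeInner_lt_treeLeaves hk hkn
  unfold numNodes treeSize
  nlinarith

/-- A nonleaf node has a child, and a leaf has none. -/
theorem first_child_lt_iff (hk : 1 ≤ k) (hkn : k ≤ n) (p : ℕ) :
    arity n k * p + 1 < treeSize n k ↔ p < treeInner n k := by
  -- With D = arity - 1, L leaves and I nonleaf nodes, L - 1 ≤ D I < L - 1 + D; the lower bound
  -- settles p ≥ I and the upper bound p < I.
  have h1 := treeLeaves_sub_one_le hk hkn
  have h2 := mul_treeInner_lt hk hkn
  have h3 := treeLeaves_pos hk hkn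
  unfold treeSize arity
  constructor
  · intro h
    by_contra hc
    push Not at hc
    have := Nat.mul_le_mul_left (n ⌈/⌉ k) hc
    nlinarith [Nat.sub_add_cancel h3]
  · intro h
    have : (n ⌈/⌉ k) * (p + 1) ≤ (n ⌈/⌉ k) * treeInner n k := Nat.mul_le_mul_left _ h
    nlinarith [Nat.sub_add_cancel h3]

/-! ## Levels -/

theorem level_pos (p : ℕ) : 0 < level n k p := by
  unfold level; omega

theorem lt_child (hk : 1 ≤ k) (hkn : k ≤ n) (p c : ℕ) : p < arity n k * p + c + 1 := by
  have := two_le_arity hk hkn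
  nlinarith

theorem level_child_lt (hk : 1 ≤ k) (hkn : k ≤ n) {p c : ℕ} (hc : c < arity n k)
    (h : arity n k * p + c + 1 < treeSize n k) :
    level n k (arity n k * p + c + 1) < level n k p := by
  conv_rhs => unfold level
  have := Finset.le_sup (f := fun c =>
    if h : p < arity n k * p + c + 1 ∧ arity n k * p + c + 1 < treeSize n k then
      level n k (arity n k * p + c + 1) else 0) (Finset.mem_range.2 hc)
  rw [dif_pos ⟨lt_child hk hkn p c, h⟩] at this
  exact Nat.lt_one_add_iff.2 this

/-- The parent of a node with positive number, by number. -/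
def parentIndex (n k p : ℕ) : ℕ := (p - 1) / arity n k

theorem parentIndex_lt {p : ℕ} (hp : p ≠ 0) : parentIndex n k p < p :=
  lt_of_le_of_lt (Nat.div_le_self _ _) (by omega)

theorem child_parentIndex {p : ℕ} (hp : p ≠ 0) :
    arity n k * parentIndex n k p + (p - 1) % arity n k + 1 = p := by
  unfold parentIndex
  rw [Nat.div_add_mod]; omega

theorem parentIndex_child {p c : ℕ} (hc : c < arity n k) :
    parentIndex n k (arity n k * p + c + 1) = p := by
  unfold parentIndex
  rw [Nat.add_sub_cancel, Nat.mul_add_div (by omega), Nat.div_eq_of_lt hc, add_zero]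

theorem level_lt_level_parentIndex (hk : 1 ≤ k) (hkn : k ≤ n) {p : ℕ} (hp : p ≠ 0)
    (h : p < treeSize n k) : level n k p < level n k (parentIndex n k p) := by
  have h1 := child_parentIndex (n := n) (k := k) hp
  have h2 := level_child_lt hk hkn (p := parentIndex n k p) (c := (p - 1) % arity n k)
    (Nat.mod_lt _ (by unfold arity; omega)) (by omega)
  rwa [h1] at h2

theorem level_le_forestHeight (hk : 1 ≤ k) (hkn : k ≤ n) {p : ℕ} (h : p < treeSize n k) :
    level n k p ≤ forestHeight n k := by
  induction p using Nat.strong_induction_on with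
  | _ p ih =>
    rcases eq_or_ne p 0 with rfl | hp
    · rfl
    · have h1 := parentIndex_lt (n := n) (k := k) hp
      exact (level_lt_level_parentIndex hk hkn hp h).le.trans (ih _ h1 (h1.trans h))

/-- With D = arity - 1, passing from p to a child multiplies D p + 1 by at least the arity, since D
(a p + c + 1) + 1 ≥ a (D p + 1) for a = D + 1. Following a longest descending path, the quantity
never exceeds its value at the last node. -/
theorem pow_level_mul_le (hk : 1 ≤ k) (hkn : k ≤ n) (p : ℕ) (hp : p < treeSize n k) :
    arity n k ^ (level n k p - 1) * ((n ⌈/⌉ k) * p + 1) ≤ (n ⌈/⌉ k) * (treeSize n k - 1) + 1 := by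
  induction h : treeSize n k - p using Nat.strong_induction_on generalizing p with
  | _ d ih =>
    have hl : level n k p - 1 = (Finset.range (arity n k)).sup fun c =>
        if h : p < arity n k * p + c + 1 ∧ arity n k * p + c + 1 < treeSize n k then
          level n k (arity n k * p + c + 1) else 0 := by
      conv_lhs => unfold level
      simp
    obtain ⟨c, hc, hc'⟩ := Finset.exists_mem_eq_sup (Finset.range (arity n k))
      ⟨0, by have := two_le_arity hk hkn; simp; omega⟩ fun c =>
        if h : p < arity n k * p + c + 1 ∧ arity n k * p + c + 1 < treeSize n k then
          level n k (arity n k * p + c + 1) else 0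
    rw [hl, hc']
    split_ifs with hcond
    · have := ih (treeSize n k - (arity n k * p + c + 1)) (by omega) _ hcond.2 rfl
      refine le_trans ?_ this
      obtain ⟨e, he⟩ : ∃ e, level n k (arity n k * p + c + 1) = e + 1 :=
        ⟨_, (Nat.sub_add_cancel (level_pos _)).symm⟩
      rw [he, Nat.add_sub_cancel, pow_succ, mul_assoc]
      refine Nat.mul_le_mul_left _ ?_
      unfold arity
      nlinarith
    · rw [pow_zero, one_mul]
      gcongr
      omega

theorem pow_forestHeight_lt (hk : 1 ≤ k) (hkn : k ≤ n) :
    arity n k ^ (forestHeight n k - 1) < arity n k * treeLeaves n k := by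
  have h1 := pow_level_mul_le hk hkn 0 (treeSize_pos hk hkn)
  have h2 := mul_treeInner_lt hk hkn
  have h3 := treeLeaves_pos hk hkn
  have h4 : 0 < n ⌈/⌉ k := ceilDiv_pos_of_pos (by omega) (by omega)
  rw [mul_zero, zero_add, mul_one] at h1
  refine lt_of_le_of_lt h1 ?_
  unfold arity treeSize
  obtain ⟨l, hl⟩ : ∃ l, treeLeaves n k = l + 1 := ⟨_, (Nat.sub_add_cancel h3).symm⟩
  rw [hl] at h2 ⊢
  rw [show l + 1 + treeInner n k - 1 = l + treeInner n k by omega]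
  simp only [Nat.add_sub_cancel] at h2
  nlinarith

/-- This makes the height logarithmic, and it also bounds the last term of the geometric sum of the
widths by the number of leaves. -/
theorem pow_forestHeight_sub_two_lt (hk : 1 ≤ k) (hkn : k ≤ n) (h : 2 ≤ forestHeight n k) :
    arity n k ^ (forestHeight n k - 2) < treeLeaves n k := by
  have h1 := pow_forestHeight_lt hk hkn
  rw [show forestHeight n k - 1 = forestHeight n k - 2 + 1 by omega, pow_succ'] at h1
  exact Nat.lt_of_mul_lt_mul_left h1

/-! ## The indices assigned to the nodes -/

theorem card_block_mul_lt (hk : 1 ≤ k) (hkn : k ≤ n) (l : ℕ) :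
    (block n k l).card * (numTrees n k * treeLeaves n k) <
      n + numTrees n k * treeLeaves n k := by
  have hL := le_numLeaves hk hkn
  set Λ := numTrees n k * treeLeaves n k
  rcases (block n k l).eq_empty_or_nonempty with h | h
  · rw [h]; simp; omega
  · set a := (block n k l).min' h
    have ha : a ∈ block n k l := Finset.min'_mem _ _
    -- Two indices at distance d in the same block satisfy dΛ < n, so the block fits into ⌈n/Λ⌉
    -- consecutive numbers from its minimum on.
    have hsub : (block n k l).map Fin.valEmbedding ⊆
        Finset.Ico (a : ℕ) (a + (n + Λ - 1) / Λ) := by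
      intro x hx
      obtain ⟨j, hj, rfl⟩ := Finset.mem_map.1 hx
      have h1 : a ≤ j := Finset.min'_le _ _ hj
      simp only [block, Finset.mem_filter, Finset.mem_univ, true_and] at ha hj
      have hn : 0 < n := by omega
      have e1 := Nat.div_mul_le_self ((a : ℕ) * Λ) n
      have e2 := Nat.lt_div_mul_add (a := (j : ℕ) * Λ) hn
      rw [show (a : ℕ) * Λ / n = l from ha] at e1
      rw [show (j : ℕ) * Λ / n = l from hj] at e2
      have h1' : (a : ℕ) ≤ j := h1
      simp only [Fin.valEmbedding_apply, Finset.mem_Ico]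
      refine ⟨h1', ?_⟩
      obtain ⟨d, hd⟩ := Nat.exists_eq_add_of_le h1'
      have h3 : d < (n + Λ - 1) / Λ := by
        rw [Nat.lt_iff_add_one_le, Nat.le_div_iff_mul_le (by omega)]
        have : d * Λ < n := by rw [hd] at e2; nlinarith
        rw [add_mul, one_mul]; omega
      omega
    have := Finset.card_le_card hsub
    rw [Finset.card_map, Nat.card_Ico, Nat.add_sub_cancel_left] at this
    calc (block n k l).card * Λ ≤ (n + Λ - 1) / Λ * Λ := Nat.mul_le_mul_right _ this
      _ ≤ n + Λ - 1 := Nat.div_mul_le_self _ _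
      _ < n + Λ := by omega

/-- An upper bound on the length of a block. -/
def blockBound (n k : ℕ) : ℕ := n / (numTrees n k * treeLeaves n k) + 1

theorem card_block_le (hk : 1 ≤ k) (hkn : k ≤ n) (l : ℕ) :
    (block n k l).card ≤ blockBound n k := by
  have h1 := card_block_mul_lt hk hkn l
  have hL := le_numLeaves hk hkn
  unfold blockBound
  set Λ := numTrees n k * treeLeaves n k
  have hd := Nat.lt_div_mul_add (a := n) (b := Λ) (by omega)
  by_contra hc
  push Not at hc
  have : (n / Λ + 2) * Λ ≤ (block n k l).card * Λ := Nat.mul_le_mul_right _ hc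
  nlinarith

theorem assigned_leaf (a : ℕ) {p : ℕ} (hp : treeInner n k ≤ p) :
    assigned n k a p = block n k (a * treeLeaves n k + (p - treeInner n k)) := by
  unfold assigned
  rw [if_pos hp]

theorem mem_assigned_inner (hk : 1 ≤ k) (hkn : k ≤ n) (a : ℕ) {p : ℕ} (hp : p < treeInner n k)
    (j : Fin n) : j ∈ assigned n k a p ↔ ∃ c < arity n k,
      arity n k * p + c + 1 < treeSize n k ∧ j ∈ assigned n k a (arity n k * p + c + 1) := by
  conv_lhs => unfold assigned
  rw [if_neg (by omega)]
  simp only [Finset.mem_biUnion, Finset.mem_range]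
  refine exists_congr fun c => and_congr_right fun _ => ?_
  split_ifs with h
  · simp [h]
  · have : ¬ arity n k * p + c + 1 < treeSize n k := fun h' => h ⟨lt_child hk hkn _ _, h'⟩
    simp [this]

/-- A subtree of height h has at most a ^ (h - 1) leaves, each with one block. -/
theorem card_assigned_le (hk : 1 ≤ k) (hkn : k ≤ n) (a p : ℕ) :
    (assigned n k a p).card ≤ blockBound n k * arity n k ^ (level n k p - 1) := by
  induction h : treeSize n k - p using Nat.strong_induction_on generalizing p with
  | _ d ih =>
    rcases le_or_gt (treeInner n k) p with hp | hp
    · rw [assigned_leaf a hp]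
      exact (card_block_le hk hkn _).trans
        (Nat.le_mul_of_pos_right _ (pow_pos (by have := two_le_arity hk hkn; omega) _))
    · have hlt : p < treeSize n k := by unfold treeSize; omega
      have h2 := (first_child_lt_iff hk hkn p).2 hp
      -- The first child shows that the level is at least 2, so that the subtractions in the
      -- exponents are genuine.
      have hlev := level_child_lt hk hkn (p := p) (c := 0)
        (by have := two_le_arity hk hkn; omega) (by simpa using h2)
      have hpos := level_pos (n := n) (k := k) (arity n k * p + 0 + 1)
      obtain ⟨e, he⟩ : ∃ e, level n k p = e + 2 := ⟨level n k p - 2, by omega⟩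
      unfold assigned
      rw [if_neg (by omega)]
      refine (Finset.card_biUnion_le_card_mul _ _ (blockBound n k * arity n k ^ e) ?_).trans ?_
      · intro c hc
        split_ifs with hcond
        · refine (ih _ (by omega) _ rfl).trans ?_
          have := level_child_lt hk hkn (Finset.mem_range.1 hc) hcond.2
          refine Nat.mul_le_mul_left _
            (Nat.pow_le_pow_right (by have := two_le_arity hk hkn; omega) (by omega))
        · simp
      · rw [he, show e + 2 - 1 = e + 1 by omega, pow_succ, Finset.card_range]
        apply le_of_eq; ring

/-- The number within its tree of the leaf that is responsible for an index. -/
def leafIndex (n k : ℕ) (j : Fin n) : ℕ :=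
  treeInner n k + (j : ℕ) * (numTrees n k * treeLeaves n k) / n % treeLeaves n k

/-- The number of the tree that is responsible for an index. -/
def treeIndex (n k : ℕ) (j : Fin n) : ℕ :=
  (j : ℕ) * (numTrees n k * treeLeaves n k) / n / treeLeaves n k

/-- An index determines its tree and its leaf, and only ancestors of that leaf hold it. Hence the
nodes holding an index form a chain. -/
theorem exists_iterate_of_mem_assigned (hk : 1 ≤ k) (hkn : k ≤ n) (a p : ℕ)
    (hp : p < treeSize n k) (j : Fin n) (hj : j ∈ assigned n k a p) :
    treeIndex n k j = a ∧ ∃ d, (parentIndex n k)^[d] (leafIndex n k j) = p := by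
  induction h : treeSize n k - p using Nat.strong_induction_on generalizing p with
  | _ d ih =>
    rcases le_or_gt (treeInner n k) p with hp' | hp'
    · rw [assigned_leaf a hp'] at hj
      simp only [block, Finset.mem_filter, Finset.mem_univ, true_and] at hj
      have h1 : p - treeInner n k < treeLeaves n k := by unfold treeSize at hp; omega
      unfold treeIndex leafIndex
      rw [hj]
      refine ⟨?_, 0, ?_⟩
      · rw [Nat.add_comm, Nat.add_mul_div_right _ _ (by omega), Nat.div_eq_of_lt h1, zero_add]
      · rw [Nat.add_comm (a * _), Nat.add_mul_mod_self_right, Nat.mod_eq_of_lt h1]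
        simp; omega
    · obtain ⟨c, hc, hcs, hcj⟩ := (mem_assigned_inner hk hkn a hp' j).1 hj
      have hlt := lt_child hk hkn p c
      obtain ⟨h1, e, he⟩ := ih _ (by omega) _ hcs hcj rfl
      refine ⟨h1, e + 1, ?_⟩
      rw [Function.iterate_succ_apply', he, parentIndex_child hc]

theorem mem_assigned_leafIndex (j : Fin n) :
    j ∈ assigned n k (treeIndex n k j) (leafIndex n k j) := by
  rw [assigned_leaf _ (by unfold leafIndex; omega), block, Finset.mem_filter]
  refine ⟨Finset.mem_univ _, ?_⟩
  rw [treeIndex, leafIndex, Nat.add_sub_cancel_left, Nat.mul_comm (_ / _ / _), Nat.div_add_mod]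

theorem leafIndex_lt (hk : 1 ≤ k) (hkn : k ≤ n) (j : Fin n) : leafIndex n k j < treeSize n k := by
  have := Nat.mod_lt ((j : ℕ) * (numTrees n k * treeLeaves n k) / n) (treeLeaves_pos hk hkn)
  unfold leafIndex treeSize; omega

theorem treeIndex_lt (hk : 1 ≤ k) (hkn : k ≤ n) (j : Fin n) : treeIndex n k j < numTrees n k := by
  have h1 := treeLeaves_pos hk hkn
  unfold treeIndex
  rw [Nat.div_lt_iff_lt_mul h1, Nat.div_lt_iff_lt_mul (by omega), Nat.mul_comm]
  exact Nat.mul_lt_mul_of_pos_left j.2 (Nat.mul_pos (numTrees_pos hk hkn) h1)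

theorem mem_assigned_parentIndex (hk : 1 ≤ k) (hkn : k ≤ n) {a p : ℕ} (hp : p ≠ 0)
    (hps : p < treeSize n k) {j : Fin n} (hj : j ∈ assigned n k a p) :
    j ∈ assigned n k a (parentIndex n k p) := by
  have h1 := child_parentIndex (n := n) (k := k) hp
  have h2 : parentIndex n k p < treeInner n k := by
    rw [← first_child_lt_iff hk hkn]; omega
  rw [mem_assigned_inner hk hkn a h2]
  exact ⟨(p - 1) % arity n k, Nat.mod_lt _ (by unfold arity; omega), by omega, by rwa [h1]⟩

theorem mem_assigned_root (hk : 1 ≤ k) (hkn : k ≤ n) (j : Fin n) :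
    j ∈ assigned n k (treeIndex n k j) 0 := by
  suffices ∀ p, p < treeSize n k → j ∈ assigned n k (treeIndex n k j) p →
      j ∈ assigned n k (treeIndex n k j) 0 from
    this _ (leafIndex_lt hk hkn j) (mem_assigned_leafIndex j)
  intro p
  induction p using Nat.strong_induction_on with
  | _ p ih =>
    intro hp hj
    rcases eq_or_ne p 0 with rfl | h0
    · exact hj
    · have h1 := parentIndex_lt (n := n) (k := k) h0
      exact ih _ h1 (h1.trans hp) (mem_assigned_parentIndex hk hkn h0 hp hj)

theorem mem_indexList {v : Node n k} {j : Fin n} :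
    j ∈ indexList n k v ↔ j ∈ assigned n k v.1 v.2 := by
  simp [indexList]

theorem nodup_indexList (v : Node n k) : (indexList n k v).Nodup :=
  (List.nodup_finRange n).filter _

theorem length_indexList (v : Node n k) :
    (indexList n k v).length = (assigned n k v.1 v.2).card := by
  rw [← List.toFinset_card_of_nodup (nodup_indexList v)]
  congr 1
  ext j
  simp [mem_indexList]

theorem mem_nodes (v : Node n k) : v ∈ nodes n k := by
  obtain ⟨a, p⟩ := v
  simp [nodes]

theorem nodup_nodes : (nodes n k).Nodup := by
  unfold nodes
  rw [List.nodup_flatMap]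
  refine ⟨fun a _ => (List.nodup_finRange _).map fun p q h => (Prod.mk.inj h).2, ?_⟩
  refine (List.nodup_finRange _).imp fun {a b} hab => ?_
  intro x hx hy
  simp only [List.mem_map] at hx hy
  obtain ⟨p, -, rfl⟩ := hx
  obtain ⟨q, -, h⟩ := hy
  exact hab (Prod.mk.inj h).1.symm

theorem parent_eq_some_iff {v u : Node n k} :
    parent n k v = some u ↔ (v.2 : ℕ) ≠ 0 ∧ u.1 = v.1 ∧ (u.2 : ℕ) = parentIndex n k v.2 := by
  unfold parent
  split_ifs with h
  · simp [h]
  · rw [Option.some_inj]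
    constructor
    · rintro rfl; exact ⟨h, rfl, rfl⟩
    · rintro ⟨-, h1, h2⟩
      exact Prod.ext h1.symm (Fin.ext h2.symm)

theorem parent_eq_none_iff {v : Node n k} : parent n k v = none ↔ (v.2 : ℕ) = 0 := by
  unfold parent
  split_ifs with h <;> simp [h]

theorem reportPhase_of_ne_zero {v : Node n k} (hv : (v.2 : ℕ) ≠ 0) :
    reportPhase n k v = level n k (parentIndex n k v.2) := by
  unfold reportPhase parent
  rw [if_neg hv]; rfl

theorem reportPhase_of_eq_zero {v : Node n k} (hv : (v.2 : ℕ) = 0) :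
    reportPhase n k v = forestHeight n k + 1 := by
  unfold reportPhase
  rw [parent_eq_none_iff.2 hv]

theorem level_lt_reportPhase (hk : 1 ≤ k) (hkn : k ≤ n) (v : Node n k) :
    level n k v.2 < reportPhase n k v := by
  by_cases h : (v.2 : ℕ) = 0
  · rw [reportPhase_of_eq_zero h]
    exact Nat.lt_succ_of_le (level_le_forestHeight hk hkn v.2.2)
  · rw [reportPhase_of_ne_zero h]
    exact level_lt_level_parentIndex hk hkn h v.2.2

theorem reportPhase_le_forestHeight (hk : 1 ≤ k) (hkn : k ≤ n) {v : Node n k}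
    (hv : (v.2 : ℕ) ≠ 0) : reportPhase n k v ≤ forestHeight n k := by
  rw [reportPhase_of_ne_zero hv]
  exact level_le_forestHeight hk hkn ((parentIndex_lt hv).trans v.2.2)

theorem two_le_reportPhase (hk : 1 ≤ k) (hkn : k ≤ n) (v : Node n k) : 2 ≤ reportPhase n k v := by
  have := level_lt_reportPhase hk hkn v
  have := level_pos (n := n) (k := k) v.2
  omega

theorem exists_child_of_mem (hk : 1 ≤ k) (hkn : k ≤ n) {u : Node n k} (hu : ¬ IsLeaf n k u)
    {j : Fin n} (hj : j ∈ indexList n k u) :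
    ∃ v : Node n k, parent n k v = some u ∧ reportPhase n k v = level n k u.2 ∧
      j ∈ indexList n k v := by
  have hu' : (u.2 : ℕ) < treeInner n k := not_le.1 hu
  obtain ⟨c, hc, hcs, hcj⟩ := (mem_assigned_inner hk hkn _ hu' j).1 (mem_indexList.1 hj)
  have h1 : parent n k (u.1, ⟨_, hcs⟩) = some u :=
    parent_eq_some_iff.2 ⟨Nat.succ_ne_zero _, rfl, (parentIndex_child hc).symm⟩
  refine ⟨(u.1, ⟨_, hcs⟩), h1, ?_, mem_indexList.2 hcj⟩
  unfold reportPhase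
  rw [h1]

/-- A node reports in the phase given by the level of its parent, and the parent reports only later;
so phases increase strictly towards the root. -/
theorem reportPhase_lt_of_iterate (hk : 1 ≤ k) (hkn : k ≤ n) {a : Fin (numTrees n k)}
    {p q : Fin (treeSize n k)} {d : ℕ} (h : (parentIndex n k)^[d] (q : ℕ) = p) (hpq : p ≠ q) :
    reportPhase n k (a, q) < reportPhase n k (a, p) := by
  induction d generalizing q with
  | zero => exact absurd (Fin.ext h.symm) hpq
  | succ d ih =>
    rw [Function.iterate_succ_apply] at h
    have hq : (q : ℕ) ≠ 0 := by
      intro hq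
      have h0 : parentIndex n k 0 = 0 := by simp [parentIndex]
      rw [hq, h0, Function.iterate_fixed h0] at h
      exact hpq (Fin.ext (by omega))
    have hlt : parentIndex n k q < treeSize n k := (parentIndex_lt hq).trans q.2
    have h1 : reportPhase n k (a, q) < reportPhase n k (a, ⟨parentIndex n k q, hlt⟩) := by
      rw [reportPhase_of_ne_zero (v := (a, q)) hq]
      exact level_lt_reportPhase hk hkn (a, ⟨parentIndex n k q, hlt⟩)
    by_cases hp : p = ⟨parentIndex n k q, hlt⟩
    · rwa [hp]
    · exact h1.trans (ih h hp)

/-- Nodes that report in the same phase have no index in common. -/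
theorem node_unique (hk : 1 ≤ k) (hkn : k ≤ n) {v w : Node n k}
    (h : reportPhase n k v = reportPhase n k w) {j : Fin n} (hv : j ∈ indexList n k v)
    (hw : j ∈ indexList n k w) : v = w := by
  obtain ⟨a, p⟩ := v
  obtain ⟨b, q⟩ := w
  obtain ⟨ha, d, hd⟩ := exists_iterate_of_mem_assigned hk hkn _ _ p.2 j (mem_indexList.1 hv)
  obtain ⟨hb, e, he⟩ := exists_iterate_of_mem_assigned hk hkn _ _ q.2 j (mem_indexList.1 hw)
  obtain rfl : a = b := Fin.ext (ha.symm.trans hb)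
  by_contra hne
  have hpq : p ≠ q := fun h => hne (by rw [h])
  -- Both nodes are ancestors of the leaf of `j`, so one is an ancestor of the other, and distinct
  -- nodes on a path have distinct phases.
  rcases le_total d e with hde | hde
  · have : (parentIndex n k)^[e - d] (p : ℕ) = q := by
      rw [← hd, ← Function.iterate_add_apply, Nat.sub_add_cancel hde, he]
    exact (reportPhase_lt_of_iterate hk hkn (a := a) this hpq.symm).ne h
  · have : (parentIndex n k)^[d - e] (q : ℕ) = p := by
      rw [← he, ← Function.iterate_add_apply, Nat.sub_add_cancel hde, hd]
    exact (reportPhase_lt_of_iterate hk hkn (a := a) this hpq).ne h.symm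

/-- The index sets in question are disjoint by `node_unique`. This keeps the message count of a
phase linear in n. -/
theorem sum_length_indexList_le (hk : 1 ≤ k) (hkn : k ≤ n) (i : ℕ) :
    ∑ v : Node n k with reportPhase n k v = i, (indexList n k v).length ≤ n := by
  simp only [length_indexList]
  rw [← Finset.card_biUnion]
  · exact (Finset.card_le_univ _).trans (by simp)
  · intro v hv w hw hne
    simp only [Finset.coe_filter, Finset.mem_univ, true_and, Set.mem_ofPred_eq] at hv hw
    refine Finset.disjoint_left.2 fun j hjv hjw => hne ?_
    exact node_unique hk hkn (hv.trans hw.symm) (mem_indexList.2 hjv) (mem_indexList.2 hjw)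

/-! ## Widths of the phases -/

theorem length_indexList_le_width {i : ℕ} {v : Node n k} (h : reportPhase n k v = i) :
    (indexList n k v).length ≤ width n k i :=
  Finset.le_sup (f := fun v : Node n k => (indexList n k v).length) (by simpa using h)

/-- Phases are numbered from 2, and a node reporting in phase e + 2 has level at most e + 1. -/
theorem width_le (hk : 1 ≤ k) (hkn : k ≤ n) (e : ℕ) :
    width n k (e + 2) ≤ blockBound n k * arity n k ^ e := by
  refine Finset.sup_le fun v hv => ?_
  rw [length_indexList]
  have h1 := level_lt_reportPhase hk hkn v
  rw [(Finset.mem_filter.1 hv).2] at h1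
  exact (card_assigned_le hk hkn _ _).trans (Nat.mul_le_mul_left _
    (Nat.pow_le_pow_right (by have := two_le_arity hk hkn; omega) (by omega)))

/-- For the roots the general estimate `width_le` could lose a factor of the arity, since the
deepest level need not be full; counting the leaves of the tree avoids this. -/
theorem width_forestHeight_succ_le (hk : 1 ≤ k) (hkn : k ≤ n) :
    width n k (forestHeight n k + 1) ≤ blockBound n k * treeLeaves n k := by
  refine Finset.sup_le fun v hv => ?_
  have h0 : (v.2 : ℕ) = 0 := by
    by_contra h0
    have := reportPhase_le_forestHeight hk hkn h0
    rw [(Finset.mem_filter.1 hv).2] at this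
    omega
  rw [length_indexList]
  have hsub : assigned n k v.1 v.2 ⊆ (Finset.range (treeLeaves n k)).biUnion fun l =>
      block n k (v.1 * treeLeaves n k + l) := by
    intro j hj
    have h1 := (exists_iterate_of_mem_assigned hk hkn _ _ v.2.2 j hj).1
    simp only [Finset.mem_biUnion, Finset.mem_range]
    refine ⟨_, Nat.mod_lt ((j : ℕ) * (numTrees n k * treeLeaves n k) / n)
      (treeLeaves_pos hk hkn), ?_⟩
    simp only [block, Finset.mem_filter, Finset.mem_univ, true_and]
    rw [← h1, treeIndex, Nat.mul_comm (_ / _ / _), Nat.div_add_mod]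
  refine (Finset.card_le_card hsub).trans ?_
  refine (Finset.card_biUnion_le_card_mul _ _ _ fun l _ => card_block_le hk hkn _).trans ?_
  rw [Finset.card_range, Nat.mul_comm]

theorem sum_pow_le_two_mul_pow {a : ℕ} (ha : 2 ≤ a) (e : ℕ) :
    ∑ i ∈ Finset.range (e + 1), a ^ i ≤ 2 * a ^ e := by
  induction e with
  | zero => simp
  | succ e ih =>
    rw [Finset.sum_range_succ, pow_succ]
    nlinarith [Nat.zero_le (a ^ e)]

/-- The phases before the last form a geometric sum, at most twice its last term, whose power of the
arity is below the number of leaves; the last phase contributes the third unit. -/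
theorem sum_width_le (hk : 1 ≤ k) (hkn : k ≤ n) :
    ∑ e ∈ Finset.range (forestHeight n k), width n k (e + 2) ≤
      3 * (blockBound n k * treeLeaves n k) := by
  have hH : 0 < forestHeight n k := level_pos _
  obtain ⟨h, hh⟩ : ∃ h, forestHeight n k = h + 1 := ⟨_, (Nat.sub_add_cancel hH).symm⟩
  have h1 := width_forestHeight_succ_le hk hkn
  rw [hh] at h1 ⊢
  rw [Finset.sum_range_succ]
  change width n k (h + 2) ≤ _ at h1
  have h2 : ∑ e ∈ Finset.range h, width n k (e + 2) ≤
      2 * (blockBound n k * treeLeaves n k) := by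
    rcases Nat.eq_zero_or_pos h with rfl | hpos
    · simp
    · obtain ⟨g, rfl⟩ : ∃ g, h = g + 1 := ⟨_, (Nat.sub_add_cancel hpos).symm⟩
      have h3 := pow_forestHeight_sub_two_lt hk hkn (by omega)
      rw [hh, show g + 1 + 1 - 2 = g by omega] at h3
      calc ∑ e ∈ Finset.range (g + 1), width n k (e + 2)
          ≤ ∑ e ∈ Finset.range (g + 1), blockBound n k * arity n k ^ e :=
            Finset.sum_le_sum fun e _ => width_le hk hkn e
        _ = blockBound n k * ∑ e ∈ Finset.range (g + 1), arity n k ^ e := by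
            rw [Finset.mul_sum]
        _ ≤ blockBound n k * (2 * arity n k ^ g) :=
            Nat.mul_le_mul_left _ (sum_pow_le_two_mul_pow (two_le_arity hk hkn) g)
        _ ≤ blockBound n k * (2 * treeLeaves n k) := by gcongr
        _ = _ := by ring
  omega

end Forest

section Execution

variable {n k : ℕ} {β : ℝ} (adv : StaticAdversary n k β) (ω : Coins k)

/-! ## The election -/

/-- The committees that are determined by the global random bits. -/
noncomputable def electedCommittee (n k : ℕ) (β : ℝ) (ω : Coins k) : Node n k → Finset (Fin k) :=
  committee n k β fun s => ω (Sum.inl s)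

/-- The state of a machine in an execution of the algorithm. -/
noncomputable abbrev pdState (t : ℕ) (M : Fin k) : LocalState n k :=
  states (parallelDownload n k β) adv ω t M

/-- The answers received by a machine that is in state `st`. -/
noncomputable abbrev pdAnswers (st : LocalState n k) : Query n → Option Bool :=
  fun q => if q ∈ pdQueries n k β st then some (cloud adv ω q) else none

/-- The messages received by `M` in round `t`. -/
noncomputable abbrev pdInbox (t : ℕ) (M : Fin k) : Fin k → Option (Message n) :=
  fun M' => message (parallelDownload n k β) adv ω (pdState adv ω t) t M' M

/-- The election reads no bit beyond `numRandomBits`, so the default values stored there are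
harmless. -/
theorem committee_congr {bits bits' : ℕ → Bool}
    (h : ∀ s < numRandomBits n k β, bits s = bits' s) :
    committee n k β bits = committee n k β bits' := by
  funext v
  unfold committee
  congr 1
  funext M
  refine propext (exists_congr fun u => and_congr_right fun hu => ?_)
  have hw : ∀ e ∈ Finset.range (committeeSize n β),
      randomWord n k bits (u * committeeSize n β + e) =
        randomWord n k bits' (u * committeeSize n β + e) := by
    intro e he
    rw [Finset.mem_range] at he
    refine Finset.sum_congr rfl fun i hi => ?_
    rw [Finset.mem_range] at hi
    rw [h]
    unfold numRandomBits
    calc (u * committeeSize n β + e) * wordLength n k + i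
        < (u * committeeSize n β + e + 1) * wordLength n k := by rw [add_mul _ 1]; omega
      _ ≤ committeeSize n β * committeeSize n β * wordLength n k := by
        refine Nat.mul_le_mul_right _ ?_
        calc u * committeeSize n β + e + 1 ≤ (u + 1) * committeeSize n β := by
              rw [add_mul]; omega
          _ ≤ _ := Nat.mul_le_mul_right _ hu
  unfold hash
  rw [Finset.sum_congr rfl fun e he => by rw [hw e he]]

theorem pdState_succ {t : ℕ} {M : Fin k} {ins : Instruction}
    (h : currentInstruction n k β (pdState adv ω t M) = some ins) :
    pdState adv ω (t + 1) M =
      pdReceive n k β (pdAnswer n k β (pdState adv ω t M)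
        (pdAnswers adv ω (pdState adv ω t M))) (pdInbox adv ω t M) := by
  have h0 : ((parallelDownload n k β).output (pdState adv ω t M)).isSome = false := by
    simp [parallelDownload, h]
  change states _ adv ω (t + 1) M = _
  unfold states
  rw [if_neg (by rw [h0]; decide)]
  rfl

/-- During the election only the clock and the fetched bits change, so the adversary has no
influence and the state is explicit. -/
theorem pdState_eq_of_le_electionRounds {t : ℕ} (ht : t ≤ electionRounds n k β) (M : Fin k) :
    pdState adv ω t M =
      { self := M
        clock := t
        bits := fun s => if s < t * n ∧ s < numRandomBits n k β then ω (Sum.inl s) else false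
        res := fun _ => false
        reports := fun _ _ _ => none
        blacklist := fun _ => ∅ } := by
  induction t with
  | zero => simp [pdState, states, parallelDownload]
  | succ t ih =>
    have ih := ih (by omega)
    have hc : currentInstruction n k β (pdState adv ω t M) = some (Instruction.elect t) := by
      rw [ih]; unfold currentInstruction; simp; omega
    rw [pdState_succ adv ω hc, pdAnswer, hc]
    simp only
    rw [pdReceive]
    -- Receiving looks up the instruction again, in the state updated by the answers; only its clock
    -- matters here.
    have hc' : ∀ st : LocalState n k, st.clock = t →
        currentInstruction n k β st = some (Instruction.elect t) := by
      intro st h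
      unfold currentInstruction; rw [h, if_pos (by omega)]
    rw [hc' _ (by rw [ih])]
    simp only [ih, LocalState.mk.injEq, true_and, and_true]
    funext s
    have hq : pdQueries n k β (pdState adv ω t M) =
        ((Finset.range n).filter fun s => t * n + s < numRandomBits n k β).image
          fun s => Query.random (t * n + s) := by
      rw [pdQueries, hc]
    rw [← ih, pdAnswers, hq]
    have hm : (Query.random s ∈ ((Finset.range n).filter fun s =>
        t * n + s < numRandomBits n k β).image fun s => (Query.random (t * n + s) : Query n)) ↔
        t * n ≤ s ∧ s < (t + 1) * n ∧ s < numRandomBits n k β := by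
      simp only [Finset.mem_image, Finset.mem_filter, Finset.mem_range, Query.random.injEq]
      rw [add_mul, one_mul]
      constructor
      · rintro ⟨a, ⟨h1, h2⟩, rfl⟩; omega
      · rintro ⟨h1, h2, h3⟩; exact ⟨s - t * n, by omega, by omega⟩
    simp only [hm]
    have hlt : t * n ≤ (t + 1) * n := Nat.mul_le_mul_right _ (by omega)
    by_cases h1 : s < t * n
    · rw [if_neg (by omega)]
      simp only [Option.getD_none]
      congr 1
      exact propext ⟨fun h => ⟨by omega, h.2⟩, fun h => ⟨h1, h.2⟩⟩
    · by_cases h2 : s < (t + 1) * n ∧ s < numRandomBits n k β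
      · rw [if_pos ⟨by omega, h2⟩, if_pos h2]; rfl
      · rw [if_neg (fun h => h2 h.2), if_neg h2, if_neg (fun h => h1 h.1)]; rfl

theorem numRandomBits_le_mul (hn : 0 < n) :
    numRandomBits n k β ≤ electionRounds n k β * n := by
  rw [Nat.mul_comm]
  exact le_mul_ceilDiv _ hn

theorem committee_after_election (hn : 0 < n) (M : Fin k) :
    committee n k β (pdState adv ω (electionRounds n k β) M).bits =
      electedCommittee n k β ω := by
  rw [pdState_eq_of_le_electionRounds adv ω le_rfl]
  refine committee_congr fun s hs => ?_
  exact if_pos ⟨hs.trans_le (numRandomBits_le_mul hn), hs⟩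

/-! ## The rounds after the election -/

/-- The state in round `r` after the election. -/
noncomputable abbrev lateState (r : ℕ) (M : Fin k) : LocalState n k :=
  pdState adv ω (electionRounds n k β + r) M

theorem currentInstruction_of_clock {st : LocalState n k} {r : ℕ}
    (h1 : st.clock = electionRounds n k β + r)
    (h2 : committee n k β st.bits = electedCommittee n k β ω) :
    currentInstruction n k β st = (program (electedCommittee n k β ω))[r]? := by
  unfold currentInstruction
  rw [if_neg (by omega), h1, h2, Nat.add_sub_cancel_left]

theorem pdAnswer_self (st : LocalState n k) (ans : Query n → Option Bool) :
    (pdAnswer n k β st ans).self = st.self := by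
  unfold pdAnswer; split <;> rfl

theorem pdAnswer_clock (st : LocalState n k) (ans : Query n → Option Bool) :
    (pdAnswer n k β st ans).clock = st.clock := by
  unfold pdAnswer; split <;> rfl

theorem pdAnswer_reports (st : LocalState n k) (ans : Query n → Option Bool) :
    (pdAnswer n k β st ans).reports = st.reports := by
  unfold pdAnswer; split <;> rfl

/-- Bits are written only by `elect`, which does not occur in `program`. -/
theorem pdAnswer_bits (st : LocalState n k) (ans : Query n → Option Bool)
    (h : electionRounds n k β ≤ st.clock) : (pdAnswer n k β st ans).bits = st.bits := by
  unfold pdAnswer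
  split
  · next h' =>
    unfold currentInstruction at h'
    rw [if_neg (by omega)] at h'
    have := List.mem_of_getElem? h'
    simp [program] at this
  all_goals rfl

theorem pdReceive_self (st : LocalState n k) (inbox : Fin k → Option (Message n)) :
    (pdReceive n k β st inbox).self = st.self := by
  unfold pdReceive; split <;> rfl

theorem pdReceive_clock (st : LocalState n k) (inbox : Fin k → Option (Message n)) :
    (pdReceive n k β st inbox).clock = st.clock + 1 := by
  unfold pdReceive; split <;> rfl

theorem pdReceive_bits (st : LocalState n k) (inbox : Fin k → Option (Message n)) :
    (pdReceive n k β st inbox).bits = st.bits := by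
  unfold pdReceive; split <;> rfl

theorem pdReceive_res (st : LocalState n k) (inbox : Fin k → Option (Message n)) :
    (pdReceive n k β st inbox).res = st.res := by
  unfold pdReceive; split <;> rfl

theorem pdReceive_blacklist (st : LocalState n k) (inbox : Fin k → Option (Message n)) :
    (pdReceive n k β st inbox).blacklist = st.blacklist := by
  unfold pdReceive; split <;> rfl

/-- All machines compute the same committees and hence run the same public program in lockstep; this
is what makes the schedule common knowledge. -/
theorem lateState_public (hn : 0 < n) {r : ℕ}
    (hr : r ≤ (program (electedCommittee n k β ω)).length) (M : Fin k) :
    (lateState adv ω r M).self = M ∧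
    (lateState adv ω r M).clock = electionRounds n k β + r ∧
    committee n k β (lateState adv ω r M).bits = electedCommittee n k β ω := by
  induction r with
  | zero =>
    refine ⟨?_, ?_, committee_after_election adv ω hn M⟩
    · rw [lateState, pdState_eq_of_le_electionRounds adv ω (Nat.add_zero _).le]
    · rw [lateState, pdState_eq_of_le_electionRounds adv ω (Nat.add_zero _).le]
  | succ r ih =>
    obtain ⟨h1, h2, h3⟩ := ih (by omega)
    have h4 := currentInstruction_of_clock ω h2 h3
    rw [List.getElem?_eq_getElem (by omega)] at h4
    have h5 := pdState_succ adv ω h4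
    change lateState adv ω (r + 1) M = _ at h5
    rw [h5, pdReceive_self, pdReceive_clock, pdReceive_bits, pdAnswer_self, pdAnswer_clock,
      pdAnswer_bits _ _ (by rw [h2]; omega)]
    exact ⟨h1, by rw [h2]; omega, h3⟩

theorem currentInstruction_lateState (hn : 0 < n) {r : ℕ}
    (hr : r ≤ (program (electedCommittee n k β ω)).length) (M : Fin k) :
    currentInstruction n k β (lateState adv ω r M) =
      (program (electedCommittee n k β ω))[r]? :=
  have h := lateState_public adv ω hn hr M
  currentInstruction_of_clock ω h.2.1 h.2.2

theorem lt_length_of_getElem? {α : Type*} {l : List α} {r : ℕ} {a : α} (h : l[r]? = some a) :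
    r < l.length := by
  by_contra hc
  rw [List.getElem?_eq_none (by omega)] at h
  cases h

theorem lateState_succ (hn : 0 < n) {r : ℕ} {ins : Instruction}
    (hr : (program (electedCommittee n k β ω))[r]? = some ins) (M : Fin k) :
    lateState adv ω (r + 1) M =
      pdReceive n k β (pdAnswer n k β (lateState adv ω r M)
        (pdAnswers adv ω (lateState adv ω r M)))
        (pdInbox adv ω (electionRounds n k β + r) M) := by
  have hlt := lt_length_of_getElem? hr
  have h4 := currentInstruction_lateState adv ω hn hlt.le M
  rw [hr] at h4
  exact pdState_succ adv ω h4

/-- Sending and receiving read the instruction off the state after the answers; it is still that of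
the current round. -/
theorem currentInstruction_pdAnswer (hn : 0 < n) {r : ℕ}
    (hr : r ≤ (program (electedCommittee n k β ω)).length) (M : Fin k)
    (ans : Query n → Option Bool) :
    currentInstruction n k β (pdAnswer n k β (lateState adv ω r M) ans) =
      (program (electedCommittee n k β ω))[r]? := by
  have h := lateState_public adv ω hn hr M
  refine currentInstruction_of_clock ω ?_ ?_
  · rw [pdAnswer_clock, h.2.1]
  · rw [pdAnswer_bits _ _ (by rw [h.2.1]; omega), h.2.2]

/-! ### Effects of the instructions -/

theorem lateState_res_succ (hn : 0 < n) {r : ℕ} {ins : Instruction}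
    (hr : (program (electedCommittee n k β ω))[r]? = some ins) (M : Fin k) :
    (lateState adv ω (r + 1) M).res = (pdAnswer n k β (lateState adv ω r M)
        (pdAnswers adv ω (lateState adv ω r M))).res := by
  rw [lateState_succ adv ω hn hr, pdReceive_res]

theorem lateState_blacklist_succ (hn : 0 < n) {r : ℕ} {ins : Instruction}
    (hr : (program (electedCommittee n k β ω))[r]? = some ins) (M : Fin k) :
    (lateState adv ω (r + 1) M).blacklist = (pdAnswer n k β (lateState adv ω r M)
        (pdAnswers adv ω (lateState adv ω r M))).blacklist := by
  rw [lateState_succ adv ω hn hr, pdReceive_blacklist]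

theorem pdQueries_lateState (hn : 0 < n) {r : ℕ} {ins : Instruction}
    (hr : (program (electedCommittee n k β ω))[r]? = some ins) (M : Fin k) :
    pdQueries n k β (lateState adv ω r M) =
      match ins with
      | .elect _ => ∅
      | .queryLeaves =>
        (leafIndices (electedCommittee n k β ω) (lateState adv ω r M)).image Query.input
      | .report _ _ => ∅
      | .resolve i t =>
        (conflicts (electedCommittee n k β ω) (lateState adv ω r M) i t).image Query.input := by
  have hlt := lt_length_of_getElem? hr
  have h4 := currentInstruction_lateState adv ω hn hlt.le M
  have h5 := (lateState_public adv ω hn hlt.le M).2.2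
  rw [hr] at h4
  unfold pdQueries
  rw [h4, h5]
  cases ins with
  | elect _ =>
    have := List.mem_of_getElem? hr
    simp [program] at this
  | _ => rfl

theorem lateState_queryLeaves_res (hn : 0 < n) {r : ℕ}
    (hr : (program (electedCommittee n k β ω))[r]? = some .queryLeaves) (M : Fin k) (j : Fin n) :
    (lateState adv ω (r + 1) M).res j =
      if j ∈ leafIndices (electedCommittee n k β ω) (lateState adv ω r M) then adv.input j
      else (lateState adv ω r M).res j := by
  have hlt := lt_length_of_getElem? hr
  have h4 := currentInstruction_lateState adv ω hn hlt.le M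
  rw [lateState_res_succ adv ω hn hr, pdAnswer, h4, hr]
  simp only [pdAnswers]
  rw [pdQueries_lateState adv ω hn hr]
  have : Query.input j ∈ (leafIndices (electedCommittee n k β ω)
      (lateState adv ω r M)).image Query.input ↔
      j ∈ leafIndices (electedCommittee n k β ω) (lateState adv ω r M) := by simp
  simp only [this]
  split_ifs <;> rfl

theorem lateState_res_report (hn : 0 < n) {r i s : ℕ}
    (hr : (program (electedCommittee n k β ω))[r]? = some (.report i s)) (M : Fin k) :
    (lateState adv ω (r + 1) M).res = (lateState adv ω r M).res := by
  have hlt := lt_length_of_getElem? hr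
  have h4 := currentInstruction_lateState adv ω hn hlt.le M
  rw [lateState_res_succ adv ω hn hr, pdAnswer, h4, hr]

theorem lateState_blacklist_queryLeaves (hn : 0 < n) {r : ℕ}
    (hr : (program (electedCommittee n k β ω))[r]? = some .queryLeaves) (M : Fin k) :
    (lateState adv ω (r + 1) M).blacklist = (lateState adv ω r M).blacklist := by
  have hlt := lt_length_of_getElem? hr
  have h4 := currentInstruction_lateState adv ω hn hlt.le M
  rw [lateState_blacklist_succ adv ω hn hr, pdAnswer, h4, hr]

theorem lateState_blacklist_report (hn : 0 < n) {r i s : ℕ}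
    (hr : (program (electedCommittee n k β ω))[r]? = some (.report i s)) (M : Fin k) :
    (lateState adv ω (r + 1) M).blacklist = (lateState adv ω r M).blacklist := by
  have hlt := lt_length_of_getElem? hr
  have h4 := currentInstruction_lateState adv ω hn hlt.le M
  rw [lateState_blacklist_succ adv ω hn hr, pdAnswer, h4, hr]

theorem lateState_reports_report (hn : 0 < n) {r i s : ℕ}
    (hr : (program (electedCommittee n k β ω))[r]? = some (.report i s)) (M : Fin k)
    (v : Node n k) (M' : Fin k) (j : Fin n) :
    (lateState adv ω (r + 1) M).reports v M' j =
      if slot (electedCommittee n k β ω) i s M' = some (v, j) ∧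
          M ∈ recipients (electedCommittee n k β ω) v then
        (pdInbox adv ω (electionRounds n k β + r) M M').bind readBit
      else (lateState adv ω r M).reports v M' j := by
  have hlt := lt_length_of_getElem? hr
  have h4 := currentInstruction_pdAnswer adv ω hn hlt.le M
    (pdAnswers adv ω (lateState adv ω r M))
  have h := lateState_public adv ω hn hlt.le M
  rw [lateState_succ adv ω hn hr, pdReceive, h4, hr]
  simp only [storeReports]
  rw [pdAnswer_bits _ _ (by rw [h.2.1]; omega), h.2.2, pdAnswer_self, h.1, pdAnswer_reports]

theorem lateState_reports_resolve (hn : 0 < n) {r i t : ℕ}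
    (hr : (program (electedCommittee n k β ω))[r]? = some (.resolve i t)) (M : Fin k) :
    (lateState adv ω (r + 1) M).reports = (lateState adv ω r M).reports := by
  have hlt := lt_length_of_getElem? hr
  have h4 := currentInstruction_pdAnswer adv ω hn hlt.le M
    (pdAnswers adv ω (lateState adv ω r M))
  rw [lateState_succ adv ω hn hr, pdReceive, h4, hr]
  exact pdAnswer_reports _ _

theorem pdAnswers_resolve (hn : 0 < n) {r i t : ℕ}
    (hr : (program (electedCommittee n k β ω))[r]? = some (.resolve i t)) (M : Fin k)
    (j : Fin n) :
    pdAnswers adv ω (lateState adv ω r M) (Query.input j) =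
      if j ∈ conflicts (electedCommittee n k β ω) (lateState adv ω r M) i t then
        some (adv.input j) else none := by
  simp only [pdAnswers]
  rw [pdQueries_lateState adv ω hn hr]
  have : Query.input j ∈ (conflicts (electedCommittee n k β ω)
      (lateState adv ω r M) i t).image Query.input ↔
      j ∈ conflicts (electedCommittee n k β ω) (lateState adv ω r M) i t := by simp
  simp only [this]
  rfl

theorem lateState_res_resolve (hn : 0 < n) {r i t : ℕ}
    (hr : (program (electedCommittee n k β ω))[r]? = some (.resolve i t)) (M : Fin k)
    (j : Fin n) :
    (lateState adv ω (r + 1) M).res j =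
      if j ∈ conflicts (electedCommittee n k β ω) (lateState adv ω r M) i t then adv.input j
      else match (nodes n k).find? fun v =>
          Resolves (electedCommittee n k β ω) (lateState adv ω r M) i t v j with
        | some v => decide (Claimed (electedCommittee n k β ω) (lateState adv ω r M) v j true)
        | none => (lateState adv ω r M).res j := by
  have hlt := lt_length_of_getElem? hr
  have h4 := currentInstruction_lateState adv ω hn hlt.le M
  have h := lateState_public adv ω hn hlt.le M
  rw [lateState_res_succ adv ω hn hr, pdAnswer, h4, hr]
  simp only [resolveStep]
  rw [pdAnswers_resolve adv ω hn hr, h.2.2]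
  split_ifs <;> rfl

theorem mem_blacklist_resolve (hn : 0 < n) {r i t : ℕ}
    (hr : (program (electedCommittee n k β ω))[r]? = some (.resolve i t)) (M : Fin k)
    (v : Node n k) (M' : Fin k) :
    M' ∈ (lateState adv ω (r + 1) M).blacklist v ↔
      M' ∈ (lateState adv ω r M).blacklist v ∨ (M' ∈ electedCommittee n k β ω v ∧
        ∃ j, Resolves (electedCommittee n k β ω) (lateState adv ω r M) i t v j ∧
          j ∈ conflicts (electedCommittee n k β ω) (lateState adv ω r M) i t ∧
          claim (lateState adv ω r M) v M' j = some (!adv.input j)) := by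
  have hlt := lt_length_of_getElem? hr
  have h4 := currentInstruction_lateState adv ω hn hlt.le M
  have h := lateState_public adv ω hn hlt.le M
  rw [lateState_blacklist_succ adv ω hn hr, pdAnswer, h4, hr]
  simp only [resolveStep, Finset.mem_union, Finset.mem_filter, h.2.2]
  refine or_congr_right (and_congr_right fun _ => exists_congr fun j => and_congr_right fun _ => ?_)
  rw [pdAnswers_resolve adv ω hn hr]
  split_ifs with hc <;> simp [hc]

/-- The messages sent by the honest machines after the election. -/
theorem message_lateState (hn : 0 < n) {r : ℕ} {ins : Instruction}
    (hr : (program (electedCommittee n k β ω))[r]? = some ins) {M M' : Fin k}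
    (hM : M ∉ adv.byzantine) :
    message (parallelDownload n k β) adv ω (lateState adv ω r) (electionRounds n k β + r) M M' =
      if M = M' then none
      else match ins with
        | .report i s => (slot (electedCommittee n k β ω) i s M).bind fun x =>
            if M' ∈ recipients (electedCommittee n k β ω) x.1 then
              some (bitMessage n ((lateState adv ω r M).res x.2)) else none
        | _ => none := by
  have hlt := lt_length_of_getElem? hr
  have h4 := currentInstruction_lateState adv ω hn hlt.le M
  have h4' := currentInstruction_pdAnswer adv ω hn hlt.le M
    (pdAnswers adv ω (lateState adv ω r M))
  have h := lateState_public adv ω hn hlt.le M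
  unfold message
  split_ifs with h1 h2
  · rfl
  · exfalso
    simp [parallelDownload, h4, hr] at h2
  · change pdSend n k β (pdAnswer n k β (lateState adv ω r M)
      (pdAnswers adv ω (lateState adv ω r M))) M' = _
    rw [pdSend, h4', hr, pdAnswer_bits _ _ (by rw [h.2.1]; omega), h.2.2, pdAnswer_self, h.1]
    cases ins with
    | report i s =>
      have h6 : (pdAnswer n k β (lateState adv ω r M)
          (pdAnswers adv ω (lateState adv ω r M))).res = (lateState adv ω r M).res := by
        rw [pdAnswer, h4, hr]
      rw [h6]
    | _ => rfl

end Execution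

section Program

variable {n k : ℕ} (com : Node n k → Finset (Fin k))

/-! ## The schedule -/

/-- The instructions of phase `i`. -/
def phaseProgram (i : ℕ) : List Instruction :=
  (List.range (maxDuties com i * width n k i)).map (Instruction.report i) ++
    (List.range (width n k i)).map (Instruction.resolve i)

theorem length_phaseProgram (i : ℕ) :
    (phaseProgram com i).length = maxDuties com i * width n k i + width n k i := by
  simp [phaseProgram]

/-- The number of instructions before phase `e + 2`. -/
def phaseStart (e : ℕ) : ℕ :=
  1 + ∑ i ∈ Finset.range e, (maxDuties com (i + 2) * width n k (i + 2) + width n k (i + 2))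

theorem program_eq :
    program com = Instruction.queryLeaves ::
      (List.range (forestHeight n k)).flatMap fun e => phaseProgram com (e + 2) := by
  unfold program
  rw [List.range'_eq_map_range, List.flatMap_map]
  simp only [Nat.add_comm 2]
  rfl

theorem length_flatMap_phaseProgram (e : ℕ) :
    ((List.range e).flatMap fun e => phaseProgram com (e + 2)).length + 1 = phaseStart com e := by
  induction e with
  | zero => simp [phaseStart]
  | succ e ih =>
    rw [List.range_succ, List.flatMap_append, List.length_append]
    simp only [List.flatMap_cons, List.flatMap_nil, List.append_nil, length_phaseProgram]
    unfold phaseStart at ih ⊢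
    rw [Finset.sum_range_succ]
    omega

theorem length_program : (program com).length = phaseStart com (forestHeight n k) := by
  rw [program_eq, List.length_cons, length_flatMap_phaseProgram]

theorem program_getElem?_phaseStart {e : ℕ} (he : e < forestHeight n k) {s : ℕ}
    (hs : s < (phaseProgram com (e + 2)).length) :
    (program com)[phaseStart com e + s]? = (phaseProgram com (e + 2))[s]? := by
  obtain ⟨d, hd⟩ := Nat.exists_eq_add_of_lt he
  -- The range of phases is split as e phases, then the single phase e + 2, then the rest; the
  -- leading `queryLeaves` accounts for the shift by one.
  rw [program_eq, hd, show e + d + 1 = e + (1 + d) by omega, List.range_add, List.flatMap_append,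
    List.range_add, List.map_append, List.flatMap_append, ← length_flatMap_phaseProgram,
    show ∀ a : ℕ, a + 1 + s = (a + s) + 1 by omega, List.getElem?_cons_succ,
    List.getElem?_append_right (by omega), Nat.add_sub_cancel_left]
  simp only [List.range_one, List.map_cons, List.map_nil, List.flatMap_cons, List.flatMap_nil,
    List.append_nil, Nat.add_zero]
  rw [List.getElem?_append_left hs]

theorem program_report {e : ℕ} (he : e < forestHeight n k) {s : ℕ}
    (hs : s < maxDuties com (e + 2) * width n k (e + 2)) :
    (program com)[phaseStart com e + s]? = some (.report (e + 2) s) := by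
  rw [program_getElem?_phaseStart com he (by rw [length_phaseProgram]; omega), phaseProgram,
    List.getElem?_append_left (by simpa using hs)]
  simp [hs]

theorem program_resolve {e : ℕ} (he : e < forestHeight n k) {t : ℕ} (ht : t < width n k (e + 2)) :
    (program com)[phaseStart com e + maxDuties com (e + 2) * width n k (e + 2) + t]? =
      some (.resolve (e + 2) t) := by
  rw [Nat.add_assoc,
    program_getElem?_phaseStart com he (by rw [length_phaseProgram]; omega), phaseProgram,
    List.getElem?_append_right (by simp)]
  simp [ht]

theorem phaseStart_succ (e : ℕ) :
    phaseStart com (e + 1) =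
      phaseStart com e + maxDuties com (e + 2) * width n k (e + 2) + width n k (e + 2) := by
  unfold phaseStart
  rw [Finset.sum_range_succ]
  omega

theorem mem_duties {i : ℕ} {M : Fin k} {v : Node n k} :
    v ∈ duties com i M ↔ reportPhase n k v = i ∧ M ∈ com v := by
  simp [duties, mem_nodes]

theorem slot_spec {i s : ℕ} {M : Fin k} {v : Node n k} {j : Fin n}
    (h : slot com i s M = some (v, j)) :
    reportPhase n k v = i ∧ M ∈ com v ∧ j ∈ indexList n k v := by
  simp only [slot, Option.bind_eq_some_iff, Option.map_eq_some_iff] at h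
  obtain ⟨w, h1, l, h2, h3⟩ := h
  obtain ⟨rfl, rfl⟩ := Prod.mk.inj h3
  have := (mem_duties com).1 (List.mem_of_getElem? h1)
  exact ⟨this.1, this.2, List.mem_of_getElem? h2⟩

theorem exists_slot {i : ℕ} {M : Fin k} {v : Node n k} {j : Fin n}
    (hv : reportPhase n k v = i) (hM : M ∈ com v) (hj : j ∈ indexList n k v) :
    ∃ s < maxDuties com i * width n k i, slot com i s M = some (v, j) := by
  obtain ⟨d, hd, hdv⟩ := List.getElem_of_mem ((mem_duties com).2 ⟨hv, hM⟩)
  obtain ⟨t, ht, htj⟩ := List.getElem_of_mem hj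
  have h1 := length_indexList_le_width hv
  have h2 : (duties com i M).length ≤ maxDuties com i :=
    Finset.le_sup (f := fun M => (duties com i M).length) (Finset.mem_univ M)
  -- Duty number `d` and index number `t` of that duty; division by the width recovers both because
  -- `t` is below the width.
  refine ⟨d * width n k i + t, ?_, ?_⟩
  · calc d * width n k i + t < (d + 1) * width n k i := by rw [add_mul]; omega
      _ ≤ _ := Nat.mul_le_mul_right _ (by omega)
  · unfold slot
    rw [Nat.add_comm, Nat.add_mul_div_right _ _ (by omega), Nat.div_eq_of_lt (by omega), zero_add,
      Nat.add_mul_mod_self_right, Nat.mod_eq_of_lt (by omega), List.getElem?_eq_getElem hd, hdv]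
    simp [List.getElem?_eq_getElem ht, htj]

end Program

section Correctness

variable {n k : ℕ} {β : ℝ} (adv : StaticAdversary n k β) (ω : Coins k)

/-! ## Correctness -/

/-- What holds at the beginning of phase `i`, which is round `r` after the election. -/
structure PhaseInvariant (i r : ℕ) : Prop where
  leaf : ∀ M ∉ adv.byzantine, ∀ v : Node n k, IsLeaf n k v → M ∈ electedCommittee n k β ω v →
    ∀ j ∈ indexList n k v, (lateState adv ω r M).res j = adv.input j
  learned : ∀ M ∉ adv.byzantine, ∀ v : Node n k, reportPhase n k v < i →
    M ∈ recipients (electedCommittee n k β ω) v →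
    ∀ j ∈ indexList n k v, (lateState adv ω r M).res j = adv.input j
  blacklist : ∀ M ∉ adv.byzantine, ∀ M' ∉ adv.byzantine, ∀ v,
    M' ∉ (lateState adv ω r M).blacklist v

/-- The honest members of the committees that report in phase `i` have reported the input. -/
def Reported (i r : ℕ) : Prop :=
  ∀ M ∉ adv.byzantine, ∀ M' ∉ adv.byzantine, M' ≠ M → ∀ v : Node n k, reportPhase n k v = i →
    M ∈ recipients (electedCommittee n k β ω) v → M' ∈ electedCommittee n k β ω v →
    ∀ j ∈ indexList n k v, (lateState adv ω r M).reports v M' j = some (adv.input j)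

variable {adv ω}

/-- A member of a leaf committee has asked the cloud. A member of the committee of a nonleaf node
has learned the index from the child that holds it, which reported in an earlier phase. -/
theorem PhaseInvariant.res_eq (hk : 1 ≤ k) (hkn : k ≤ n) {i r : ℕ}
    (h : PhaseInvariant adv ω i r) {M : Fin k} (hM : M ∉ adv.byzantine) {v : Node n k}
    (hv : reportPhase n k v ≤ i) (hMv : M ∈ electedCommittee n k β ω v) {j : Fin n}
    (hj : j ∈ indexList n k v) : (lateState adv ω r M).res j = adv.input j := by
  by_cases hl : IsLeaf n k v
  · exact h.leaf M hM v hl hMv j hj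
  · obtain ⟨c, hc, hcp, hcj⟩ := exists_child_of_mem hk hkn hl hj
    refine h.learned M hM c ?_ ?_ j hcj
    · rw [hcp]
      exact (level_lt_reportPhase hk hkn v).trans_le hv
    · unfold recipients; rw [hc]; exact hMv

theorem phaseInvariant_start (hn : 0 < n) (hk : 1 ≤ k) (hkn : k ≤ n) :
    PhaseInvariant adv ω 2 1 := by
  have hr : (program (electedCommittee n k β ω))[0]? = some .queryLeaves := by simp [program]
  have h0 := lateState_public adv ω hn (Nat.zero_le _)
  refine ⟨?_, ?_, ?_⟩
  · intro M hM v hv hMv j hj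
    rw [lateState_queryLeaves_res adv ω hn hr, if_pos]
    simp only [leafIndices, Finset.mem_filter, Finset.mem_univ, true_and, (h0 M).1]
    exact ⟨v, hv, hMv, hj⟩
  · intro M hM v hv
    have := two_le_reportPhase hk hkn v
    omega
  · intro M hM M' hM' v
    rw [lateState_blacklist_queryLeaves adv ω hn hr, lateState,
      pdState_eq_of_le_electionRounds adv ω (Nat.add_zero _).le]
    simp

theorem readBit_bitMessage (b : Bool) : readBit (bitMessage n b) = some b := rfl

theorem PhaseInvariant.report (hn : 0 < n) {i r s : ℕ} (h : PhaseInvariant adv ω i r)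
    (hr : (program (electedCommittee n k β ω))[r]? = some (.report i s)) :
    PhaseInvariant adv ω i (r + 1) := by
  refine ⟨?_, ?_, ?_⟩
  · intro M; rw [lateState_res_report adv ω hn hr]; exact h.leaf M
  · intro M; rw [lateState_res_report adv ω hn hr]; exact h.learned M
  · intro M; rw [lateState_blacklist_report adv ω hn hr]; exact h.blacklist M

theorem PhaseInvariant.reports_eq (hn : 0 < n) (hk : 1 ≤ k) (hkn : k ≤ n) {i r s : ℕ}
    (h : PhaseInvariant adv ω i r)
    (hr : (program (electedCommittee n k β ω))[r]? = some (.report i s)) {M M' : Fin k}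
    (hM' : M' ∉ adv.byzantine) (hne : M' ≠ M) {v : Node n k} {j : Fin n}
    (hM : M ∈ recipients (electedCommittee n k β ω) v)
    (hs : slot (electedCommittee n k β ω) i s M' = some (v, j)) :
    (lateState adv ω (r + 1) M).reports v M' j = some (adv.input j) := by
  obtain ⟨h1, h2, h3⟩ := slot_spec _ hs
  rw [lateState_reports_report adv ω hn hr, if_pos ⟨hs, hM⟩]
  have h4 := message_lateState adv ω hn hr (M' := M) hM'
  rw [if_neg hne] at h4
  simp only [hs, Option.bind_some, if_pos hM] at h4
  change (message (parallelDownload n k β) adv ω (lateState adv ω r) _ M' M).bind readBit = _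
  rw [h4, Option.bind_some, readBit_bitMessage, h.res_eq hk hkn hM' h1.le h2 h3]

theorem PhaseInvariant.reports (hn : 0 < n) (hk : 1 ≤ k) (hkn : k ≤ n) {e : ℕ}
    (he : e < forestHeight n k)
    (h : PhaseInvariant adv ω (e + 2) (phaseStart (electedCommittee n k β ω) e)) {s : ℕ}
    (hs : s ≤ maxDuties (electedCommittee n k β ω) (e + 2) * width n k (e + 2)) :
    PhaseInvariant adv ω (e + 2) (phaseStart (electedCommittee n k β ω) e + s) ∧
    ∀ M' ∉ adv.byzantine, ∀ M, M' ≠ M → ∀ (v : Node n k) (j : Fin n),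
      M ∈ recipients (electedCommittee n k β ω) v →
      (∃ s' < s, slot (electedCommittee n k β ω) (e + 2) s' M' = some (v, j)) →
      (lateState adv ω (phaseStart (electedCommittee n k β ω) e + s) M).reports v M' j =
        some (adv.input j) := by
  induction s with
  | zero => exact ⟨h, fun _ _ _ _ _ _ _ ⟨s', hs', _⟩ => absurd hs' (Nat.not_lt_zero _)⟩
  | succ s ih =>
    obtain ⟨ih1, ih2⟩ := ih (by omega)
    have hr := program_report (electedCommittee n k β ω) he (s := s) (by omega)
    refine ⟨ih1.report hn hr, ?_⟩
    rintro M' hM' M hne v j hM ⟨s', hs', hslot⟩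
    rw [← Nat.add_assoc]
    -- If the current slot concerns the same node and index, the entry is written with the correct
    -- bit; otherwise it is left alone.
    by_cases hss : slot (electedCommittee n k β ω) (e + 2) s M' = some (v, j)
    · exact ih1.reports_eq hn hk hkn hr hM' hne hM hss
    · rw [lateState_reports_report adv ω hn hr, if_neg fun h => hss h.1]
      refine ih2 M' hM' M hne v j hM ⟨s', ?_, hslot⟩
      rcases Nat.lt_succ_iff_lt_or_eq.1 hs' with h | rfl
      · exact h
      · exact absurd hslot hss

/-- Honest members claim the truth. A machine does not send to itself, so its own claim rests on
what it knows and every other claim on the report received. -/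
theorem claim_eq (hn : 0 < n) (hk : 1 ≤ k) (hkn : k ≤ n) {i r t : ℕ}
    (hr : r ≤ (program (electedCommittee n k β ω)).length)
    (h : PhaseInvariant adv ω i r) (hrep : Reported adv ω i r) {M M' : Fin k}
    (hM : M ∉ adv.byzantine) (hM' : M' ∉ adv.byzantine) {v : Node n k} {j : Fin n}
    (hv : Resolves (electedCommittee n k β ω) (lateState adv ω r M) i t v j)
    (hM'v : M' ∈ electedCommittee n k β ω v) :
    claim (lateState adv ω r M) v M' j = some (adv.input j) := by
  obtain ⟨h1, h2, h3⟩ := hv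
  have h3 := List.mem_of_getElem? h3
  rw [(lateState_public adv ω hn hr M).1] at h2
  unfold claim
  rw [(lateState_public adv ω hn hr M).1]
  split_ifs with heq
  · subst heq
    rw [h.res_eq hk hkn hM h1.le hM'v h3]
  · exact hrep M hM M' hM' heq v h1 h2 hM'v j h3

/-- The heart of the correctness proof: some honest member of the committee is not blacklisted and
claims the true bit, so without a conflict nobody who counts claims the other one. Indices that were
already right stay right, whether or not they are resolved in this step. -/
theorem resolve_res_eq (hn : 0 < n) (hk : 1 ≤ k) (hkn : k ≤ n)
    (hgood : ∀ v, ∃ M ∈ electedCommittee n k β ω v, M ∉ adv.byzantine) {i r t : ℕ}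
    (h : PhaseInvariant adv ω i r) (hrep : Reported adv ω i r)
    (hr : (program (electedCommittee n k β ω))[r]? = some (.resolve i t)) {M : Fin k}
    (hM : M ∉ adv.byzantine) {j : Fin n}
    (hj : (lateState adv ω r M).res j = adv.input j ∨
      ∃ v, Resolves (electedCommittee n k β ω) (lateState adv ω r M) i t v j) :
    (lateState adv ω (r + 1) M).res j = adv.input j := by
  rw [lateState_res_resolve adv ω hn hr]
  split_ifs with hc
  · rfl
  · split
    · next v hv =>
      have hres := List.find?_some hv
      rw [decide_eq_true_eq] at hres
      obtain ⟨M', hM'v, hM'⟩ := hgood v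
      have hcl : Claimed (electedCommittee n k β ω) (lateState adv ω r M) v j (adv.input j) :=
        ⟨M', Finset.mem_sdiff.2 ⟨hM'v, h.blacklist M hM M' hM' v⟩,
          claim_eq hn hk hkn (lt_length_of_getElem? hr).le h hrep hM hM' hres hM'v⟩
      -- A conflict at any resolving node would have caused a query of `j`, and that case is done.
      have hnc : ¬ Conflict (electedCommittee n k β ω) (lateState adv ω r M) v j := by
        intro hcon
        exact hc (by simpa [conflicts] using ⟨_, _, hres, hcon⟩)
      cases hx : adv.input j with
      | true => rw [hx] at hcl; exact decide_eq_true hcl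
      | false =>
        rw [hx] at hcl
        exact decide_eq_false fun ht => hnc ⟨ht, hcl⟩
    · next hv =>
      rcases hj with hj | ⟨v, hres⟩
      · exact hj
      · rw [List.find?_eq_none] at hv
        exact absurd (decide_eq_true hres) (hv v (mem_nodes v))

theorem PhaseInvariant.resolve (hn : 0 < n) (hk : 1 ≤ k) (hkn : k ≤ n)
    (hgood : ∀ v, ∃ M ∈ electedCommittee n k β ω v, M ∉ adv.byzantine) {i r t : ℕ}
    (h : PhaseInvariant adv ω i r) (hrep : Reported adv ω i r)
    (hr : (program (electedCommittee n k β ω))[r]? = some (.resolve i t)) :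
    PhaseInvariant adv ω i (r + 1) ∧ Reported adv ω i (r + 1) := by
  refine ⟨⟨?_, ?_, ?_⟩, ?_⟩
  · intro M hM v hv hMv j hj
    exact resolve_res_eq hn hk hkn hgood h hrep hr hM (.inl (h.leaf M hM v hv hMv j hj))
  · intro M hM v hv hMv j hj
    exact resolve_res_eq hn hk hkn hgood h hrep hr hM (.inl (h.learned M hM v hv hMv j hj))
  · intro M hM M' hM' v hmem
    rw [mem_blacklist_resolve adv ω hn hr] at hmem
    rcases hmem with hmem | ⟨hcom, j, hres, -, hcl⟩
    · exact h.blacklist M hM M' hM' v hmem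
    · rw [claim_eq hn hk hkn (lt_length_of_getElem? hr).le h hrep hM hM' hres hcom] at hcl
      simp at hcl
  · intro M
    rw [lateState_reports_resolve adv ω hn hr]
    exact hrep M

theorem PhaseInvariant.resolves (hn : 0 < n) (hk : 1 ≤ k) (hkn : k ≤ n)
    (hgood : ∀ v, ∃ M ∈ electedCommittee n k β ω v, M ∉ adv.byzantine) {e r : ℕ}
    (he : e < forestHeight n k)
    (hreq : r = phaseStart (electedCommittee n k β ω) e +
      maxDuties (electedCommittee n k β ω) (e + 2) * width n k (e + 2))
    (h : PhaseInvariant adv ω (e + 2) r) (hrep : Reported adv ω (e + 2) r) {t : ℕ}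
    (ht : t ≤ width n k (e + 2)) :
    PhaseInvariant adv ω (e + 2) (r + t) ∧ Reported adv ω (e + 2) (r + t) ∧
    ∀ M ∉ adv.byzantine, ∀ (v : Node n k) (j : Fin n), reportPhase n k v = e + 2 →
      M ∈ recipients (electedCommittee n k β ω) v →
      (∃ t' < t, (indexList n k v)[t']? = some j) →
      (lateState adv ω (r + t) M).res j = adv.input j := by
  induction t with
  | zero => exact ⟨h, hrep, fun _ _ _ _ _ _ ⟨t', ht', _⟩ => absurd ht' (Nat.not_lt_zero _)⟩
  | succ t ih =>
    obtain ⟨ih1, ih2, ih3⟩ := ih (by omega)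
    have hr := program_resolve (electedCommittee n k β ω) he (t := t) (by omega)
    rw [← hreq] at hr
    obtain ⟨h1, h2⟩ := ih1.resolve hn hk hkn hgood ih2 hr
    refine ⟨h1, h2, ?_⟩
    rintro M hM v j hv hMv ⟨t', ht', htj⟩
    refine resolve_res_eq hn hk hkn hgood ih1 ih2 hr hM ?_
    rcases Nat.lt_succ_iff_lt_or_eq.1 ht' with h' | rfl
    · exact .inl (ih3 M hM v j hv hMv ⟨t', h', htj⟩)
    · refine .inr ⟨v, hv, ?_, htj⟩
      rwa [(lateState_public adv ω hn (lt_length_of_getElem? hr).le M).1]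

/-- One phase: its slots establish `Reported`, and its resolving steps then turn the reported
indices into learned ones. After the last phase the bound `forestHeight + 2` covers the roots as
well. -/
theorem phaseInvariant_phaseStart (hn : 0 < n) (hk : 1 ≤ k) (hkn : k ≤ n)
    (hgood : ∀ v, ∃ M ∈ electedCommittee n k β ω v, M ∉ adv.byzantine) {e : ℕ}
    (he : e ≤ forestHeight n k) :
    PhaseInvariant adv ω (e + 2) (phaseStart (electedCommittee n k β ω) e) := by
  induction e with
  | zero => simpa [phaseStart] using phaseInvariant_start hn hk hkn
  | succ e ih =>
    have h0 := ih (by omega)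
    obtain ⟨h1, h2⟩ := h0.reports hn hk hkn (by omega) le_rfl
    have h3 : Reported adv ω (e + 2) (phaseStart (electedCommittee n k β ω) e +
        maxDuties (electedCommittee n k β ω) (e + 2) * width n k (e + 2)) :=
      fun M _ M' hM' hne v hv hMv hM'v j hj =>
        h2 M' hM' M hne v j hMv (exists_slot _ hv hM'v hj)
    obtain ⟨h4, -, h5⟩ := h1.resolves hn hk hkn hgood (by omega) rfl h3 le_rfl
    rw [phaseStart_succ]
    refine ⟨h4.leaf, ?_, h4.blacklist⟩
    intro M hM v hv hMv j hj
    rcases Nat.lt_succ_iff_lt_or_eq.1 (show reportPhase n k v < e + 2 + 1 by omega) with h | h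
    · exact h4.learned M hM v h hMv j hj
    · obtain ⟨t, ht, htj⟩ := List.getElem_of_mem hj
      exact h5 M hM v j h hMv ⟨t, ht.trans_le (length_indexList_le_width h),
        by rw [List.getElem?_eq_getElem ht, htj]⟩

/-- If every committee has an honest member, then all honest machines learn the input. -/
theorem output_eq (hn : 0 < n) (hk : 1 ≤ k) (hkn : k ≤ n)
    (hgood : ∀ v, ∃ M ∈ electedCommittee n k β ω v, M ∉ adv.byzantine) {M : Fin k}
    (hM : M ∉ adv.byzantine) :
    (parallelDownload n k β).output
      (lateState adv ω (program (electedCommittee n k β ω)).length M) = some adv.input := by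
  have h := phaseInvariant_phaseStart hn hk hkn hgood le_rfl
  rw [← length_program] at h
  have hc := currentInstruction_lateState adv ω hn le_rfl M
  rw [List.getElem?_eq_none le_rfl] at hc
  simp only [parallelDownload, hc, Option.isNone_none, if_true, Option.some_inj]
  funext j
  have hroot : (treeIndex n k j) < numTrees n k := treeIndex_lt hk hkn j
  have hpos := treeSize_pos hk hkn
  -- The root of the tree responsible for `j` reports to all machines.
  refine h.learned M hM (⟨_, hroot⟩, ⟨0, hpos⟩) ?_ ?_ j (mem_indexList.2 (mem_assigned_root hk hkn j))
  · rw [reportPhase_of_eq_zero rfl]; omega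
  · unfold recipients
    rw [parent_eq_none_iff.2 rfl]
    exact Finset.mem_univ _

end Correctness

section Costs

variable {n k : ℕ} {β : ℝ} (adv : StaticAdversary n k β) (ω : Coins k)

/-! ## After termination -/

theorem output_isSome_of_le (hn : 0 < n) (M : Fin k) {t : ℕ}
    (ht : electionRounds n k β + (program (electedCommittee n k β ω)).length ≤ t) :
    ((parallelDownload n k β).output (pdState adv ω t M)).isSome = true := by
  induction t, ht using Nat.le_induction with
  | base =>
    have hc := currentInstruction_lateState adv ω hn le_rfl M
    rw [List.getElem?_eq_none le_rfl] at hc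
    simp [parallelDownload, hc]
  | succ t _ ih =>
    have : pdState adv ω (t + 1) M = pdState adv ω t M := by
      change states _ adv ω (t + 1) M = _
      unfold states
      rw [if_pos ih]
    rw [this, ih]

/-! ## The number of queries -/

theorem queryCount_succ (t : ℕ) (M : Fin k) :
    queryCount (parallelDownload n k β) adv ω (t + 1) M =
      queryCount (parallelDownload n k β) adv ω t M +
        if ((parallelDownload n k β).output (pdState adv ω t M)).isSome then 0
        else (pdQueries n k β (pdState adv ω t M)).card := by
  unfold queryCount
  rw [Finset.sum_range_succ]
  rfl

theorem queryCount_succ_le (t : ℕ) (M : Fin k) :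
    queryCount (parallelDownload n k β) adv ω (t + 1) M ≤
      queryCount (parallelDownload n k β) adv ω t M +
        (pdQueries n k β (pdState adv ω t M)).card := by
  rw [queryCount_succ]
  split_ifs <;> omega

theorem queryCount_mono (M : Fin k) :
    Monotone fun t => queryCount (parallelDownload n k β) adv ω t M :=
  monotone_nat_of_le_succ fun t => by rw [queryCount_succ]; omega

/-- The last batch is truncated at `numRandomBits`, so rounding up to full batches of n costs no
queries. -/
theorem queryCount_election_le {t : ℕ} (ht : t ≤ electionRounds n k β) (M : Fin k) :
    queryCount (parallelDownload n k β) adv ω t M ≤ min (t * n) (numRandomBits n k β) := by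
  induction t with
  | zero => simp [queryCount]
  | succ t ih =>
    have hc : currentInstruction n k β (pdState adv ω t M) = some (Instruction.elect t) := by
      rw [pdState_eq_of_le_electionRounds adv ω (by omega)]
      unfold currentInstruction; simp; omega
    have hq : (pdQueries n k β (pdState adv ω t M)).card ≤
        min n (numRandomBits n k β - t * n) := by
      rw [pdQueries, hc]
      refine Finset.card_image_le.trans ?_
      refine (Finset.card_le_card (t := Finset.range (min n (numRandomBits n k β - t * n)))
        fun s hs => ?_).trans (Finset.card_range _).le
      simp only [Finset.mem_filter, Finset.mem_range] at hs ⊢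
      omega
    have h1 := queryCount_succ_le adv ω t M
    have h2 := ih (by omega)
    rw [add_mul, one_mul]
    omega

/-- The indices of the leaves to whose committees `M` belongs. -/
def leafIndicesOf (com : Node n k → Finset (Fin k)) (M : Fin k) : Finset (Fin n) :=
  Finset.univ.filter fun j => ∃ v : Node n k, IsLeaf n k v ∧ M ∈ com v ∧ j ∈ indexList n k v

/-- A machine keeps blacklists only for committees from which it learns, and only of their members.
Thus the final sizes of the blacklists bound the queries caused by conflicts. -/
theorem mem_of_mem_blacklist (hn : 0 < n) {r : ℕ}
    (hr : r ≤ (program (electedCommittee n k β ω)).length) (M : Fin k) (v : Node n k) (M' : Fin k)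
    (h : M' ∈ (lateState adv ω r M).blacklist v) :
    M ∈ recipients (electedCommittee n k β ω) v ∧ M' ∈ electedCommittee n k β ω v := by
  induction r with
  | zero =>
    rw [lateState, pdState_eq_of_le_electionRounds adv ω (Nat.add_zero _).le] at h
    simp at h
  | succ r ih =>
    have hlt : r < (program (electedCommittee n k β ω)).length := by omega
    have hr' := List.getElem?_eq_getElem hlt
    match hins : (program (electedCommittee n k β ω))[r], hr' with
    | .elect _, hr' =>
      have := List.mem_of_getElem? hr'
      simp [program] at this
    | .queryLeaves, hr' =>
      rw [lateState_blacklist_queryLeaves adv ω hn hr'] at h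
      exact ih hlt.le h
    | .report i s, hr' =>
      rw [lateState_blacklist_report adv ω hn hr'] at h
      exact ih hlt.le h
    | .resolve i t, hr' =>
      rw [mem_blacklist_resolve adv ω hn hr'] at h
      rcases h with h | ⟨hcom, j, hres, -, -⟩
      · exact ih hlt.le h
      · have := hres.2.1
        rw [(lateState_public adv ω hn hlt.le M).1] at this
        exact ⟨this, hcom⟩

/-- Each query caused by a conflict adds a machine to a blacklist. -/
theorem card_conflicts_le (hn : 0 < n) {r i t : ℕ}
    (hr : (program (electedCommittee n k β ω))[r]? = some (.resolve i t)) (M : Fin k) :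
    ∑ v, ((lateState adv ω r M).blacklist v).card +
        (conflicts (electedCommittee n k β ω) (lateState adv ω r M) i t).card ≤
      ∑ v, ((lateState adv ω (r + 1) M).blacklist v).card := by
  classical
  set X := conflicts (electedCommittee n k β ω) (lateState adv ω r M) i t with hX
  have hex : ∀ j ∈ X, ∃ v : Node n k,
      Resolves (electedCommittee n k β ω) (lateState adv ω r M) i t v j ∧
      Conflict (electedCommittee n k β ω) (lateState adv ω r M) v j := by
    intro j hj
    simpa [hX, conflicts] using hj
  -- The nodes whose blacklist grows in this step; the queried indices are injected into them.
  set W := Finset.univ.filter fun v : Node n k =>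
    ((lateState adv ω r M).blacklist v).card < ((lateState adv ω (r + 1) M).blacklist v).card
  have hsub : ∀ v, (lateState adv ω r M).blacklist v ⊆ (lateState adv ω (r + 1) M).blacklist v :=
    fun v M' h => (mem_blacklist_resolve adv ω hn hr M v M').2 (.inl h)
  have hXW : X.card ≤ W.card := by
    rcases X.eq_empty_or_nonempty with h | ⟨j₀, hj₀⟩
    · rw [h]; simp
    -- Provides the default value of the choice function outside `X`.
    have : Nonempty (Node n k) := ⟨(hex j₀ hj₀).choose⟩
    choose! f hf using hex
    refine Finset.card_le_card_of_injOn f ?_ ?_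
    · intro j hj
      obtain ⟨hres, hcon⟩ := hf j hj
      simp only [W, Finset.coe_filter, Finset.mem_univ, true_and, Set.mem_ofPred_eq]
      -- In a conflict both values are claimed, so some member not yet blacklisted claims the wrong
      -- one.
      have hcl : Claimed (electedCommittee n k β ω) (lateState adv ω r M) (f j) j
          (!adv.input j) := by
        cases adv.input j
        · exact hcon.1
        · exact hcon.2
      obtain ⟨M', hM', hcl⟩ := hcl
      rw [Finset.mem_sdiff] at hM'
      refine Finset.card_lt_card ⟨hsub _, fun hle => hM'.2 (hle ?_)⟩
      rw [mem_blacklist_resolve adv ω hn hr]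
      exact .inr ⟨hM'.1, j, hres, hj, hcl⟩
    · intro j hj j' hj' heq
      -- At step `t` a node resolves only its `t`-th index, so the node determines the index.
      have h1 := (hf j hj).1.2.2
      have h2 := (hf j' hj').1.2.2
      rw [heq, h2] at h1
      exact (Option.some_inj.1 h1).symm
  refine (Nat.add_le_add_left hXW _).trans ?_
  rw [Finset.card_filter, ← Finset.sum_add_distrib]
  refine Finset.sum_le_sum fun v _ => ?_
  have := Finset.card_le_card (hsub v)
  split_ifs <;> omega

theorem program_succ_ne_queryLeaves (com : Node n k → Finset (Fin k)) (r : ℕ) :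
    (program com)[r + 1]? ≠ some .queryLeaves := by
  rw [program_eq, List.getElem?_cons_succ]
  intro h
  have := List.mem_of_getElem? h
  simp [phaseProgram] at this

/-- The total size of the blacklists serves as a potential: each later query is paid for by its
growth. -/
theorem queryCount_late_le (hn : 0 < n) {r : ℕ}
    (hr : r + 1 ≤ (program (electedCommittee n k β ω)).length) (M : Fin k) :
    queryCount (parallelDownload n k β) adv ω (electionRounds n k β + (r + 1)) M ≤
      numRandomBits n k β + (leafIndicesOf (electedCommittee n k β ω) M).card +
        ∑ v, ((lateState adv ω (r + 1) M).blacklist v).card := by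
  induction r with
  | zero =>
    have h0 : (program (electedCommittee n k β ω))[0]? = some .queryLeaves := by simp [program]
    have h1 := queryCount_succ_le adv ω (electionRounds n k β + 0) M
    have h2 := queryCount_election_le adv ω le_rfl M
    have h3 := pdQueries_lateState adv ω hn h0 M
    simp only at h3
    rw [h3] at h1
    have h4 : ((leafIndices (electedCommittee n k β ω) (lateState adv ω 0 M)).image
        Query.input).card ≤ (leafIndicesOf (electedCommittee n k β ω) M).card := by
      refine Finset.card_image_le.trans (le_of_eq ?_)
      unfold leafIndices leafIndicesOf
      rw [(lateState_public adv ω hn (by omega) M).1]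
    simp only [Nat.add_zero] at h1
    simp only [zero_add]
    omega
  | succ r ih =>
    have hlt : r + 1 < (program (electedCommittee n k β ω)).length := by omega
    have hr' := List.getElem?_eq_getElem hlt
    have ih := ih hlt.le
    have h1 := queryCount_succ_le adv ω (electionRounds n k β + (r + 1)) M
    have h3 := pdQueries_lateState adv ω hn hr' M
    rw [h3] at h1
    change queryCount (parallelDownload n k β) adv ω (electionRounds n k β + (r + 1 + 1)) M ≤ _
      at h1
    refine h1.trans ?_
    match hins : (program (electedCommittee n k β ω))[r + 1], hr' with
    | .elect _, hr' =>
      have := List.mem_of_getElem? hr'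
      simp [program] at this
    | .queryLeaves, hr' => exact absurd hr' (program_succ_ne_queryLeaves _ _)
    | .report i s, hr' =>
      rw [lateState_blacklist_report adv ω hn hr']
      simpa using ih
    | .resolve i t, hr' =>
      have h4 := card_conflicts_le adv ω hn hr' M
      have h5 : ((conflicts (electedCommittee n k β ω) (lateState adv ω (r + 1) M) i t).image
        (Query.input)).card ≤ _ := Finset.card_image_le
      simp only
      omega

/-- A terminated machine asks nothing, so it suffices to count up to the end of the program, where
each blacklist lies within its committee and is empty for committees that do not report to the
machine. -/
theorem queryCount_le (hn : 0 < n) (t : ℕ) (M : Fin k) :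
    queryCount (parallelDownload n k β) adv ω t M ≤
      numRandomBits n k β + (leafIndicesOf (electedCommittee n k β ω) M).card +
        ∑ v : Node n k with M ∈ recipients (electedCommittee n k β ω) v,
          (electedCommittee n k β ω v).card := by
  set T := electionRounds n k β + (program (electedCommittee n k β ω)).length with hT
  have hlen : 0 < (program (electedCommittee n k β ω)).length := by simp [program]
  obtain ⟨r, hr⟩ : ∃ r, (program (electedCommittee n k β ω)).length = r + 1 :=
    ⟨_, (Nat.sub_add_cancel hlen).symm⟩
  have hmax : queryCount (parallelDownload n k β) adv ω t M ≤
      queryCount (parallelDownload n k β) adv ω T M := by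
    rcases le_total t T with h | h
    · exact queryCount_mono adv ω M h
    · refine le_of_eq ?_
      induction t, h using Nat.le_induction with
      | base => rfl
      | succ t ht ih =>
        rw [queryCount_succ, if_pos (output_isSome_of_le adv ω hn M ht), add_zero, ih]
  refine hmax.trans ?_
  rw [hT, hr]
  refine (queryCount_late_le adv ω hn hr.ge M).trans (Nat.add_le_add_left ?_ _)
  rw [Finset.sum_filter]
  refine Finset.sum_le_sum fun v _ => ?_
  split_ifs with h
  · exact Finset.card_le_card fun M' hM' =>
      (mem_of_mem_blacklist adv ω hn hr.ge M v M' hM').2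
  · rw [Nat.le_zero, Finset.card_eq_zero, Finset.eq_empty_iff_forall_notMem]
    exact fun M' hM' => h (mem_of_mem_blacklist adv ω hn hr.ge M v M' hM').1

/-! ## The number of messages -/

/-- The number of messages that an instruction may cause, counting all machines. -/
def messageBound (com : Node n k → Finset (Fin k)) : Option Instruction → ℕ
  | some (.report i s) => ∑ M, (slot com i s M).elim 0 fun x => (recipients com x.1).card
  | _ => 0

theorem messageCount_succ (t : ℕ) :
    messageCount (parallelDownload n k β) adv ω (t + 1) =
      messageCount (parallelDownload n k β) adv ω t + ∑ M ∈ adv.byzantineᶜ,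
        (Finset.univ.filter fun M' => (message (parallelDownload n k β) adv ω
          (pdState adv ω t) t M M').isSome).card := by
  unfold messageCount
  rw [Finset.sum_range_succ]

theorem messageCount_mono : Monotone fun t => messageCount (parallelDownload n k β) adv ω t :=
  monotone_nat_of_le_succ fun t => by rw [messageCount_succ]; omega

theorem messageCount_election {t : ℕ} (ht : t ≤ electionRounds n k β) :
    messageCount (parallelDownload n k β) adv ω t = 0 := by
  induction t with
  | zero => simp [messageCount]
  | succ t ih =>
    rw [messageCount_succ, ih (by omega), zero_add]
    refine Finset.sum_eq_zero fun M hM => ?_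
    rw [Finset.card_eq_zero, Finset.filter_eq_empty_iff]
    intro M' _
    rw [Finset.mem_compl] at hM
    have hclock : (pdState adv ω t M).clock = t := by
      rw [pdState_eq_of_le_electionRounds adv ω (by omega)]
    unfold message
    split_ifs with h1 h2
    · simp
    · simp
    · change ¬ (pdSend n k β (pdAnswer n k β (pdState adv ω t M)
        (pdAnswers adv ω (pdState adv ω t M))) M').isSome = true
      have hc : currentInstruction n k β (pdAnswer n k β (pdState adv ω t M)
          (pdAnswers adv ω (pdState adv ω t M))) = some (.elect t) := by
        unfold currentInstruction
        rw [pdAnswer_clock, hclock, if_pos (by omega)]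
      rw [pdSend, hc]
      simp

theorem messageCount_late_le (hn : 0 < n) {r : ℕ}
    (hr : r ≤ (program (electedCommittee n k β ω)).length) :
    messageCount (parallelDownload n k β) adv ω (electionRounds n k β + r) ≤
      ∑ q ∈ Finset.range r, messageBound (electedCommittee n k β ω)
        (program (electedCommittee n k β ω))[q]? := by
  induction r with
  | zero => rw [messageCount_election adv ω (Nat.add_zero _).le]; simp
  | succ r ih =>
    rw [← Nat.add_assoc, messageCount_succ, Finset.sum_range_succ]
    refine Nat.add_le_add (ih (by omega)) ?_
    have hr' := List.getElem?_eq_getElem (show r < (program (electedCommittee n k β ω)).length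
      by omega)
    rw [hr']
    have hmsg := fun M hM M' => message_lateState adv ω hn hr' (M := M) (M' := M') hM
    match hins : (program (electedCommittee n k β ω))[r], hmsg with
    | .elect _, hmsg | .queryLeaves, hmsg | .resolve _ _, hmsg =>
      refine le_of_eq (Finset.sum_eq_zero fun M hM => ?_)
      rw [Finset.card_eq_zero, Finset.filter_eq_empty_iff]
      intro M' _
      rw [Finset.mem_compl] at hM
      rw [hmsg M hM M']
      simp
    | .report i s, hmsg =>
      refine (Finset.sum_le_sum fun M hM => ?_).trans
        (Finset.sum_le_sum_of_subset (Finset.subset_univ _))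
      rw [Finset.mem_compl] at hM
      simp only [hmsg M hM]
      cases hslot : slot (electedCommittee n k β ω) i s M with
      | none => simp
      | some x =>
        refine Finset.card_le_card fun M' hM' => ?_
        simp only [Finset.mem_filter, Finset.mem_univ, true_and, Option.bind_some] at hM'
        by_contra hc
        rw [if_neg hc] at hM'
        simp at hM'

theorem messageCount_le_sum (hn : 0 < n) (t : ℕ) :
    messageCount (parallelDownload n k β) adv ω t ≤
      ∑ q ∈ Finset.range (program (electedCommittee n k β ω)).length,
        messageBound (electedCommittee n k β ω) (program (electedCommittee n k β ω))[q]? := by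
  refine le_trans ?_ (messageCount_late_le adv ω hn le_rfl)
  set T := electionRounds n k β + (program (electedCommittee n k β ω)).length
  rcases le_total t T with h | h
  · exact messageCount_mono adv ω h
  · refine le_of_eq ?_
    induction t, h using Nat.le_induction with
    | base => rfl
    | succ t ht ih =>
      rw [messageCount_succ, ih, Nat.add_eq_left]
      refine Finset.sum_eq_zero fun M hM => ?_
      rw [Finset.card_eq_zero, Finset.filter_eq_empty_iff]
      intro M' _
      rw [Finset.mem_compl] at hM
      unfold message
      rw [if_neg hM, if_pos (output_isSome_of_le adv ω hn M ht)]
      simp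

theorem sum_messageBound_phaseStart (com : Node n k → Finset (Fin k)) {e : ℕ}
    (he : e ≤ forestHeight n k) :
    ∑ q ∈ Finset.range (phaseStart com e), messageBound com (program com)[q]? =
      ∑ d ∈ Finset.range e, ∑ s ∈ Finset.range (maxDuties com (d + 2) * width n k (d + 2)),
        messageBound com (some (.report (d + 2) s)) := by
  induction e with
  | zero => simp [phaseStart, program, messageBound]
  | succ e ih =>
    rw [phaseStart_succ, Finset.sum_range_add, Finset.sum_range_add, ih (by omega),
      Finset.sum_range_succ]
    have h1 : ∀ s ∈ Finset.range (maxDuties com (e + 2) * width n k (e + 2)),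
        messageBound com (program com)[phaseStart com e + s]? =
          messageBound com (some (.report (e + 2) s)) := fun s hs => by
      rw [program_report com (by omega) (Finset.mem_range.1 hs)]
    have h2 : ∀ t ∈ Finset.range (width n k (e + 2)), messageBound com
        (program com)[phaseStart com e + maxDuties com (e + 2) * width n k (e + 2) + t]? = 0 :=
      fun t ht => by
        rw [program_resolve com (by omega) (Finset.mem_range.1 ht)]
        rfl
    rw [Finset.sum_congr rfl h1, Finset.sum_eq_zero h2, add_zero]

theorem nodup_duties (com : Node n k → Finset (Fin k)) (i : ℕ) (M : Fin k) :
    (duties com i M).Nodup :=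
  nodup_nodes.filter _

theorem getElem?_inj_of_nodup {α : Type*} {l : List α} (hl : l.Nodup) {a b : ℕ} {x : α}
    (ha : l[a]? = some x) (hb : l[b]? = some x) : a = b := by
  obtain ⟨h1, h1'⟩ := List.getElem?_eq_some_iff.1 ha
  obtain ⟨h2, h2'⟩ := List.getElem?_eq_some_iff.1 hb
  exact (hl.getElem_inj_iff).1 (h1'.trans h2'.symm)

/-- The lists of duties and of indices have no repetitions, so the pair determines quotient and
remainder of the slot by the width. Hence no report is sent twice. -/
theorem slot_inj (com : Node n k → Finset (Fin k)) {i s s' : ℕ} {M : Fin k}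
    {x : Node n k × Fin n} (h : slot com i s M = some x) (h' : slot com i s' M = some x) :
    s = s' := by
  simp only [slot, Option.bind_eq_some_iff, Option.map_eq_some_iff] at h h'
  obtain ⟨w, h1, l, h2, rfl⟩ := h
  obtain ⟨w', h1', l', h2', h3⟩ := h'
  obtain ⟨rfl, rfl⟩ := Prod.mk.inj h3
  have e1 := getElem?_inj_of_nodup (nodup_duties com i M) h1 h1'
  have e2 := getElem?_inj_of_nodup (nodup_indexList _) h2 h2'
  rw [← Nat.div_add_mod s (width n k i), ← Nat.div_add_mod s' (width n k i), e1, e2]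

theorem sum_slot_le (com : Node n k → Finset (Fin k)) (i m : ℕ) (M : Fin k) :
    ∑ s ∈ Finset.range m, (slot com i s M).elim 0 (fun x => (recipients com x.1).card) ≤
      ∑ v : Node n k with reportPhase n k v = i ∧ M ∈ com v,
        (indexList n k v).length * (recipients com v).card := by
  classical
  set f : Option (Node n k × Fin n) → ℕ := fun o => o.elim 0 fun x => (recipients com x.1).card
  set P := (Finset.univ.filter fun v : Node n k => reportPhase n k v = i ∧ M ∈ com v).sigma
    fun v => assigned n k v.1 v.2
  -- Idle slots contribute nothing and are removed, since `slot` is injective only where it is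
  -- defined.
  have h1 : ∑ s ∈ Finset.range m, f (slot com i s M) =
      ∑ s ∈ (Finset.range m).filter fun s => (slot com i s M).isSome, f (slot com i s M) := by
    rw [Finset.sum_filter]
    refine Finset.sum_congr rfl fun s _ => ?_
    split_ifs with h
    · rfl
    · rw [Option.not_isSome_iff_eq_none.1 h]; rfl
  have hinj : Set.InjOn (fun s => slot com i s M)
      ((Finset.range m).filter fun s => (slot com i s M).isSome : Finset ℕ) := by
    intro s hs s' _ heq
    obtain ⟨x, hx⟩ := Option.isSome_iff_exists.1 (Finset.mem_filter.1 hs).2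
    exact slot_inj com hx (heq.symm.trans hx)
  change ∑ s ∈ Finset.range m, f (slot com i s M) ≤ _
  rw [h1, ← Finset.sum_image (f := f) hinj]
  calc _ ≤ ∑ x ∈ P.image fun y => some (y.1, y.2), f x := by
        refine Finset.sum_le_sum_of_subset fun o ho => ?_
        obtain ⟨s, hs, rfl⟩ := Finset.mem_image.1 ho
        obtain ⟨⟨v, j⟩, hx⟩ := Option.isSome_iff_exists.1 (Finset.mem_filter.1 hs).2
        obtain ⟨a, b, c⟩ := slot_spec com hx
        refine Finset.mem_image.2 ⟨⟨v, j⟩, ?_, hx.symm⟩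
        simp only [P, Finset.mem_sigma, Finset.mem_filter, Finset.mem_univ, true_and]
        exact ⟨⟨a, b⟩, mem_indexList.1 c⟩
    _ ≤ ∑ y ∈ P, f (some (y.1, y.2)) := Finset.sum_image_le_of_nonneg fun _ _ => Nat.zero_le _
    _ = _ := by
        rw [Finset.sum_sigma]
        refine Finset.sum_congr rfl fun v _ => ?_
        simp [f, length_indexList]

theorem sum_messageBound_report_le (com : Node n k → Finset (Fin k)) (i m : ℕ) :
    ∑ s ∈ Finset.range m, messageBound com (some (.report i s)) ≤
      ∑ v : Node n k with reportPhase n k v = i,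
        (indexList n k v).length * ((com v).card * (recipients com v).card) := by
  unfold messageBound
  rw [Finset.sum_comm]
  refine (Finset.sum_le_sum fun M _ => sum_slot_le com i m M).trans (le_of_eq ?_)
  simp only [Finset.sum_filter]
  rw [Finset.sum_comm]
  refine Finset.sum_congr rfl fun v _ => ?_
  split_ifs with h
  · simp only [h, true_and]
    rw [← Finset.sum_filter, Finset.sum_const, smul_eq_mul]
    have : (Finset.univ.filter fun M => M ∈ com v) = com v := by ext; simp
    rw [this]; ring
  · simp [h]

theorem messageCount_le (hk : 1 ≤ k) (hkn : k ≤ n) {c : ℕ}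
    (hc : ∀ v, (electedCommittee n k β ω v).card ≤ c) (t : ℕ) :
    messageCount (parallelDownload n k β) adv ω t ≤
      (forestHeight n k - 1) * (n * (c * c)) + n * (c * k) := by
  refine (messageCount_le_sum adv ω (by omega) t).trans ?_
  rw [length_program, sum_messageBound_phaseStart _ le_rfl]
  have hH : 0 < forestHeight n k := level_pos _
  obtain ⟨h, hh⟩ : ∃ h, forestHeight n k = h + 1 := ⟨_, (Nat.sub_add_cancel hH).symm⟩
  -- A phase whose nodes have at most `b` recipients costs at most `n * (c * b)`; here `b` is `c`
  -- before the last phase and `k` in it.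
  have key : ∀ (e b : ℕ), (∀ v : Node n k, reportPhase n k v = e + 2 →
      (recipients (electedCommittee n k β ω) v).card ≤ b) →
      ∑ s ∈ Finset.range (maxDuties (electedCommittee n k β ω) (e + 2) * width n k (e + 2)),
        messageBound (electedCommittee n k β ω) (some (.report (e + 2) s)) ≤ n * (c * b) := by
    intro e b hb
    refine (sum_messageBound_report_le _ _ _).trans ?_
    refine (Finset.sum_le_sum fun v hv => Nat.mul_le_mul_left _
      (Nat.mul_le_mul (hc v) (hb v (Finset.mem_filter.1 hv).2))).trans ?_
    rw [← Finset.sum_mul]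
    exact Nat.mul_le_mul_right _ (sum_length_indexList_le hk hkn _)
  rw [hh, Finset.sum_range_succ, Nat.add_sub_cancel]
  refine Nat.add_le_add ?_ (key _ _ fun v _ => (Finset.card_le_univ _).trans (by simp))
  refine (Finset.sum_le_card_nsmul _ _ (n * (c * c)) fun e he => ?_).trans (by simp)
  refine key _ _ fun v hv => ?_
  rw [Finset.mem_range] at he
  have h0 : (v.2 : ℕ) ≠ 0 := fun h0 => by
    rw [reportPhase_of_eq_zero h0] at hv; omega
  unfold recipients
  cases hp : parent n k v with
  | none => exact absurd (parent_eq_none_iff.1 hp) h0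
  | some u => exact hc u

end Costs

open MeasureTheory

/-! ## Counting polynomials -/

section Counting

/-- The fibres of a surjective homomorphism have equal size, so taking preimages preserves density.
-/
theorem card_preimage_mul_card {G H : Type*} [AddGroup G] [Fintype G] [AddGroup H] [Fintype H]
    [DecidableEq H] (φ : G →+ H) (hφ : Function.Surjective φ) (T : Finset H) :
    (Finset.univ.filter fun g => φ g ∈ T).card * Fintype.card H = T.card * Fintype.card G := by
  have hf : ∀ y, (Finset.univ.filter fun g => φ g = y).card =
      (Finset.univ.filter fun g => φ g = 0).card :=
    fun y => AddMonoidHom.card_fiber_eq_of_mem_range φ (hφ y) (hφ 0)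
  have key : ∀ T : Finset H, (Finset.univ.filter fun g => φ g ∈ T).card =
      T.card * (Finset.univ.filter fun g => φ g = 0).card := by
    intro T
    rw [Finset.card_eq_sum_card_fiberwise (f := φ) (t := T) (fun g hg => by simpa using hg),
      Finset.sum_const_nat]
    intro y hy
    rw [← hf y]
    congr 1
    ext g
    simp only [Finset.mem_filter, Finset.mem_univ, true_and]
    exact ⟨fun h => h.2, fun h => ⟨h ▸ hy, h⟩⟩
  have h2 := key Finset.univ
  simp only [Finset.mem_univ, Finset.filter_true, Finset.card_univ] at h2
  rw [key T, h2]
  ring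

variable {F : Type*} [Field F]

/-- The evaluation of a polynomial that is given by its coefficients. -/
def evalCoeffs {d : ℕ} (p : Fin d → F) (x : F) : F := ∑ e : Fin d, p e * x ^ (e : ℕ)

/-- The values at finitely many points of a polynomial that is given by its coefficients. -/
def evalHom {ι : Type*} (d : ℕ) (x : ι → F) : (Fin d → F) →+ (ι → F) where
  toFun p i := evalCoeffs p (x i)
  map_zero' := by funext i; simp [evalCoeffs]
  map_add' p q := by funext i; simp [evalCoeffs, add_mul, Finset.sum_add_distrib]

/-- Lagrange interpolation produces a polynomial of degree below the number of points. -/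
theorem evalHom_surjective {ι : Type*} [Fintype ι] {d : ℕ} {x : ι → F}
    (hx : Function.Injective x) (hd : Fintype.card ι ≤ d) (hd0 : 0 < d) :
    Function.Surjective (evalHom d x) := by
  classical
  intro y
  set P := Lagrange.interpolate Finset.univ x y
  have hdeg : P.degree < d :=
    lt_of_lt_of_le (Lagrange.degree_interpolate_lt y hx.injOn) (by
      rw [Finset.card_univ]; exact_mod_cast hd)
  have hnat : P.natDegree < d := by
    rcases eq_or_ne P 0 with h | h
    · rw [h]; simpa using hd0
    · exact (Polynomial.natDegree_lt_iff_degree_lt h).2 hdeg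
  refine ⟨fun e => P.coeff e, ?_⟩
  funext i
  change ∑ e : Fin d, P.coeff e * x i ^ (e : ℕ) = y i
  rw [← Lagrange.eval_interpolate_at_node y hx.injOn (Finset.mem_univ i),
    Polynomial.eval_eq_sum_range' hnat, Finset.sum_range]

/-- Values of a random polynomial of degree less than `d` at up to `d` points are independent. -/
theorem density_evalCoeffs [Fintype F] {ι : Type*} [Fintype ι] {d : ℕ} {x : ι → F}
    (hx : Function.Injective x) (hd : Fintype.card ι ≤ d) (hd0 : 0 < d) (B : Finset F)
    (G : Finset (Fin d → F)) (hG : ∀ p, p ∈ G ↔ ∀ i, evalCoeffs p (x i) ∈ B) :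
    (G.card : ℝ) / (Fintype.card F : ℝ) ^ d =
      ((B.card : ℝ) / Fintype.card F) ^ Fintype.card ι := by
  classical
  have h := card_preimage_mul_card (evalHom d x) (evalHom_surjective hx hd hd0)
    (Fintype.piFinset fun _ => B)
  have hGe : (Finset.univ.filter fun p => evalHom d x p ∈ Fintype.piFinset fun _ : ι => B) = G := by
    ext p
    simp only [Finset.mem_filter, Finset.mem_univ, true_and, Fintype.mem_piFinset, hG]
    rfl
  rw [hGe, Fintype.card_piFinset, Finset.prod_const, Finset.card_univ, Fintype.card_fun, Fintype.card_fun, Fintype.card_fin] at h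
  have h' : (G.card : ℝ) * (Fintype.card F : ℝ) ^ Fintype.card ι =
      (B.card : ℝ) ^ Fintype.card ι * (Fintype.card F : ℝ) ^ d := by exact_mod_cast h
  have hq : (Fintype.card F : ℝ) ≠ 0 := by exact_mod_cast Fintype.card_ne_zero
  rw [div_pow, div_eq_div_iff (pow_ne_zero _ hq) (pow_ne_zero _ hq), h']

end Counting

/-! ## The coefficients of the hash functions are uniformly distributed -/

section Coins

variable {k : ℕ}

theorem coinMeasure_cylinder (b : ℕ → Bool) (N : ℕ) :
    coinMeasure k {ω | ∀ s < N, ω (Sum.inl s) = b s} = (2⁻¹ : ENNReal) ^ N := by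
  have hset : {ω : Coins k | ∀ s < N, ω (Sum.inl s) = b s} =
      (((Finset.range N).map ⟨Sum.inl, Sum.inl_injective⟩ : Finset (ℕ ⊕ (Fin k × ℕ))) :
        Set (ℕ ⊕ (Fin k × ℕ))).pi fun i => {Sum.elim b (fun _ => false) i} := by
    ext ω
    simp [Set.mem_pi]
  rw [hset, coinMeasure, Measure.infinitePi_pi _ fun _ _ => measurableSet_singleton _,
    Finset.prod_map]
  simp

end Coins

section Hash

variable {n k : ℕ} {β : ℝ}

theorem toField_injOn {x y : ℕ} (hx : x < 2 ^ wordLength n k) (hy : y < 2 ^ wordLength n k)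
    (h : toField n k x = toField n k y) : x = y := by
  have := (fieldEquiv n k).symm.injective h
  rw [Fin.mk.injEq, Nat.mod_eq_of_lt hx, Nat.mod_eq_of_lt hy] at this
  exact this

theorem randomWord_eq (bits : ℕ → Bool) (l : ℕ) :
    randomWord n k bits l = ∑ i ∈ (Finset.range (wordLength n k)).filter
      (fun i => bits (l * wordLength n k + i) = true), 2 ^ i := by
  rw [Finset.sum_filter]; rfl

theorem randomWord_lt (bits : ℕ → Bool) (l : ℕ) :
    randomWord n k bits l < 2 ^ wordLength n k := by
  rw [randomWord_eq]
  exact Nat.geomSum_lt le_rfl fun i hi => Finset.mem_range.1 (Finset.mem_filter.1 hi).1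

/-- Binary expansions are unique. -/
theorem bits_eq_of_randomWord_eq {bits bits' : ℕ → Bool} {l i : ℕ} (hi : i < wordLength n k)
    (h : randomWord n k bits l = randomWord n k bits' l) :
    bits (l * wordLength n k + i) = bits' (l * wordLength n k + i) := by
  rw [randomWord_eq, randomWord_eq] at h
  have := Finset.geomSum_injective le_rfl h
  have := Finset.ext_iff.1 this i
  simp only [Finset.mem_filter, Finset.mem_range, hi, true_and] at this
  exact Bool.eq_iff_iff.2 this

/-- The coefficients of the hash functions. -/
noncomputable def hashCoeffs (n k : ℕ) (β : ℝ) (ω : Coins k) :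
    Fin (committeeSize n β) → Fin (committeeSize n β) → GaloisField 2 (wordLength n k) :=
  fun u e => toField n k (randomWord n k (fun s => ω (Sum.inl s)) (u * committeeSize n β + e))

/-- The field element that stands for a node. -/
noncomputable def nodeElement (v : Node n k) : GaloisField 2 (wordLength n k) :=
  toField n k (nodeNumber n k v)

theorem hash_eq (ω : Coins k) (u : Fin (committeeSize n β)) (v : Node n k) :
    hash n k β (fun s => ω (Sum.inl s)) u v =
      (fieldEquiv n k (evalCoeffs (hashCoeffs n k β ω u) (nodeElement v)) : ℕ) % k := by
  unfold hash evalCoeffs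
  rw [Finset.sum_range]
  rfl

/-- With words of length m, bit `s` lies in word s / m, which is coefficient (s / m) % σ of hash
function (s / m) / σ. -/
theorem bits_eq_of_hashCoeffs_eq {ω ω' : Coins k}
    (h : hashCoeffs n k β ω = hashCoeffs n k β ω') {s : ℕ} (hs : s < numRandomBits n k β) :
    ω (Sum.inl s) = ω' (Sum.inl s) := by
  set σ := committeeSize n β with hσ
  have hm : 0 < wordLength n k := Nat.succ_pos _
  have hl : s / wordLength n k < σ * σ := by
    rw [Nat.div_lt_iff_lt_mul hm]
    exact hs
  have hσ0 : 0 < σ := Nat.pos_of_ne_zero fun h0 => by simp [h0] at hl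
  have hu : s / wordLength n k / σ < σ := by rwa [Nat.div_lt_iff_lt_mul hσ0]
  have he : s / wordLength n k % σ < σ := Nat.mod_lt _ hσ0
  have h1 := congrFun (congrFun h ⟨_, hu⟩) ⟨_, he⟩
  have h2 := toField_injOn (randomWord_lt _ _) (randomWord_lt _ _) h1
  simp only [← hσ, Nat.div_add_mod'] at h2
  have h3 := bits_eq_of_randomWord_eq (Nat.mod_lt s hm) h2
  simpa only [Nat.div_add_mod'] using h3

/-- All outcomes with given coefficients lie in one cylinder. An upper bound suffices for the union
bounds, so measurability of the events is never needed. -/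
theorem coinMeasure_hashCoeffs_eq_le
    (a : Fin (committeeSize n β) → Fin (committeeSize n β) → GaloisField 2 (wordLength n k)) :
    coinMeasure k {ω | hashCoeffs n k β ω = a} ≤ (2⁻¹ : ENNReal) ^ numRandomBits n k β := by
  rcases Set.eq_empty_or_nonempty {ω : Coins k | hashCoeffs n k β ω = a} with h | ⟨ω₀, h₀⟩
  · rw [h]; simp
  · rw [← coinMeasure_cylinder (k := k) fun s => ω₀ (Sum.inl s)]
    refine measure_mono fun ω hω s hs => ?_
    exact bits_eq_of_hashCoeffs_eq (β := β) (hω.trans h₀.symm) hs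

noncomputable instance fintypeGaloisField : Fintype (GaloisField 2 (wordLength n k)) := Fintype.ofFinite _

theorem card_field : Fintype.card (GaloisField 2 (wordLength n k)) = 2 ^ wordLength n k := by
  rw [← Nat.card_eq_fintype_card]
  exact GaloisField.card 2 (wordLength n k) (Nat.succ_ne_zero _)

/-- Independence of the hash functions, as an upper bound: there are ∏ |G u| admissible coefficient
arrays, each of probability at most 2 ^ (-σ²m), and the field has 2 ^ m elements. -/
theorem coinMeasure_forall_hashCoeffs_mem_le
    (G : Fin (committeeSize n β) →
      Finset (Fin (committeeSize n β) → GaloisField 2 (wordLength n k))) :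
    coinMeasure k {ω | ∀ u, hashCoeffs n k β ω u ∈ G u} ≤
      ENNReal.ofReal (∏ u, ((G u).card : ℝ) /
        (Fintype.card (GaloisField 2 (wordLength n k)) : ℝ) ^ committeeSize n β) := by
  classical
  have hsub : {ω : Coins k | ∀ u, hashCoeffs n k β ω u ∈ G u} ⊆
      ⋃ a ∈ Fintype.piFinset G, {ω | hashCoeffs n k β ω = a} := by
    intro ω hω
    simp only [Set.mem_iUnion]
    exact ⟨hashCoeffs n k β ω, Fintype.mem_piFinset.2 hω, rfl⟩
  refine (measure_mono hsub).trans ((measure_biUnion_finset_le _ _).trans ?_)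
  refine (Finset.sum_le_card_nsmul _ _ _ fun a _ => coinMeasure_hashCoeffs_eq_le a).trans ?_
  rw [Fintype.card_piFinset, Finset.prod_div_distrib, Finset.prod_const, Finset.card_univ,
    Fintype.card_fin, card_field]
  have h2 : (2⁻¹ : ENNReal) = ENNReal.ofReal 2⁻¹ := by
    rw [ENNReal.ofReal_inv_of_pos (by norm_num)]; simp
  rw [h2, ← ENNReal.ofReal_pow (by norm_num), nsmul_eq_mul, ← ENNReal.ofReal_natCast,
    ← ENNReal.ofReal_mul (by positivity)]
  refine ENNReal.ofReal_le_ofReal (le_of_eq ?_)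
  push_cast
  rw [inv_pow, div_eq_mul_inv]
  congr 2
  rw [← pow_mul, ← pow_mul, numRandomBits]
  congr 1
  ring

/-! ### Single residues -/

theorem card_fieldEquiv_filter (P : ℕ → Prop) [DecidablePred P] :
    (Finset.univ.filter fun y => P (fieldEquiv n k y)).card =
      ((Finset.range (2 ^ wordLength n k)).filter P).card := by
  refine Finset.card_bij (fun y _ => (fieldEquiv n k y : ℕ)) ?_ ?_ ?_
  · intro y hy
    simp only [Finset.mem_filter, Finset.mem_univ, true_and, Finset.mem_range] at hy ⊢
    exact ⟨(fieldEquiv n k y).2, hy⟩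
  · intro y _ z _ h
    exact (fieldEquiv n k).injective (Fin.ext h)
  · intro x hx
    simp only [Finset.mem_filter, Finset.mem_range] at hx
    exact ⟨(fieldEquiv n k).symm ⟨x, hx.1⟩, by simpa using hx.2, by simp⟩

theorem card_filter_mod_eq (q : ℕ) (M : Fin k) :
    q / k ≤ ((Finset.range q).filter fun x => x % k = M).card ∧
    ((Finset.range q).filter fun x => x % k = M).card ≤ q / k + 1 := by
  have hk : 0 < k := M.pos
  have h := Nat.count_modEq_card q hk M
  rw [Nat.count_eq_card_filter_range] at h
  have he : ((Finset.range q).filter fun x => x % k = M) =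
      (Finset.range q).filter fun x => x ≡ M [MOD k] := by
    refine Finset.filter_congr fun x _ => ?_
    rw [Nat.ModEq, Nat.mod_eq_of_lt M.2]
  rw [he, h]
  split_ifs <;> omega

/-- One factor 2 comes from the summand 1 in `wordLength`, the other from n ≥ 2. -/
theorem mul_le_two_pow_wordLength (hn : 2 ≤ n) : 4 * k ≤ 2 ^ wordLength n k := by
  unfold wordLength
  have := Nat.le_pow_clog (show 1 < 2 by norm_num) (n * max (numNodes n k) k)
  have h1 : 2 * k ≤ n * max (numNodes n k) k := Nat.mul_le_mul hn (le_max_right _ _)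
  rw [pow_succ]
  omega

theorem numNodes_le_two_pow_wordLength (hn : 2 ≤ n) : numNodes n k ≤ 2 ^ wordLength n k := by
  unfold wordLength
  have := Nat.le_pow_clog (show 1 < 2 by norm_num) (n * max (numNodes n k) k)
  have h1 : 2 * numNodes n k ≤ n * max (numNodes n k) k := Nat.mul_le_mul hn (le_max_left _ _)
  rw [pow_succ]
  omega

theorem nodeNumber_lt (v : Node n k) : nodeNumber n k v < numNodes n k := by
  unfold nodeNumber numNodes
  calc v.1 * treeSize n k + v.2 < (v.1 + 1) * treeSize n k := by
        rw [add_mul, one_mul]; exact Nat.add_lt_add_left v.2.2 _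
    _ ≤ _ := Nat.mul_le_mul_right _ v.1.2

theorem nodeNumber_injective : Function.Injective (nodeNumber n k) := by
  intro v w h
  have hpos : 0 < treeSize n k := v.2.pos
  unfold nodeNumber at h
  have h1 := congrArg (· / treeSize n k) h
  have h2 := congrArg (· % treeSize n k) h
  simp only [Nat.add_comm _ (Fin.val _), Nat.add_mul_div_right _ _ hpos,
    Nat.add_mul_mod_self_right, Nat.div_eq_of_lt v.2.2, Nat.div_eq_of_lt w.2.2,
    Nat.mod_eq_of_lt v.2.2, Nat.mod_eq_of_lt w.2.2] at h1 h2
  exact Prod.ext (Fin.ext h1) (Fin.ext h2)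

theorem nodeElement_injective (hn : 2 ≤ n) :
    Function.Injective (nodeElement : Node n k → GaloisField 2 (wordLength n k)) := by
  intro v w h
  have hle := numNodes_le_two_pow_wordLength (k := k) hn
  exact nodeNumber_injective (toField_injOn ((nodeNumber_lt v).trans_le hle)
    ((nodeNumber_lt w).trans_le hle) h)

/-- The field elements that are hashed to the machine `M`. -/
noncomputable def elementsOf (M : Fin k) : Finset (GaloisField 2 (wordLength n k)) :=
  Finset.univ.filter fun y => (fieldEquiv n k y : ℕ) % k = M

/-- A residue class has at most q/k + 1 elements, and q ≥ k, so rounding at most doubles the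
probability. -/
theorem card_elementsOf_le (hn : 2 ≤ n) (M : Fin k) :
    ((elementsOf (n := n) M).card : ℝ) / Fintype.card (GaloisField 2 (wordLength n k)) ≤ 2 / k := by
  have hk : 0 < k := M.pos
  have h0 : (elementsOf (n := n) M).card ≤ 2 ^ wordLength n k / k + 1 := by
    rw [elementsOf, card_fieldEquiv_filter fun x => x % k = M]
    exact (card_filter_mod_eq _ M).2
  have h1 : (elementsOf (n := n) M).card * k ≤ 2 * 2 ^ wordLength n k := by
    have h2 := Nat.div_mul_le_self (2 ^ wordLength n k) k
    have h3 := mul_le_two_pow_wordLength (k := k) hn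
    calc (elementsOf (n := n) M).card * k ≤ (2 ^ wordLength n k / k + 1) * k :=
          Nat.mul_le_mul_right _ h0
      _ ≤ _ := by rw [add_mul]; omega
  rw [card_field, div_le_div_iff₀ (by positivity) (by exact_mod_cast hk)]
  exact_mod_cast h1

/-- The field elements that are hashed to Byzantine machines. -/
noncomputable def byzantineElements (Z : Finset (Fin k)) :
    Finset (GaloisField 2 (wordLength n k)) :=
  Finset.univ.filter fun y => ∃ M ∈ Z, (fieldEquiv n k y : ℕ) % k = M

/-- Each machine outside `Z` receives at least ⌊q/k⌋ > q/k - 1 ≥ (3/4) q/k elements, as q ≥ 4k, and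
there are at least (1 - β) k such machines. -/
theorem card_byzantineElements_le (hn : 2 ≤ n) (hk : 1 ≤ k) {Z : Finset (Fin k)}
    (hZ : (Z.card : ℝ) ≤ β * k) :
    ((byzantineElements (n := n) Z).card : ℝ) /
      Fintype.card (GaloisField 2 (wordLength n k)) ≤ 1 - 3 / 4 * (1 - β) := by
  classical
  set q := 2 ^ wordLength n k with hq
  have hk0 : (0 : ℝ) < k := by exact_mod_cast hk
  have h1 : (byzantineElements (n := n) Z).card + Zᶜ.card * (q / k) ≤ q := by
    have hdisj : Disjoint (byzantineElements (n := n) Z)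
        (Zᶜ.biUnion fun M => elementsOf (n := n) M) := by
      refine Finset.disjoint_left.2 fun y hy hy' => ?_
      simp only [byzantineElements, elementsOf, Finset.mem_filter, Finset.mem_univ, true_and,
        Finset.mem_biUnion, Finset.mem_compl] at hy hy'
      obtain ⟨M, hM, h⟩ := hy
      obtain ⟨M', hM', h'⟩ := hy'
      exact hM' ((Fin.ext (h.symm.trans h') : M = M') ▸ hM)
    have h2 : Zᶜ.card * (q / k) ≤ (Zᶜ.biUnion fun M => elementsOf (n := n) M).card := by
      rw [Finset.card_biUnion, ← smul_eq_mul]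
      · refine Finset.card_nsmul_le_sum _ _ _ fun M _ => ?_
        rw [elementsOf, card_fieldEquiv_filter fun x => x % k = M]
        exact (card_filter_mod_eq _ M).1
      · intro M _ M' _ hne
        refine Finset.disjoint_left.2 fun y hy hy' => hne ?_
        simp only [elementsOf, Finset.mem_filter, Finset.mem_univ, true_and] at hy hy'
        exact Fin.ext (hy.symm.trans hy')
    calc _ ≤ _ := Nat.add_le_add_left h2 _
      _ = _ := (Finset.card_union_of_disjoint hdisj).symm
      _ ≤ Fintype.card _ := Finset.card_le_univ _
      _ = q := card_field
  have h4 : (4 * k : ℝ) ≤ q := by exact_mod_cast mul_le_two_pow_wordLength (k := k) hn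
  have h5 : (Zᶜ.card : ℝ) = k - Z.card := by
    rw [Finset.card_compl, Fintype.card_fin, Nat.cast_sub]
    simpa using Finset.card_le_univ Z
  have h6 : (1 - β) * k ≤ Zᶜ.card := by rw [h5]; linarith
  have h7 : (3 / 4 : ℝ) * q ≤ ((q / k : ℕ) : ℝ) * k := by
    have h8 : (q : ℝ) < ((q / k : ℕ) : ℝ) * k + k := by
      exact_mod_cast Nat.lt_div_mul_add (a := q) hk
    linarith
  have h1' : ((byzantineElements (n := n) Z).card : ℝ) + Zᶜ.card * ((q / k : ℕ) : ℝ) ≤ q := by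
    exact_mod_cast h1
  have h9 : 3 / 4 * (1 - β) * q ≤ Zᶜ.card * ((q / k : ℕ) : ℝ) := by
    rcases le_or_gt (1 - β) 0 with hβ | hβ
    · have : 3 / 4 * (1 - β) * q ≤ 0 := by
        have : (0 : ℝ) ≤ q := by positivity
        nlinarith
      exact this.trans (by positivity)
    · calc 3 / 4 * (1 - β) * q = (1 - β) * (3 / 4 * q) := by ring
        _ ≤ (1 - β) * (((q / k : ℕ) : ℝ) * k) := by gcongr
        _ = (1 - β) * k * ((q / k : ℕ) : ℝ) := by ring
        _ ≤ _ := by gcongr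
  rw [card_field, ← hq, div_le_iff₀ (by linarith)]
  linarith

/-! ### The two bad events -/

theorem mem_electedCommittee {ω : Coins k} {v : Node n k} {M : Fin k} :
    M ∈ electedCommittee n k β ω v ↔ ∃ u : Fin (committeeSize n β),
      evalCoeffs (hashCoeffs n k β ω u) (nodeElement v) ∈ elementsOf M := by
  simp only [electedCommittee, committee, elementsOf, Finset.mem_filter, Finset.mem_univ, true_and]
  constructor
  · rintro ⟨u, hu, h⟩
    exact ⟨⟨u, hu⟩, (hash_eq ω ⟨u, hu⟩ v).symm.trans h⟩
  · rintro ⟨u, h⟩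
    exact ⟨u, u.2, (hash_eq ω u v).trans h⟩

/-- The node is fixed, so one evaluation point per hash function is needed, and the hash functions
are independent. -/
theorem coinMeasure_no_honest_le (hn : 2 ≤ n) (hk : 1 ≤ k) (hσ : 0 < committeeSize n β)
    (adv : StaticAdversary n k β) (v : Node n k) :
    coinMeasure k {ω | ∀ M ∈ electedCommittee n k β ω v, M ∈ adv.byzantine} ≤
      ENNReal.ofReal ((1 - 3 / 4 * (1 - β)) ^ committeeSize n β) := by
  classical
  set G : Finset (Fin (committeeSize n β) → GaloisField 2 (wordLength n k)) :=
    Finset.univ.filter fun p => evalCoeffs p (nodeElement v) ∈ byzantineElements adv.byzantine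
    with hG
  have hsub : {ω : Coins k | ∀ M ∈ electedCommittee n k β ω v, M ∈ adv.byzantine} ⊆
      {ω | ∀ u, hashCoeffs n k β ω u ∈ G} := by
    intro ω hω u
    simp only [hG, byzantineElements, Finset.mem_filter, Finset.mem_univ, true_and]
    set y := evalCoeffs (hashCoeffs n k β ω u) (nodeElement v)
    exact ⟨⟨(fieldEquiv n k y : ℕ) % k, Nat.mod_lt _ hk⟩,
      hω _ (mem_electedCommittee.2 ⟨u, by simp [elementsOf, y]⟩), rfl⟩
  refine (measure_mono hsub).trans ((coinMeasure_forall_hashCoeffs_mem_le fun _ => G).trans ?_)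
  refine ENNReal.ofReal_le_ofReal ?_
  rw [Finset.prod_const, Finset.card_univ, Fintype.card_fin]
  have hd := density_evalCoeffs (ι := Unit) (x := fun _ => nodeElement v)
    (fun _ _ _ => rfl) (by rw [Fintype.card_unit]; exact hσ) hσ (byzantineElements adv.byzantine) G
    (fun p => by simp [hG])
  rw [hd]
  simp only [Fintype.card_unit, pow_one]
  exact pow_le_pow_left₀ (by positivity)
    (card_byzantineElements_le hn hk adv.card_byzantine_le) _

/-- Only function `u` is constrained, the others contribute the factor 1; its values at the σ nodes
of `S` are independent because its degree is less than σ. -/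
theorem coinMeasure_collision_le (hn : 2 ≤ n) (hσ : 0 < committeeSize n β)
    (u : Fin (committeeSize n β)) (M : Fin k) (S : Finset (Node n k))
    (hS : S.card = committeeSize n β) :
    coinMeasure k {ω | ∀ v ∈ S,
        evalCoeffs (hashCoeffs n k β ω u) (nodeElement v) ∈ elementsOf M} ≤
      ENNReal.ofReal ((2 / k : ℝ) ^ committeeSize n β) := by
  classical
  set G : Finset (Fin (committeeSize n β) → GaloisField 2 (wordLength n k)) :=
    Finset.univ.filter fun p => ∀ v ∈ S, evalCoeffs p (nodeElement v) ∈ elementsOf M with hG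
  have hsub : {ω : Coins k | ∀ v ∈ S,
        evalCoeffs (hashCoeffs n k β ω u) (nodeElement v) ∈ elementsOf M} ⊆
      {ω | ∀ u', hashCoeffs n k β ω u' ∈ if u' = u then G else Finset.univ} := by
    intro ω hω u'
    split_ifs with h
    · subst h
      exact Finset.mem_filter.2 ⟨Finset.mem_univ _, hω⟩
    · exact Finset.mem_univ _
  refine (measure_mono hsub).trans ((coinMeasure_forall_hashCoeffs_mem_le _).trans ?_)
  refine ENNReal.ofReal_le_ofReal ?_
  have hq : (Fintype.card (GaloisField 2 (wordLength n k)) : ℝ) ≠ 0 := by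
    exact_mod_cast Fintype.card_ne_zero
  rw [Finset.prod_eq_single u]
  · rw [if_pos rfl]
    have hd := density_evalCoeffs (ι := S) (x := fun v => nodeElement v.1)
      (fun v w h => Subtype.ext (nodeElement_injective hn h)) (by simp [hS]) hσ (elementsOf M) G
      (fun p => by simp [hG])
    rw [hd, Fintype.card_coe, hS]
    exact pow_le_pow_left₀ (by positivity) (card_elementsOf_le hn M) _
  · intro u' _ hne
    rw [if_neg hne, Finset.card_univ, Fintype.card_fun, Fintype.card_fin]
    push_cast
    exact div_self (pow_ne_zero _ hq)
  · intro h; exact absurd (Finset.mem_univ _) h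

/-- Pigeonhole: if each of the σ hash functions sent fewer than σ nodes to `M`, at most σ² nodes
could have `M` in their committee. -/
theorem exists_collision {ω : Coins k} {M : Fin k}
    (h : committeeSize n β * committeeSize n β <
      (Finset.univ.filter fun v : Node n k => M ∈ electedCommittee n k β ω v).card) :
    ∃ u : Fin (committeeSize n β), ∃ S : Finset (Node n k), S.card = committeeSize n β ∧
      ∀ v ∈ S, evalCoeffs (hashCoeffs n k β ω u) (nodeElement v) ∈ elementsOf M := by
  classical
  by_contra hc
  push Not at hc
  have hsub : (Finset.univ.filter fun v : Node n k => M ∈ electedCommittee n k β ω v) ⊆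
      (Finset.univ : Finset (Fin (committeeSize n β))).biUnion fun u =>
        Finset.univ.filter fun v : Node n k =>
          evalCoeffs (hashCoeffs n k β ω u) (nodeElement v) ∈ elementsOf M := by
    intro v hv
    obtain ⟨u, hu⟩ := mem_electedCommittee.1 (Finset.mem_filter.1 hv).2
    exact Finset.mem_biUnion.2 ⟨u, Finset.mem_univ _, Finset.mem_filter.2 ⟨Finset.mem_univ _, hu⟩⟩
  have hle := (Finset.card_le_card hsub).trans (Finset.card_biUnion_le_card_mul _ _
    (committeeSize n β) fun u _ => ?_)
  · rw [Finset.card_univ, Fintype.card_fin] at hle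
    omega
  · by_contra hlt
    obtain ⟨S, hS, hcard⟩ := Finset.exists_subset_card_eq (not_le.1 hlt).le
    obtain ⟨v, hv, hv'⟩ := hc u S hcard
    exact hv' (Finset.mem_filter.1 (hS hv)).2

/-- Every committee has an honest member, and no machine is in too many committees. -/
def GoodElection (adv : StaticAdversary n k β) (ω : Coins k) : Prop :=
  (∀ v, ∃ M ∈ electedCommittee n k β ω v, M ∉ adv.byzantine) ∧
  ∀ M, (Finset.univ.filter fun v : Node n k => M ∈ electedCommittee n k β ω v).card ≤
    committeeSize n β * committeeSize n β

theorem card_node : Fintype.card (Node n k) = numNodes n k := by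
  simp [numNodes]

theorem measure_biUnion_le_ofReal {α ι : Type*} [MeasurableSpace α] (μ : Measure α)
    (s : Finset ι) (f : ι → Set α) {p : ℝ} (hf : ∀ i ∈ s, μ (f i) ≤ ENNReal.ofReal p) :
    μ (⋃ i ∈ s, f i) ≤ ENNReal.ofReal (s.card * p) := by
  refine (measure_biUnion_finset_le _ _).trans ((Finset.sum_le_card_nsmul _ _ _ hf).trans ?_)
  rw [nsmul_eq_mul, ENNReal.ofReal_mul (by positivity), ENNReal.ofReal_natCast]

/-- A union bound over the nodes and over the triples of a hash function, a machine and a set of σ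
nodes. It is essential that the Byzantine set is fixed before the coins are tossed. -/
theorem coinMeasure_not_goodElection_le (hn : 2 ≤ n) (hk : 1 ≤ k) (hβ : 0 ≤ β)
    (hσ : 0 < committeeSize n β) (adv : StaticAdversary n k β) :
    coinMeasure k {ω | ¬ GoodElection adv ω} ≤
      ENNReal.ofReal (numNodes n k * (1 - 3 / 4 * (1 - β)) ^ committeeSize n β +
        committeeSize n β * k * (numNodes n k).choose (committeeSize n β) *
          (2 / k : ℝ) ^ committeeSize n β) := by
  classical
  have hsub : {ω | ¬ GoodElection adv ω} ⊆
      (⋃ v ∈ (Finset.univ : Finset (Node n k)),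
        {ω | ∀ M ∈ electedCommittee n k β ω v, M ∈ adv.byzantine}) ∪
      ⋃ x ∈ (Finset.univ : Finset (Fin (committeeSize n β))) ×ˢ (Finset.univ : Finset (Fin k)) ×ˢ
          Finset.powersetCard (committeeSize n β) (Finset.univ : Finset (Node n k)),
        {ω : Coins k | ∀ v ∈ x.2.2,
          evalCoeffs (hashCoeffs n k β ω x.1) (nodeElement v) ∈ elementsOf x.2.1} := by
    intro ω hω
    rw [Set.mem_ofPred_eq, GoodElection, not_and_or] at hω
    rcases hω with h | h
    · left
      push Not at h
      obtain ⟨v, hv⟩ := h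
      simp only [Set.mem_iUnion]
      exact ⟨v, Finset.mem_univ _, hv⟩
    · right
      push Not at h
      obtain ⟨M, hM⟩ := h
      obtain ⟨u, S, hS, hv⟩ := exists_collision hM
      simp only [Set.mem_iUnion]
      exact ⟨(u, M, S), by simp [hS], hv⟩
  have hb : 0 ≤ 1 - 3 / 4 * (1 - β) := by linarith
  refine (measure_mono hsub).trans ((measure_union_le _ _).trans ?_)
  rw [ENNReal.ofReal_add (by positivity) (by positivity)]
  refine add_le_add ?_ ?_
  · refine (measure_biUnion_le_ofReal _ _ _ fun v _ =>
      coinMeasure_no_honest_le hn hk hσ adv v).trans (le_of_eq ?_)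
    rw [Finset.card_univ, card_node]
  · refine (measure_biUnion_le_ofReal _ _ _ fun x hx =>
      coinMeasure_collision_le hn hσ x.1 x.2.1 x.2.2 ?_).trans (le_of_eq ?_)
    · simp only [Finset.mem_product, Finset.mem_powersetCard] at hx
      exact hx.2.2.2
    · simp only [Finset.card_product, Finset.card_powersetCard, Finset.card_univ, card_node,
        Fintype.card_fin]
      push_cast
      congr 1
      ring_nf

end Hash

section Bounds

variable {n k : ℕ} {β : ℝ}

/-! ## Costs in terms of the size of the committees -/

theorem card_electedCommittee_le (ω : Coins k) (v : Node n k) :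
    (electedCommittee n k β ω v).card ≤ committeeSize n β := by
  classical
  have hsub : (electedCommittee n k β ω v).map Fin.valEmbedding ⊆
      (Finset.range (committeeSize n β)).image
        fun u => hash n k β (fun s => ω (Sum.inl s)) u v := by
    intro x hx
    obtain ⟨M, hM, rfl⟩ := Finset.mem_map.1 hx
    obtain ⟨u, hu, h⟩ := (Finset.mem_filter.1 hM).2
    exact Finset.mem_image.2 ⟨u, Finset.mem_range.2 hu, h⟩
  have := (Finset.card_le_card hsub).trans Finset.card_image_le
  rwa [Finset.card_map, Finset.card_range] at this

theorem card_children_le (u : Node n k) :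
    (Finset.univ.filter fun v : Node n k => parent n k v = some u).card ≤ arity n k := by
  rw [← Nat.add_sub_cancel_left (n := arity n k * u.2 + 1) (m := arity n k), ← Nat.card_Ico]
  refine Finset.card_le_card_of_injOn (fun v => (v.2 : ℕ)) ?_ ?_
  · intro v hv
    obtain ⟨h1, -, h3⟩ := parent_eq_some_iff.1 (Finset.mem_filter.1 hv).2
    have h4 := child_parentIndex (n := n) (k := k) h1
    have h5 := Nat.mod_lt ((v.2 : ℕ) - 1) (show 0 < arity n k by unfold arity; omega)
    simp only [Finset.coe_Ico, Set.mem_Ico]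
    rw [h3]
    omega
  · intro v hv w hw h
    obtain ⟨-, h2, -⟩ := parent_eq_some_iff.1 (Finset.mem_filter.1 hv).2
    obtain ⟨-, h2', -⟩ := parent_eq_some_iff.1 (Finset.mem_filter.1 hw).2
    exact Prod.ext (h2.symm.trans h2') (Fin.ext h)

theorem card_roots_le :
    (Finset.univ.filter fun v : Node n k => parent n k v = none).card ≤ numTrees n k := by
  refine (Finset.card_le_card_of_injOn (t := Finset.univ) (fun v => v.1)
    (fun _ _ => Finset.mem_coe.2 (Finset.mem_univ _)) ?_).trans (Finset.card_fin _).le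
  intro v hv w hw h
  have h1 := parent_eq_none_iff.1 (Finset.mem_filter.1 hv).2
  have h2 := parent_eq_none_iff.1 (Finset.mem_filter.1 hw).2
  exact Prod.ext h (Fin.ext (h1.trans h2.symm))

/-- A machine learns from the roots and from the children of the nodes to whose committees it
belongs. -/
theorem card_received_le (com : Node n k → Finset (Fin k)) (M : Fin k) :
    (Finset.univ.filter fun v : Node n k => M ∈ recipients com v).card ≤
      numTrees n k + (Finset.univ.filter fun v : Node n k => M ∈ com v).card * arity n k := by
  classical
  have hsub : (Finset.univ.filter fun v : Node n k => M ∈ recipients com v) ⊆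
      (Finset.univ.filter fun v : Node n k => parent n k v = none) ∪
      (Finset.univ.filter fun v : Node n k => M ∈ com v).biUnion fun u =>
        Finset.univ.filter fun v : Node n k => parent n k v = some u := by
    intro v hv
    have hv := (Finset.mem_filter.1 hv).2
    unfold recipients at hv
    cases hp : parent n k v with
    | none => simp [hp]
    | some u =>
      rw [hp] at hv
      refine Finset.mem_union_right _ (Finset.mem_biUnion.2 ⟨u, ?_, ?_⟩)
      · simpa using hv
      · simpa using hp
  refine (Finset.card_le_card hsub).trans ((Finset.card_union_le _ _).trans ?_)
  exact Nat.add_le_add card_roots_le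
    (Finset.card_biUnion_le_card_mul _ _ _ fun u _ => card_children_le u)

theorem card_leafIndicesOf_le (hk : 1 ≤ k) (hkn : k ≤ n) (com : Node n k → Finset (Fin k))
    (M : Fin k) : (leafIndicesOf com M).card ≤
      (Finset.univ.filter fun v : Node n k => M ∈ com v).card * blockBound n k := by
  classical
  have hsub : leafIndicesOf com M ⊆ (Finset.univ.filter fun v : Node n k =>
      M ∈ com v).biUnion fun v => if IsLeaf n k v then assigned n k v.1 v.2 else ∅ := by
    intro j hj
    obtain ⟨v, hv, hM, hjv⟩ := (Finset.mem_filter.1 hj).2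
    refine Finset.mem_biUnion.2 ⟨v, by simpa using hM, ?_⟩
    rw [if_pos hv]
    exact mem_indexList.1 hjv
  refine (Finset.card_le_card hsub).trans (Finset.card_biUnion_le_card_mul _ _ _ fun v _ => ?_)
  split_ifs with hv
  · rw [assigned_leaf _ hv]
    exact card_block_le hk hkn _
  · simp

theorem maxDuties_le (com : Node n k → Finset (Fin k)) {c : ℕ}
    (hc : ∀ M, (Finset.univ.filter fun v : Node n k => M ∈ com v).card ≤ c) (i : ℕ) :
    maxDuties com i ≤ c := by
  classical
  refine Finset.sup_le fun M _ => le_trans ?_ (hc M)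
  rw [← List.toFinset_card_of_nodup (nodup_duties com i M)]
  refine Finset.card_le_card fun v hv => ?_
  have := ((mem_duties com).1 (List.mem_toFinset.1 hv)).2
  simpa using this

theorem length_program_le (hk : 1 ≤ k) (hkn : k ≤ n) (com : Node n k → Finset (Fin k)) {c : ℕ}
    (hc : ∀ M, (Finset.univ.filter fun v : Node n k => M ∈ com v).card ≤ c) :
    (program com).length ≤ 1 + (c + 1) * (3 * (blockBound n k * treeLeaves n k)) := by
  rw [length_program, phaseStart]
  refine Nat.add_le_add_left ?_ _
  refine le_trans ?_ (Nat.mul_le_mul_left (c + 1) (sum_width_le hk hkn))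
  rw [Finset.mul_sum]
  refine Finset.sum_le_sum fun e _ => ?_
  rw [add_mul, one_mul]
  exact Nat.add_le_add_right (Nat.mul_le_mul_right _ (maxDuties_le com hc _)) _

/-! ## Estimates of the parameters -/

theorem one_le_logb (hn : 2 ≤ n) : 1 ≤ Real.logb 2 n := by
  rw [Real.le_logb_iff_rpow_le (by norm_num) (by positivity), Real.rpow_one]
  exact_mod_cast hn

/-- Rounding up adds at most 1 ≤ log n / γ, which turns 9 into 10. -/
theorem committeeSize_le (hn : 2 ≤ n) (hβ0 : 0 ≤ β) (hβ : β < 1) :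
    (committeeSize n β : ℝ) ≤ 10 * Real.logb 2 n / (1 - β) := by
  have hL := one_le_logb hn
  have hγ : 0 < 1 - β := by linarith
  have h1 : (committeeSize n β : ℝ) < 9 * Real.logb 2 n / (1 - β) + 1 :=
    Nat.ceil_lt_add_one (by positivity)
  have h2 : 1 ≤ Real.logb 2 n / (1 - β) := by
    rw [le_div_iff₀ hγ]; linarith
  have h3 : 10 * Real.logb 2 n / (1 - β) =
      9 * Real.logb 2 n / (1 - β) + Real.logb 2 n / (1 - β) := by ring
  linarith

theorem le_committeeSize : 9 * Real.logb 2 n / (1 - β) ≤ committeeSize n β :=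
  Nat.le_ceil _

theorem logb_le_committeeSize (hn : 2 ≤ n) (hβ0 : 0 ≤ β) (hβ : β < 1) :
    9 * Real.logb 2 n ≤ committeeSize n β := by
  have hL := one_le_logb hn
  refine le_trans ?_ le_committeeSize
  rw [le_div_iff₀ (by linarith)]
  nlinarith

/-- From n max(ν, k) ≤ 8n² the length is at most 2 ⌈log n⌉ + 4 ≤ 2 log n + 6. -/
theorem wordLength_le (hn : 2 ≤ n) (hk : 1 ≤ k) (hkn : k ≤ n) :
    (wordLength n k : ℝ) ≤ 8 * Real.logb 2 n := by
  have hL := one_le_logb hn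
  have h1 : n * max (numNodes n k) k ≤ 8 * n ^ 2 := by
    have : max (numNodes n k) k ≤ 8 * n := by
      have := numNodes_le hk hkn
      exact max_le (by omega) (by omega)
    nlinarith
  have h2 : Nat.clog 2 (n * max (numNodes n k) k) ≤ 3 + 2 * Nat.clog 2 n := by
    refine Nat.clog_le_of_le_pow (h1.trans ?_)
    have := Nat.le_pow_clog (show 1 < 2 by norm_num) n
    calc 8 * n ^ 2 ≤ 8 * (2 ^ Nat.clog 2 n) ^ 2 := by gcongr
      _ = _ := by rw [pow_add, ← pow_mul, mul_comm 2]; norm_num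
  have h3 : (Nat.clog 2 n : ℝ) < Real.logb 2 n + 1 := by
    rw [← Real.natCeil_logb_natCast]
    exact Nat.ceil_lt_add_one (by push_cast; linarith)
  have h4 : (wordLength n k : ℝ) ≤ 3 + 2 * Nat.clog 2 n + 1 := by
    unfold wordLength; exact_mod_cast Nat.add_le_add_right h2 1
  linarith

theorem ceilDiv_le_two_mul_div (hk : 1 ≤ k) (hkn : k ≤ n) :
    ((n ⌈/⌉ k : ℕ) : ℝ) ≤ 2 * (n / k : ℝ) := by
  have hk0 : (0 : ℝ) < k := by exact_mod_cast hk
  have h := mul_ceilDiv_lt n (show 0 < k by omega)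
  have h' : (k : ℝ) * ((n ⌈/⌉ k : ℕ) : ℝ) ≤ 2 * n := by
    exact_mod_cast (show k * (n ⌈/⌉ k) ≤ 2 * n by omega)
  rw [← mul_div_assoc, le_div_iff₀ hk0]
  linarith

theorem blockBound_le (hk : 1 ≤ k) (hkn : k ≤ n) :
    (blockBound n k : ℝ) ≤ 2 * (n / k : ℝ) := by
  have hk0 : (0 : ℝ) < k := by exact_mod_cast hk
  have h1 : blockBound n k ≤ n / k + 1 :=
    Nat.add_le_add_right (Nat.div_le_div_left (le_numLeaves hk hkn) hk) 1
  have h2 : ((n / k : ℕ) : ℝ) ≤ n / k := Nat.cast_div_le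
  have h3 : (1 : ℝ) ≤ n / k := by
    rw [le_div_iff₀ hk0, one_mul]; exact_mod_cast hkn
  have h4 : (blockBound n k : ℝ) ≤ (n / k : ℕ) + 1 := by exact_mod_cast h1
  linarith

/-- Up to one index per leaf, this is the share n / `numTrees` of a tree. The share is at most k if
there are ⌈n/k⌉ trees, and n/k if there are k. -/
theorem blockBound_mul_treeLeaves_le (hk : 1 ≤ k) (hkn : k ≤ n) :
    ((blockBound n k * treeLeaves n k : ℕ) : ℝ) ≤ 2 * ((n / k : ℝ) + k) := by
  have hk0 : (0 : ℝ) < k := by exact_mod_cast hk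
  have hl := treeLeaves_pos hk hkn
  have ht := numTrees_pos hk hkn
  have h1 : blockBound n k * treeLeaves n k ≤ n / numTrees n k + treeLeaves n k := by
    unfold blockBound
    rw [add_mul, one_mul, ← Nat.div_div_eq_div_mul]
    exact Nat.add_le_add_right (Nat.div_mul_le_self _ _) _
  have h2 : ((n / numTrees n k : ℕ) : ℝ) ≤ n / k + k := by
    refine Nat.cast_div_le.trans ?_
    unfold numTrees
    rcases min_choice (n ⌈/⌉ k) k with h | h <;> rw [h]
    · have hD : 0 < n ⌈/⌉ k := ceilDiv_pos_of_pos (by omega) (by omega)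
      have h3 : (n : ℝ) ≤ k * (n ⌈/⌉ k : ℕ) := by
        exact_mod_cast le_mul_ceilDiv n (show 0 < k by omega)
      have h4 : (n : ℝ) / (n ⌈/⌉ k : ℕ) ≤ k := by
        rw [div_le_iff₀ (by exact_mod_cast hD)]; exact h3
      have : (0 : ℝ) ≤ n / k := by positivity
      linarith
    · linarith
  have h3 : (treeLeaves n k : ℝ) ≤ k := by exact_mod_cast treeLeaves_le hk hkn
  have h4 : ((blockBound n k * treeLeaves n k : ℕ) : ℝ) ≤
      (n / numTrees n k : ℕ) + treeLeaves n k := by exact_mod_cast h1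
  have : (0 : ℝ) ≤ n / k := by positivity
  linarith

theorem forestHeight_sub_one_le (hk : 1 ≤ k) (hkn : k ≤ n) :
    ((forestHeight n k - 1 : ℕ) : ℝ) ≤ 2 * Real.logb 2 k := by
  have hk1 : (1 : ℝ) ≤ k := by exact_mod_cast hk
  have hlog : 0 ≤ Real.logb 2 k := Real.logb_nonneg (by norm_num) hk1
  rcases Nat.lt_or_ge (forestHeight n k) 2 with h | h
  · rw [show forestHeight n k - 1 = 0 by omega]
    simpa using hlog
  · have h1 := pow_forestHeight_sub_two_lt hk hkn h
    have h2 := treeLeaves_le hk hkn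
    have h3 : 2 ^ (forestHeight n k - 2) ≤ arity n k ^ (forestHeight n k - 2) :=
      Nat.pow_le_pow_left (two_le_arity hk hkn) _
    have h4 : 0 < 2 ^ (forestHeight n k - 2) := by positivity
    -- A forest of height at least 2 has more than one leaf per tree; then log k ≥ 1 pays for the
    -- extra level.
    have hk2 : 2 ≤ k := by omega
    have h5 := one_le_logb hk2
    have h6 : ((forestHeight n k - 2 : ℕ) : ℝ) ≤ Real.logb 2 k := by
      rw [Real.le_logb_iff_rpow_le (by norm_num) (by positivity), Real.rpow_natCast]
      exact_mod_cast (by omega : 2 ^ (forestHeight n k - 2) ≤ k)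
    have h7 : ((forestHeight n k - 1 : ℕ) : ℝ) = (forestHeight n k - 2 : ℕ) + 1 := by
      exact_mod_cast (by omega : forestHeight n k - 1 = forestHeight n k - 2 + 1)
    linarith

/-! ## The failure probability -/

theorem rpow_neg_logb_le (hn : 2 ≤ n) {s : ℕ} (hs : 2 * Real.logb 2 n ≤ s) :
    ((2 : ℝ) ^ s)⁻¹ ≤ ((n : ℝ) ^ 2)⁻¹ := by
  have hn0 : (0 : ℝ) < n := by positivity
  refine inv_anti₀ (by positivity) ?_
  rw [← Real.rpow_natCast 2 s]
  calc (n : ℝ) ^ 2 = ((2 : ℝ) ^ Real.logb 2 n) ^ 2 := by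
        rw [Real.rpow_logb (by norm_num) (by norm_num) hn0]
    _ = (2 : ℝ) ^ (Real.logb 2 n * 2) := by
        rw [Real.rpow_mul (by norm_num)]; norm_num
    _ ≤ _ := Real.rpow_le_rpow_of_exponent_le (by norm_num) (by linarith)

/-- As γσ ≥ 9 log n, the exponent (3/4) γσ is more than 2 ln n; the factor n⁻² beats the at most 8n
nodes. -/
theorem failure_no_honest_le (hn : 2 ≤ n) (hk : 1 ≤ k) (hkn : k ≤ n) (hβ0 : 0 ≤ β) (hβ : β < 1) :
    numNodes n k * (1 - 3 / 4 * (1 - β)) ^ committeeSize n β ≤ 8 / n := by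
  have hL := one_le_logb hn
  have hn0 : (0 : ℝ) < n := by positivity
  have h1 : (numNodes n k : ℝ) ≤ 8 * n := by
    have := numNodes_le hk hkn
    exact_mod_cast (by omega : numNodes n k ≤ 8 * n)
  have h2 : (1 - 3 / 4 * (1 - β)) ^ committeeSize n β ≤ ((n : ℝ) ^ 2)⁻¹ := by
    calc (1 - 3 / 4 * (1 - β)) ^ committeeSize n β
        ≤ Real.exp (-(3 / 4 * (1 - β))) ^ committeeSize n β :=
          pow_le_pow_left₀ (by linarith) (Real.one_sub_le_exp_neg _) _
      _ = Real.exp (-(3 / 4 * ((1 - β) * committeeSize n β))) := by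
          rw [← Real.exp_nat_mul]; congr 1; ring
      _ ≤ Real.exp (-(2 * Real.log n)) := by
          refine Real.exp_le_exp.2 (neg_le_neg ?_)
          have h3 : 9 * Real.logb 2 n ≤ (1 - β) * committeeSize n β := by
            have := le_committeeSize (n := n) (β := β)
            rw [div_le_iff₀ (by linarith)] at this
            linarith
          have h4 : Real.log n ≤ Real.logb 2 n := by
            rw [Real.logb, le_div_iff₀ (Real.log_pos (by norm_num))]
            have := Real.log_two_lt_d9
            have : 0 ≤ Real.log n := Real.log_natCast_nonneg n
            nlinarith
          linarith
      _ = ((n : ℝ) ^ 2)⁻¹ := by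
          rw [Real.exp_neg, two_mul, Real.exp_add, Real.exp_log hn0, pow_two]
  calc numNodes n k * (1 - 3 / 4 * (1 - β)) ^ committeeSize n β
      ≤ 8 * n * ((n : ℝ) ^ 2)⁻¹ := by gcongr; exact pow_nonneg (by linarith) _
    _ = 8 / n := by field_simp

/-- The binomial coefficient and the collision probability combine to 16^s / s!. Bounding s by 2^s
and splitting off another 2^s, which is at least n², leaves 64^s / s! ≤ e^64. -/
theorem failure_collision_le (hn : 2 ≤ n) (hk : 1 ≤ k) (hkn : k ≤ n) (hβ0 : 0 ≤ β) (hβ : β < 1) :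
    committeeSize n β * k * (numNodes n k).choose (committeeSize n β) *
      (2 / k : ℝ) ^ committeeSize n β ≤ Real.exp 64 / n := by
  have hL := one_le_logb hn
  have hn0 : (0 : ℝ) < n := by positivity
  have hk0 : (0 : ℝ) < k := by exact_mod_cast hk
  have hs := logb_le_committeeSize hn hβ0 hβ
  set s := committeeSize n β
  have h1 : (numNodes n k : ℝ) ≤ 8 * k := by exact_mod_cast numNodes_le hk hkn
  have h2 : ((numNodes n k).choose s : ℝ) ≤ (8 * k : ℝ) ^ s / s.factorial :=
    (Nat.choose_le_pow_div s _).trans (by gcongr)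
  have h3 : (s : ℝ) ≤ 2 ^ s := by exact_mod_cast (Nat.lt_two_pow_self).le
  have h4 : (k : ℝ) ≤ n := by exact_mod_cast hkn
  have h5 := Real.pow_div_factorial_le_exp 64 (by norm_num) s
  calc s * k * (numNodes n k).choose s * (2 / k : ℝ) ^ s
      ≤ 2 ^ s * n * ((8 * k : ℝ) ^ s / s.factorial) * (2 / k : ℝ) ^ s := by gcongr
    _ = n * (64 ^ s / s.factorial) * ((2 : ℝ) ^ s)⁻¹ := by
        have e1 : (8 * k : ℝ) ^ s * (2 / k : ℝ) ^ s = 16 ^ s := by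
          rw [← mul_pow]; congr 1; field_simp; norm_num
        have e2 : (64 : ℝ) ^ s = 2 ^ s * 16 ^ s * 2 ^ s := by
          rw [← mul_pow, ← mul_pow]; norm_num
        rw [e2, ← e1]
        field_simp
    _ ≤ n * Real.exp 64 * ((n : ℝ) ^ 2)⁻¹ := by
        gcongr ?_ * ?_
        · gcongr
        · exact rpow_neg_logb_le hn (by linarith)
    _ = Real.exp 64 / n := by field_simp

/-! ## The costs of an execution with a good election -/

variable {adv : StaticAdversary n k β} {ω : Coins k}

theorem queryCount_le_of_goodElection (hn : 2 ≤ n) (hk : 1 ≤ k) (hkn : k ≤ n) (hβ0 : 0 ≤ β)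
    (hβ : β < 1) (h : GoodElection adv ω) (t : ℕ) (M : Fin k) :
    (queryCount (parallelDownload n k β) adv ω t M : ℝ) ≤
      15000 * (n * Real.logb 2 n ^ 3 / ((1 - β) ^ 3 * k)) := by
  have hL := one_le_logb hn
  have hγ : 0 < 1 - β := by linarith
  have hk0 : (0 : ℝ) < k := by exact_mod_cast hk
  have hσ := committeeSize_le hn hβ0 hβ
  have hm := wordLength_le hn hk hkn
  have hb := blockBound_le hk hkn
  have hD := ceilDiv_le_two_mul_div hk hkn
  set σ := committeeSize n β
  have hτ : (numTrees n k : ℝ) ≤ 2 * (n / k : ℝ) :=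
    le_trans (by exact_mod_cast min_le_left _ _) hD
  have hx : (1 : ℝ) ≤ n / k := by
    rw [le_div_iff₀ hk0, one_mul]; exact_mod_cast hkn
  have hA : (arity n k : ℝ) ≤ 3 * (n / k : ℝ) := by
    unfold arity; push_cast; linarith
  have h1 : queryCount (parallelDownload n k β) adv ω t M ≤
      σ * σ * wordLength n k + σ * σ * blockBound n k +
        (numTrees n k + σ * σ * arity n k) * σ := by
    refine (queryCount_le adv ω (by omega) t M).trans (Nat.add_le_add (Nat.add_le_add le_rfl ?_) ?_)
    · exact (card_leafIndicesOf_le hk hkn _ M).trans (Nat.mul_le_mul_right _ (h.2 M))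
    · refine (Finset.sum_le_card_nsmul _ _ σ fun v _ => card_electedCommittee_le ω v).trans ?_
      rw [smul_eq_mul]
      refine Nat.mul_le_mul_right _ ((card_received_le _ M).trans ?_)
      exact Nat.add_le_add_left (Nat.mul_le_mul_right _ (h.2 M)) _
  have h1' : (queryCount (parallelDownload n k β) adv ω t M : ℝ) ≤
      σ * σ * wordLength n k + σ * σ * blockBound n k +
        (numTrees n k + σ * σ * arity n k) * σ := by exact_mod_cast h1
  set s := 10 * Real.logb 2 n / (1 - β) with hs
  set x := (n / k : ℝ) with hxdef
  have hLs : Real.logb 2 n ≤ s := by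
    rw [hs, le_div_iff₀ hγ]; nlinarith
  have hs1 : 1 ≤ s := hL.trans hLs
  have hs3 : s ≤ s ^ 3 := le_self_pow₀ hs1 (by norm_num)
  have hs23 : s ^ 2 ≤ s ^ 3 := pow_le_pow_right₀ hs1 (by norm_num)
  calc (queryCount (parallelDownload n k β) adv ω t M : ℝ)
      ≤ σ * σ * wordLength n k + σ * σ * blockBound n k +
        (numTrees n k + σ * σ * arity n k) * σ := h1'
    _ ≤ s * s * (8 * s) + s * s * (2 * x) + (2 * x + s * s * (3 * x)) * s := by
        gcongr
        linarith
    _ = 8 * s ^ 3 + 2 * s ^ 2 * x + 2 * s * x + 3 * s ^ 3 * x := by ring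
    _ ≤ 8 * (s ^ 3 * x) + 2 * s ^ 3 * x + 2 * s ^ 3 * x + 3 * s ^ 3 * x := by
        -- The random bits cost s³ without the factor n/k, which is at least 1.
        have : s ^ 3 ≤ s ^ 3 * x := le_mul_of_one_le_right (by positivity) hx
        gcongr
    _ = 15 * (s ^ 3 * x) := by ring
    -- The constant is 15 · 10³, with 10 from the bound on the committee size.
    _ = 15000 * (n * Real.logb 2 n ^ 3 / ((1 - β) ^ 3 * k)) := by
        rw [hs, hxdef]; field_simp; ring

theorem rounds_le_of_goodElection (hn : 2 ≤ n) (hk : 1 ≤ k) (hkn : k ≤ n) (hβ0 : 0 ≤ β)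
    (hβ : β < 1) (h : GoodElection adv ω) :
    ((electionRounds n k β + (program (electedCommittee n k β ω)).length : ℕ) : ℝ) ≤
      2200 * (((n : ℝ) / k + k) * (Real.logb 2 n ^ 2 / (1 - β) ^ 2)) := by
  have hL := one_le_logb hn
  have hγ : 0 < 1 - β := by linarith
  have hk1 : (1 : ℝ) ≤ k := by exact_mod_cast hk
  have hn0 : (0 : ℝ) < n := by positivity
  have hσ := committeeSize_le hn hβ0 hβ
  have hm := wordLength_le hn hk hkn
  have hbl := blockBound_mul_treeLeaves_le hk hkn
  have hlen := length_program_le hk hkn (electedCommittee n k β ω) h.2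
  set σ := committeeSize n β with hσdef
  set y := (n : ℝ) / k + k with hy
  have hy1 : 1 ≤ y := by
    have : (0 : ℝ) ≤ n / k := by positivity
    linarith
  set s := 10 * Real.logb 2 n / (1 - β) with hs
  have hLs : Real.logb 2 n ≤ s := by
    rw [hs, le_div_iff₀ hγ]; nlinarith
  have hs1 : 1 ≤ s := hL.trans hLs
  have hss : 1 ≤ s ^ 2 := one_le_pow₀ hs1
  have hssy : 1 ≤ s ^ 2 * y := by nlinarith
  -- The word length is at most 8n, so fetching n bits per round absorbs it and only O(s²) election
  -- rounds remain.
  have hLn : Real.logb 2 n ≤ n := by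
    rw [Real.logb_le_iff_le_rpow (by norm_num) hn0, Real.rpow_natCast]
    exact_mod_cast (Nat.lt_two_pow_self).le
  have hE : (electionRounds n k β : ℝ) ≤ 9 * (s ^ 2 * y) := by
    have h1 := mul_ceilDiv_lt (numRandomBits n k β) (show 0 < n by omega)
    have h2 : (n : ℝ) * electionRounds n k β ≤ σ * σ * wordLength n k + n := by
      exact_mod_cast h1.le
    have h3 : (n : ℝ) * electionRounds n k β ≤ n * (8 * s ^ 2 + 1) := by
      calc (n : ℝ) * electionRounds n k β ≤ σ * σ * wordLength n k + n := h2
        _ ≤ s * s * (8 * n) + n := by gcongr; linarith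
        _ = _ := by ring
    have h4 := le_of_mul_le_mul_left h3 hn0
    nlinarith
  have hP : ((program (electedCommittee n k β ω)).length : ℝ) ≤ 13 * (s ^ 2 * y) := by
    have h1 : ((program (electedCommittee n k β ω)).length : ℝ) ≤
        1 + (σ * σ + 1) * (3 * (blockBound n k * treeLeaves n k : ℕ)) := by exact_mod_cast hlen
    calc _ ≤ _ := h1
      _ ≤ 1 + (s * s + s ^ 2) * (3 * (2 * y)) := by gcongr
      _ = 1 + 12 * (s ^ 2 * y) := by ring
      _ ≤ _ := by linarith
  push_cast
  calc _ ≤ 9 * (s ^ 2 * y) + 13 * (s ^ 2 * y) := add_le_add hE hP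
    -- The constant is (9 + 13) · 10².
    _ = 2200 * (y * (Real.logb 2 n ^ 2 / (1 - β) ^ 2)) := by rw [hs]; field_simp; ring

/-- No good election is needed: a committee never has more than σ members, and the schedule of a
phase does not affect how many reports are sent. -/
theorem messageCount_le_real (hn : 2 ≤ n) (hk : 1 ≤ k) (hkn : k ≤ n) (hβ0 : 0 ≤ β)
    (hβ : β < 1) (t : ℕ) :
    (messageCount (parallelDownload n k β) adv ω t : ℝ) ≤
      200 * (n * k * Real.logb 2 n / (1 - β) +
        n * Real.logb 2 k * Real.logb 2 n ^ 2 / (1 - β) ^ 2) := by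
  have hL := one_le_logb hn
  have hγ : 0 < 1 - β := by linarith
  have hσ := committeeSize_le hn hβ0 hβ
  have hH := forestHeight_sub_one_le hk hkn
  have hlog : 0 ≤ Real.logb 2 k := Real.logb_nonneg (by norm_num) (by exact_mod_cast hk)
  have h1 := messageCount_le adv ω hk hkn (card_electedCommittee_le ω) t
  set σ := committeeSize n β
  have h2 : (messageCount (parallelDownload n k β) adv ω t : ℝ) ≤
      (forestHeight n k - 1 : ℕ) * (n * (σ * σ)) + n * (σ * k) := by exact_mod_cast h1
  set s := 10 * Real.logb 2 n / (1 - β) with hs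
  have hA : 0 ≤ n * k * Real.logb 2 n / (1 - β) := by positivity
  calc (messageCount (parallelDownload n k β) adv ω t : ℝ)
      ≤ (2 * Real.logb 2 k) * (n * (s * s)) + n * (s * k) := h2.trans (by gcongr)
    _ = 10 * (n * k * Real.logb 2 n / (1 - β)) +
        200 * (n * Real.logb 2 k * Real.logb 2 n ^ 2 / (1 - β) ^ 2) := by
          rw [hs]; field_simp; ring
    _ ≤ _ := by linarith

theorem downloadsWithin_of_goodElection (hn : 2 ≤ n) (hk : 1 ≤ k) (hkn : k ≤ n) (hβ0 : 0 ≤ β)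
    (hβ : β < 1) (h : GoodElection adv ω) {C : ℝ} (hC : 15000 ≤ C) :
    DownloadsWithin (parallelDownload n k β) adv ω
      (C * (n * Real.logb 2 n ^ 3 / ((1 - β) ^ 3 * k)))
      (C * (((n : ℝ) / k + k) * (Real.logb 2 n ^ 2 / (1 - β) ^ 2)))
      (C * (n * k * Real.logb 2 n / (1 - β) +
        n * Real.logb 2 k * Real.logb 2 n ^ 2 / (1 - β) ^ 2)) := by
  have hL := one_le_logb hn
  have hγ : 0 < 1 - β := by linarith
  have hlog : 0 ≤ Real.logb 2 k := Real.logb_nonneg (by norm_num) (by exact_mod_cast hk)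
  refine ⟨⟨electionRounds n k β + (program (electedCommittee n k β ω)).length, ?_, ?_⟩, ?_, ?_⟩
  · refine (rounds_le_of_goodElection hn hk hkn hβ0 hβ h).trans ?_
    exact mul_le_mul_of_nonneg_right (by linarith) (by positivity)
  · exact fun M hM => output_eq (by omega) hk hkn h.1 hM
  · intro t M _
    refine (queryCount_le_of_goodElection hn hk hkn hβ0 hβ h t M).trans ?_
    exact mul_le_mul_of_nonneg_right hC (by positivity)
  · intro t
    refine (messageCount_le_real hn hk hkn hβ0 hβ t).trans ?_
    exact mul_le_mul_of_nonneg_right (by linarith) (by positivity)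

end Bounds

end CCA

/-! ### The main theorem -/

theorem mainTheorem4 :
    ∃ C : ℝ, 0 < C ∧
      ∀ (n k : ℕ) (β : ℝ), 2 ≤ n → 1 ≤ k → k ≤ n → 0 ≤ β → β < 1 →
        ∀ adv : CCA.StaticAdversary n k β,
          CCA.coinMeasure k
              {ω | ¬ CCA.DownloadsWithin (CCA.parallelDownload n k β) adv ω
                (C * (n * Real.logb 2 n ^ 3 / ((1 - β) ^ 3 * k)))
                (C * (((n : ℝ) / k + k) * (Real.logb 2 n ^ 2 / (1 - β) ^ 2)))
                (C * (n * k * Real.logb 2 n / (1 - β) +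
                  n * Real.logb 2 k * Real.logb 2 n ^ 2 / (1 - β) ^ 2))}
            ≤ ENNReal.ofReal (C / n) := by
  -- The first summand covers the cost bounds and the 8/n from wholly Byzantine committees; the
  -- second covers the collisions.
  refine ⟨15000 + Real.exp 64, by positivity, ?_⟩
  intro n k β hn hk hkn hβ0 hβ adv
  have hL := CCA.one_le_logb hn
  have hσ : 0 < CCA.committeeSize n β := by
    have := CCA.logb_le_committeeSize hn hβ0 hβ
    exact_mod_cast (by linarith : (0 : ℝ) < CCA.committeeSize n β)
  refine le_trans (MeasureTheory.measure_mono (t := {ω | ¬ CCA.GoodElection adv ω}) ?_) ?_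
  · intro ω hω hgood
    exact hω (CCA.downloadsWithin_of_goodElection hn hk hkn hβ0 hβ hgood
      (le_add_of_nonneg_right (Real.exp_pos _).le))
  refine (CCA.coinMeasure_not_goodElection_le hn hk hβ0 hσ adv).trans
    (ENNReal.ofReal_le_ofReal ?_)
  refine (add_le_add (CCA.failure_no_honest_le hn hk hkn hβ0 hβ)
    (CCA.failure_collision_le hn hk hkn hβ0 hβ)).trans ?_
  rw [← add_div]
  gcongr
  norm_num
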